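/- **Setting.** Let $(X,d,\mu)$ be a space of homogeneous type: $d$ is a quasi-distance ($d\ge 0$ is symmetric, vanishes exactly on the diagonal, and $d(x,y)\le K[d(x,z)+d(z,y)]$ for some constant $K$), $\mu$ is a measure on a $\sigma$-algebra containing the balls $B(x,r)=\{y: d(x,y)<r\}$, and for some constant $A$ one has $0<\mu(B(x,2r))\le A\,\mu(B(x,r))<\infty$ for all $x\in X$, $r>0$. Let $\mathcal D=\bigcup_{j\in\mathbb Z}\mathcal D^j$ be a dyadic family with parameter $\lambda\in(0,1)$: each $\mathcal D^j$ is a partition of $X$ into measurable sets (cubes); if $Q\in\mathcal D^j$ and $i<j$, there is a unique $\tilde Q\in\mathcal D^i$ with $Q\subseteq\tilde Q$; if $Q\in\mathcal D^j$, $\tilde Q\in\mathcal D^i$ and $i\le j$, then $Q\subseteq \tilde Q$ or $Q\cap\tilde Q=\emptyset$; and there are constants $a_1,a_2>0$ such that every $Q\in\mathcal D^j$ contains a point $x$ with $B(x,a_1\lambda^j)\subseteq Q\subseteq B(x,a_2\lambda^j)$. Assume that $X$ itself is a quadrant: for some $Q\in\mathcal D$, $X$ is the union of all $Q'\in\mathcal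 D$ with $Q\subseteq Q'$. Put $\tilde{\mathcal D}^j=\{Q\in\mathcal D^j: Q \text{ contains more than one cube of } \mathcal D^{j+1}\}$ and $\tilde{\mathcal D}=\bigcup_j\tilde{\mathcal D}^j$. For $Q\in\tilde{\mathcal D}^j$ (the level $j$ is unique) let $\mathcal L(Q)=\{R\in\mathcal D^{j+1}:R\subseteq Q\}$. The dyadic metric is $\delta(x,x)=0$ and $\delta(x,y)=\min\{\mu(Q):x,y\in Q\in\tilde{\mathcal D}\}$ for $x\ne y$. Let $\mathcal H$ be a Haar system associated to $\mathcal D$: a family of simple measurable real functions that is an orthonormal basis of the real space $L^2(X,\mu)$ such that 1. for each $h\in\mathcal H$ there are a unique $j\in\mathbb Z$ and a cube $Q(h)\in\tilde{\mathcal D}^j$ such that $\{h\neq0\}\subseteq Q(h)$ while no cube of $\mathcal D^{j+1}$ contains $\{h\ne 0\}$; 2. for each $Q\in\tilde{\mathcal D}$ the set $\mathcal H(Q)=\{h\in\mathcal H:Q(h)=Q\}$ has exactly $\#\mathcal L(Q)-1$ elements; 3. $\int_X h\,d\mu=0$ for $h\in\mathcal H$; 4. for each $Q\in\tilde{\mathcal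 D}$, $\{\chi_Q/\mu(Q)^{1/2}\}\cup\mathcal H(Q)$ is an orthonormal basis of the space of all functions on $Q$ that are constant on each $R\in\mathcal L(Q)$; 5. there is $C>0$ with $|h(x)|\le C|h(y)|$ for almost every $x$ and $y$ in $Q(h)$, for all $h\in\mathcal H$. Put $\mathcal H(R)=\emptyset$ if $R\in\mathcal D\setminus\tilde{\mathcal D}$. Let $\mathcal S(\mathcal H)$ be the linear span of $\mathcal H$. A bounded linear operator $T:L^2\to L^2$ is *of Calderón–Zygmund type in $(X,\delta,\mu)$* if there is $K\in L^1_{loc}(X\times X\setminus\Delta)$ ($\Delta$ the diagonal; $K$ is integrable over $B_\delta(x,r)\times B_\delta(y,r)$ for some $r>0$, whenever $x\neq y$) such that 1. $|K(x,y)|\le C/\delta(x,y)$ for $x\neq y$, for some $C>0$; 2. for some $C,\gamma>0$ and all $x\ne y$: $|K(x',y)-K(x,y)|\le C\,\delta(x',x)^\gamma/\delta(x,y)^{1+\gamma}$ if $2\delta(x',x)\le\delta(x,y)$, and $|K(x,y')-K(x,y)|\le C\,\delta(y,y')^\gamma/\delta(x,y)^{1+\gamma}$ if $2\delta(y',y)\le\delta(x,y)$;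 3. for $\varphi,\psi\in\mathcal S(\mathcal H)$ with $\{\varphi\ne 0\}\cap\{\psi\neq 0\}=\emptyset$, $\langle T\varphi,\psi\rangle=\iint_{X\times X}K(x,y)\varphi(x)\psi(y)\,d(\mu\times\mu)(x,y)$, the integral being absolutely convergent. **Theorem.** In this setting, let $(\alpha_h)_{h\in\mathcal H}$ be a bounded family of real numbers. Then for every $f\in L^2(X,\mu)$ the series $$\mathcal Pf=\sum_{Q\in\tilde{\mathcal D}}\ \sum_{h\in\mathcal H(Q)}\langle f,h\rangle\Big(\sum_{R\in\mathcal L(Q)}\ \sum_{\tilde h\in\mathcal H(R)}\alpha_{\tilde h}\,\tilde h\Big)$$ (whose inner sums are finite) converges unconditionally in $L^2(X,\mu)$, it defines a bounded linear operator $\mathcal P$ on $L^2(X,\mu)$, and $\mathcal P$ is of Calderón–Zygmund type in $(X,\delta,\mu)$. Moreover: - for every $1<p<\infty$, $\mathcal P$ is bounded on $L^p$: the restriction of $\mathcal P$ to $L^2\cap L^p$ extends to a bounded linear operator on $L^p(X,\mu)$; - $\mathcal P$ is of weak type $(1,1)$: the restriction of $\mathcal P$ to $L^1\cap L^2$ extends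 to a linear map $\mathcal P_1$ from $L^1(X,\mu)$ to the measurable functions (modulo null sets), and for some constant $C$, $\mu(\{|\mathcal P_1f|>t\})\le C\|f\|_{1}/t$ for all $f\in L^1(X,\mu)$ and $t>0$. -/

import Mathlib

open MeasureTheory
open scoped ENNReal NNReal

noncomputable section

namespace DyadicCZ

variable {X : Type*}

/-! ### Spaces of homogeneous type -/

/-- A quasi-distance on a set `X`. -/
structure IsQuasiDist (d : X → X → ℝ) : Prop where
  nonneg : ∀ x y, 0 ≤ d x y
  symm : ∀ x y, d x y = d y x
  eq_zero_iff : ∀ x y, d x y = 0 ↔ x = y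
  quasi_triangle : ∃ K : ℝ, ∀ x y z, d x y ≤ K * (d x z + d z y)

/-- The ball `B(x, r)` of a quasi-distance. -/
def ball (d : X → X → ℝ) (x : X) (r : ℝ) : Set X := {y | d x y < r}

/-- `(X, d, μ)` is a space of homogeneous type: `d` is a quasi-distance, the σ-algebra contains the
balls, and `μ` is doubling, with balls of positive finite measure. -/
structure IsHomogeneousType [MeasurableSpace X] (d : X → X → ℝ) (μ : Measure X) : Prop where
  quasiDist : IsQuasiDist d
  measurableSet_ball : ∀ x r, MeasurableSet (ball d x r)
  doubling : ∃ A : ℝ≥0, ∀ x, ∀ r : ℝ, 0 < r →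
    0 < μ (ball d x (2 * r)) ∧ μ (ball d x (2 * r)) ≤ A * μ (ball d x r) ∧ μ (ball d x r) < ⊤

/-! ### Dyadic families -/

/-- `D = ⋃ⱼ D j` is a dyadic family with parameter `lam`. -/
structure IsDyadicFamily [MeasurableSpace X] (d : X → X → ℝ) (lam : ℝ)
    (D : ℤ → Set (Set X)) : Prop where
  lam_pos : 0 < lam
  lam_lt_one : lam < 1
  measurableSet : ∀ j, ∀ Q ∈ D j, MeasurableSet Q
  disjoint : ∀ j, ∀ Q ∈ D j, ∀ Q' ∈ D j, Q ≠ Q' → Disjoint Q Q'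
  cover : ∀ j, ⋃₀ D j = Set.univ
  ancestor : ∀ i j, i < j → ∀ Q ∈ D j, ∃! Q', Q' ∈ D i ∧ Q ⊆ Q'
  nested : ∀ i j, i ≤ j → ∀ Q ∈ D j, ∀ Q' ∈ D i, Q ⊆ Q' ∨ Disjoint Q Q'
  inner_outer_ball : ∃ a₁ a₂ : ℝ, 0 < a₁ ∧ 0 < a₂ ∧ ∀ j, ∀ Q ∈ D j, ∃ x ∈ Q,
    ball d x (a₁ * lam ^ j) ⊆ Q ∧ Q ⊆ ball d x (a₂ * lam ^ j)

/-- The cubes of level `j` that split, i.e. that contain more than one cube of level `j + 1`. -/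
def splitLevel (D : ℤ → Set (Set X)) (j : ℤ) : Set (Set X) :=
  {Q ∈ D j | 1 < {Q' ∈ D (j + 1) | Q' ⊆ Q}.encard}

/-- All the cubes that split (the reduced dyadic family). -/
def splitCubes (D : ℤ → Set (Set X)) : Set (Set X) := ⋃ j, splitLevel D j

/-- The children of a cube `Q` of the reduced family: the cubes of level `j + 1` contained in `Q`,
where `j` is the (unique) level at which `Q` splits. -/
def children (D : ℤ → Set (Set X)) (Q : Set X) : Set (Set X) :=
  {R | ∃ j, Q ∈ splitLevel D j ∧ R ∈ D (j + 1) ∧ R ⊆ Q}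

/-- The quadrant of `X` that contains `Q`: the union of all dyadic cubes containing `Q`. -/
def quadrant (D : ℤ → Set (Set X)) (Q : Set X) : Set X :=
  ⋃₀ {Q' | (∃ j, Q' ∈ D j) ∧ Q ⊆ Q'}

/-- `X` itself is a quadrant for `D`. -/
def IsQuadrant (D : ℤ → Set (Set X)) : Prop :=
  ∃ j, ∃ Q ∈ D j, quadrant D Q = Set.univ

open Classical in
/-- The dyadic metric: `δ(x, y)` is the least measure of a cube of the reduced family that contains
both `x` and `y`, if `x ≠ y`, and `0` if `x = y`. -/
def dyadicDist [MeasurableSpace X] (μ : Measure X) (D : ℤ → Set (Set X)) (x y : X) : ℝ :=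
  if x = y then 0 else sInf {r | ∃ Q ∈ splitCubes D, x ∈ Q ∧ y ∈ Q ∧ r = μ.real Q}

/-! ### Haar systems -/

/-- `Q` is a cube that splits at level `j`, it contains `{h ≠ 0}`, and no cube of level `j + 1`
contains `{h ≠ 0}`. For a member `h` of a Haar system there is exactly one such `Q`, which is
`Q(h)`. -/
def IsHaarCube (D : ℤ → Set (Set X)) (h : X → ℝ) (j : ℤ) (Q : Set X) : Prop :=
  Q ∈ splitLevel D j ∧ Function.support h ⊆ Q ∧ ∀ Q' ∈ D (j + 1), ¬ Function.support h ⊆ Q'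

/-- `H(Q)`, the functions `h` in `H` with `Q(h) = Q`; it is empty if `Q` is a cube that does not
belong to the reduced family. -/
def haarAt (D : ℤ → Set (Set X)) (H : Set (X → ℝ)) (Q : Set X) : Set (X → ℝ) :=
  {h ∈ H | ∃ j, IsHaarCube D h j Q}

/-- `V_Q`: the functions on `Q`, extended by zero to `X`, that are constant on each child of `Q`. -/
def childConst (D : ℤ → Set (Set X)) (Q : Set X) : Submodule ℝ (X → ℝ) where
  carrier := {f | (∀ x, x ∉ Q → f x = 0) ∧ ∀ R ∈ children D Q, ∀ x ∈ R, ∀ y ∈ R, f x = f y}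
  add_mem' := by
    rintro f g ⟨hf, hf'⟩ ⟨hg, hg'⟩
    refine ⟨fun x hx => ?_, fun R hR x hx y hy => ?_⟩
    · simp [hf x hx, hg x hx]
    · simp [hf' R hR x hx y hy, hg' R hR x hx y hy]
  zero_mem' := ⟨fun _ _ => rfl, fun _ _ _ _ _ _ => rfl⟩
  smul_mem' := by
    rintro c f ⟨hf, hf'⟩
    refine ⟨fun x hx => ?_, fun R hR x hx y hy => ?_⟩
    · simp [hf x hx]
    · simp [hf' R hR x hx y hy]

/-- `χ_Q / μ(Q)^{1/2}`. -/
def normalizedIndicator [MeasurableSpace X] (μ : Measure X) (Q : Set X) : X → ℝ :=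
  Q.indicator fun _ => (Real.sqrt (μ.real Q))⁻¹

/-- `H` is a Haar system associated to the dyadic family `D`. -/
structure IsHaarSystem [MeasurableSpace X] (μ : Measure X) (D : ℤ → Set (Set X))
    (H : Set (X → ℝ)) : Prop where
  /-- The members of `H` are simple measurable functions. -/
  measurable : ∀ h ∈ H, Measurable h
  finite_range : ∀ h ∈ H, (Set.range h).Finite
  /-- `H` is an orthonormal basis of `L²(X, μ)`. -/
  hilbertBasis : ∃ b : HilbertBasis H ℝ (Lp ℝ 2 μ), ∀ h : H, (b h : X → ℝ) =ᵐ[μ] (h : X → ℝ)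
  cube : ∀ h ∈ H, ∃! j, ∃ Q, IsHaarCube D h j Q
  card : ∀ Q ∈ splitCubes D, (haarAt D H Q).encard + 1 = (children D Q).encard
  integral_eq_zero : ∀ h ∈ H, ∫ x, h x ∂μ = 0
  /-- `{χ_Q / μ(Q)^{1/2}} ∪ H(Q)` is an orthonormal basis of `V_Q`: it spans `V_Q`, ... -/
  span_eq : ∀ Q ∈ splitCubes D,
    Submodule.span ℝ (insert (normalizedIndicator μ Q) (haarAt D H Q)) = childConst D Q
  /-- ... its elements have norm one, ... -/
  norm_eq_one : ∀ Q ∈ splitCubes D, ∀ f ∈ insert (normalizedIndicator μ Q) (haarAt D H Q),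
    ∫ x in Q, f x * f x ∂μ = 1
  /-- ... and they are pairwise orthogonal. -/
  orthogonal : ∀ Q ∈ splitCubes D, ∀ f ∈ insert (normalizedIndicator μ Q) (haarAt D H Q),
    ∀ g ∈ insert (normalizedIndicator μ Q) (haarAt D H Q), f ≠ g →
      ∫ x in Q, f x * g x ∂μ = 0
  comparable : ∃ C : ℝ, 0 < C ∧ ∀ Q ∈ splitCubes D, ∀ h ∈ haarAt D H Q,
    ∀ᵐ x ∂(μ.restrict Q), ∀ᵐ y ∂(μ.restrict Q), |h x| ≤ C * |h y|

/-! ### Calderón–Zygmund operators -/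

/-- `T` is an operator of Calderón–Zygmund type in `(X, δ, μ)`, the kernel representation being
tested on the functions of the space `S`.

Exchanging the two variables of `K` preserves every condition on the kernel, so that the order of
the variables in the representation formula is immaterial. -/
def IsCalderonZygmund [MeasurableSpace X] (δ : X → X → ℝ) (μ : Measure X)
    (S : Submodule ℝ (X → ℝ)) (T : Lp ℝ 2 μ →L[ℝ] Lp ℝ 2 μ) : Prop :=
  ∃ K : X → X → ℝ,
    -- `K` is locally integrable off the diagonal
    (∀ x y, x ≠ y → ∃ r : ℝ, 0 < r ∧
      IntegrableOn (fun z : X × X => K z.1 z.2) (ball δ x r ×ˢ ball δ y r) (μ.prod μ)) ∧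
    -- size
    (∃ C : ℝ, 0 < C ∧ ∀ x y, x ≠ y → |K x y| ≤ C / δ x y) ∧
    -- smoothness
    (∃ C γ : ℝ, 0 < C ∧ 0 < γ ∧
      (∀ x x' y, x ≠ y → 2 * δ x' x ≤ δ x y →
        |K x' y - K x y| ≤ C * (δ x' x ^ γ / δ x y ^ (1 + γ))) ∧
      (∀ x y y', x ≠ y → 2 * δ y' y ≤ δ x y →
        |K x y' - K x y| ≤ C * (δ y y' ^ γ / δ x y ^ (1 + γ)))) ∧
    -- representation
    (∀ φ ∈ S, ∀ ψ ∈ S, Disjoint (Function.support φ) (Function.support ψ) →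
      ∀ F G : Lp ℝ 2 μ, F =ᵐ[μ] φ → G =ᵐ[μ] ψ →
        Integrable (fun z : X × X => K z.1 z.2 * φ z.1 * ψ z.2) (μ.prod μ) ∧
        inner ℝ (T F) G = ∫ z : X × X, K z.1 z.2 * φ z.1 * ψ z.2 ∂(μ.prod μ))

/-- The operator `T`, defined on `L²`, is bounded on `L^p`: its restriction to `L² ∩ L^p` extends to
a bounded linear operator on `L^p`. -/
def IsBoundedOnLp [MeasurableSpace X] {μ : Measure X} (T : Lp ℝ 2 μ →L[ℝ] Lp ℝ 2 μ)
    (p : ℝ≥0∞) [Fact (1 ≤ p)] : Prop :=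
  ∃ Tp : Lp ℝ p μ →L[ℝ] Lp ℝ p μ,
    ∀ (f : Lp ℝ 2 μ) (g : Lp ℝ p μ), f =ᵐ[μ] g → Tp g =ᵐ[μ] T f

/-- The operator `T`, defined on `L²`, is of weak type `(1,1)`: its restriction to `L¹ ∩ L²` extends
to a linear map from `L¹` to measurable functions, with `μ {|T₁ f| > t} ≤ C ‖f‖₁ / t`. -/
def IsWeakTypeOneOne [MeasurableSpace X] {μ : Measure X} (T : Lp ℝ 2 μ →L[ℝ] Lp ℝ 2 μ) : Prop :=
  ∃ T₁ : Lp ℝ 1 μ →ₗ[ℝ] (X →ₘ[μ] ℝ),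
    (∀ (f : Lp ℝ 2 μ) (g : Lp ℝ 1 μ), f =ᵐ[μ] g → T₁ g =ᵐ[μ] T f) ∧
    ∃ C : ℝ, ∀ (f : Lp ℝ 1 μ) (t : ℝ), 0 < t →
      μ {x | t < |T₁ f x|} ≤ ENNReal.ofReal (C * ‖f‖ / t)

/-! ### The Petermichl type operator -/

open Classical in
/-- The class in `L²` of a square integrable function (every Haar function is one). -/
def toL2 [MeasurableSpace X] (μ : Measure X) (h : X → ℝ) : Lp ℝ 2 μ :=
  if hh : MemLp h 2 μ then hh.toLp h else 0

/-- `∑_{R child of Q} ∑_{g ∈ H(R)} α_g g`, a finite sum. -/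
def petermichlBlock [MeasurableSpace X] (μ : Measure X) (D : ℤ → Set (Set X)) (H : Set (X → ℝ))
    (α : (X → ℝ) → ℝ) (Q : Set X) : Lp ℝ 2 μ :=
  ∑ᶠ R ∈ children D Q, ∑ᶠ g ∈ haarAt D H R, α g • toL2 μ g

/-- The term of the series for `P f` that belongs to the cube `Q`, namely
`∑_{h ∈ H(Q)} ⟨f, h⟩ (∑_{R child of Q} ∑_{g ∈ H(R)} α_g g)`, a finite sum. -/
def petermichlTerm [MeasurableSpace X] (μ : Measure X) (D : ℤ → Set (Set X)) (H : Set (X → ℝ))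
    (α : (X → ℝ) → ℝ) (f : Lp ℝ 2 μ) (Q : Set X) : Lp ℝ 2 μ :=
  ∑ᶠ h ∈ haarAt D H Q, inner ℝ f (toL2 μ h) • petermichlBlock μ D H α Q

end DyadicCZ

end

/-! All Haar functions of a cube $Q$ multiply the same block, so the operator is a sum of rank one
operators $\sum_Q \langle f,u_Q\rangle v_Q$ over the splitting cubes: $u_Q=\sum_{h\in\mathcal
H(Q)}h$ and $v_Q$ is the $\alpha$-weighted sum of the Haar functions of the children of $Q$. Both
families have the properties collected in `IsAtomFamily`: support in $Q$, size $O(\mu(Q)^{-1/2})$,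
mutual orthogonality, and constancy on every cube whose parent does not contain $Q$ ($u_Q$ is
constant on children, $v_Q$ on grandchildren). The rest of the argument uses only these properties.
They are symmetric in $u$ and $v$, so whatever holds for $P$ holds for its adjoint.

Boundedness on $L^2$ is Bessel's inequality for $u$ followed by orthogonality of $v$
(`exists_hasSum_inner_smul`).

The kernel is $K(x,y)=\sum_Q u_Q(x)v_Q(y)$. Only cubes containing both points contribute. They form
a chain along which measures grow geometrically, so the sum is comparable to its first term,
$1/\delta(x,y)$ (`sum_inv_measure_le`). For smoothness, with exponent $\gamma=1$, let $Q_1$ be the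
least cube containing $y,y'$. Every term with $x \in Q$ is constant in the second variable on $Q_1$
unless the parent of $Q_1$ contains $x$. In the exceptional case doubling makes $\delta(x,y)$ and
$\delta(y,y')$ comparable, and the size estimate is enough (`abs_atomKernel_sub_le`).

For weak type $(1,1)$, the Calderón–Zygmund bad part has mean zero on each stopping cube $S$. It is
therefore orthogonal to every $u_Q$ with $Q$ in no parent of a stopping cube, and its image vanishes
identically outside the union of these parents (`measure_lt_abs_le_of_levelConst`). No kernel
estimate is needed. The decomposition is made for functions constant on the cubes of one level,
which avoids differentiation of integrals. Density of the Haar functions then gives $L^1\cap L^2$,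
and a limiting argument gives $L^1$. Marcinkiewicz interpolation with $L^2$ covers $1<p<2$; duality
with the operator in which $u$ and $v$ are exchanged covers $p>2$.

Parents must exist for every cube. They do because $\mu(X)=\infty$: otherwise the constant $1$ would
be a nonzero element of $L^2$ orthogonal to the whole Haar basis. -/

namespace DyadicCZ

/-! ### Combinatorics and measure of dyadic cubes -/

section Geometry

variable {X : Type*} {D : ℤ → Set (Set X)}

/-- `Q` is a dyadic cube, of whatever level. -/
def IsCube (D : ℤ → Set (Set X)) (Q : Set X) : Prop := ∃ j, Q ∈ D j

theorem isCube_of_mem_splitCubes {Q : Set X} (hQ : Q ∈ splitCubes D) : IsCube D Q := by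
  obtain ⟨j, hj⟩ := Set.mem_iUnion.1 hQ
  exact ⟨j, hj.1⟩

theorem isCube_of_mem_children {Q R : Set X} (hR : R ∈ children D Q) : IsCube D R := by
  obtain ⟨j, -, h, -⟩ := hR
  exact ⟨_, h⟩

theorem subset_of_mem_children {Q R : Set X} (hR : R ∈ children D Q) : R ⊆ Q := by
  obtain ⟨j, -, -, h⟩ := hR
  exact h

theorem mem_splitCubes_of_mem_children {Q R : Set X} (hR : R ∈ children D Q) :
    Q ∈ splitCubes D := by
  obtain ⟨j, h, -⟩ := hR
  exact Set.mem_iUnion.2 ⟨j, h⟩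

theorem splitLevel_of_two {j : ℤ} {Q R R' : Set X} (hQ : Q ∈ D j)
    (hR : R ∈ D (j + 1)) (hR' : R' ∈ D (j + 1)) (h : R ⊆ Q) (h' : R' ⊆ Q) (hne : R ≠ R') :
    Q ∈ splitLevel D j :=
  ⟨hQ, Set.one_lt_encard_iff.2 ⟨R, R', ⟨hR, h⟩, ⟨hR', h'⟩, hne⟩⟩

variable [MeasurableSpace X] {d : X → X → ℝ} {μ : Measure X} {lam : ℝ}

namespace IsDyadicFamily

theorem nonempty (hD : IsDyadicFamily d lam D) {Q : Set X} (hQ : IsCube D Q) : Q.Nonempty := by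
  obtain ⟨j, hj⟩ := hQ
  obtain ⟨a₁, a₂, -, -, h⟩ := hD.inner_outer_ball
  obtain ⟨x, hx, -⟩ := h j Q hj
  exact ⟨x, hx⟩

theorem measurableSet_cube (hD : IsDyadicFamily d lam D) {Q : Set X} (hQ : IsCube D Q) :
    MeasurableSet Q := by
  obtain ⟨j, hj⟩ := hQ
  exact hD.measurableSet j Q hj

theorem exists_mem (hD : IsDyadicFamily d lam D) (j : ℤ) (x : X) : ∃ Q ∈ D j, x ∈ Q := by
  have : x ∈ ⋃₀ D j := by rw [hD.cover j]; trivial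
  obtain ⟨Q, hQ, hx⟩ := this
  exact ⟨Q, hQ, hx⟩

theorem eq_of_mem (hD : IsDyadicFamily d lam D) {j : ℤ} {Q Q' : Set X} (hQ : Q ∈ D j)
    (hQ' : Q' ∈ D j) {x : X} (hx : x ∈ Q) (hx' : x ∈ Q') : Q = Q' := by
  by_contra h
  exact Set.disjoint_left.1 (hD.disjoint j Q hQ Q' hQ' h) hx hx'

theorem subset_of_le (hD : IsDyadicFamily d lam D) {i j : ℤ} (hij : i ≤ j) {Q Q' : Set X}
    (hQ : Q ∈ D j) (hQ' : Q' ∈ D i) {x : X} (hx : x ∈ Q) (hx' : x ∈ Q') : Q ⊆ Q' := by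
  rcases hD.nested i j hij Q hQ Q' hQ' with h | h
  · exact h
  · exact absurd hx' (Set.disjoint_left.1 h hx)

theorem subset_or_subset (hD : IsDyadicFamily d lam D) {Q Q' : Set X} (hQ : IsCube D Q)
    (hQ' : IsCube D Q') {x : X} (hx : x ∈ Q) (hx' : x ∈ Q') : Q ⊆ Q' ∨ Q' ⊆ Q := by
  obtain ⟨j, hj⟩ := hQ
  obtain ⟨i, hi⟩ := hQ'
  rcases le_total i j with h | h
  · exact Or.inl (hD.subset_of_le h hj hi hx hx')
  · exact Or.inr (hD.subset_of_le h hi hj hx' hx)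

/-- The same set can be a cube at many consecutive levels; it splits at the last of them. At any
later level it would be contained in a single cube of level `i + 1`, against the existence of two.
-/
theorem level_le_of_splitLevel (hD : IsDyadicFamily d lam D) {i j : ℤ} {Q : Set X}
    (hi : Q ∈ splitLevel D i) (hj : Q ∈ D j) : j ≤ i := by
  by_contra! hlt
  obtain ⟨R, R', ⟨hR, hRQ⟩, ⟨hR', hRQ'⟩, hne⟩ := Set.one_lt_encard_iff.1 hi.2
  obtain ⟨x, hx⟩ := hD.nonempty ⟨_, hR⟩
  obtain ⟨y, hy⟩ := hD.nonempty ⟨_, hR'⟩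
  have h1 : Q ⊆ R := hD.subset_of_le (by omega) hj hR (hRQ hx) hx
  exact hne (hD.eq_of_mem hR hR' (h1 (hRQ' hy)) hy)

theorem splitLevel_unique (hD : IsDyadicFamily d lam D) {i j : ℤ} {Q : Set X}
    (hi : Q ∈ splitLevel D i) (hj : Q ∈ splitLevel D j) : i = j :=
  le_antisymm (hD.level_le_of_splitLevel hj hi.1) (hD.level_le_of_splitLevel hi hj.1)

theorem children_eq_of_mem (hD : IsDyadicFamily d lam D) {Q R R' : Set X}
    (hR : R ∈ children D Q) (hR' : R' ∈ children D Q) {x : X} (hx : x ∈ R) (hx' : x ∈ R') :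
    R = R' := by
  obtain ⟨j, hj, h, -⟩ := hR
  obtain ⟨i, hi, h', -⟩ := hR'
  obtain rfl := hD.splitLevel_unique hi hj
  exact hD.eq_of_mem h h' hx hx'

theorem children_ssubset (hD : IsDyadicFamily d lam D) {Q R : Set X} (hR : R ∈ children D Q) :
    R ⊂ Q := by
  refine ⟨subset_of_mem_children hR, fun hQR => ?_⟩
  obtain ⟨j, hj, h, hRQ⟩ := hR
  have := hD.level_le_of_splitLevel hj (j := j + 1) (by rwa [Set.Subset.antisymm hQR hRQ])
  omega

theorem exists_child (hD : IsDyadicFamily d lam D) {Q : Set X} (hQ : Q ∈ splitCubes D) {x : X}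
    (hx : x ∈ Q) : ∃ R ∈ children D Q, x ∈ R := by
  obtain ⟨j, hj⟩ := Set.mem_iUnion.1 hQ
  obtain ⟨R, hR, hxR⟩ := hD.exists_mem (j + 1) x
  exact ⟨R, ⟨j, hj, hR, hD.subset_of_le (by omega) hR hj.1 hxR hx⟩, hxR⟩

/-- A cube strictly inside a splitting cube lies inside one of its children. -/
theorem exists_child_superset (hD : IsDyadicFamily d lam D) {Q S : Set X}
    (hQ : Q ∈ splitCubes D) (hS : IsCube D S) (h : S ⊂ Q) : ∃ R ∈ children D Q, S ⊆ R := by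
  obtain ⟨x, hx⟩ := hD.nonempty hS
  obtain ⟨R, hR, hxR⟩ := hD.exists_child hQ (h.1 hx)
  refine ⟨R, hR, ?_⟩
  obtain ⟨j, hj, hRj, -⟩ := hR
  obtain ⟨i, hi⟩ := hS
  have hij : j + 1 ≤ i := by
    by_contra! hlt
    exact h.2 (hD.subset_of_le (by omega) hj.1 hi (h.1 hx) hx)
  exact hD.subset_of_le hij hi hRj hx hxR

/-- A cube with a proper subcube splits. -/
theorem mem_splitCubes_of_ssubset (hD : IsDyadicFamily d lam D) {R S : Set X} (hR : IsCube D R)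
    (hS : IsCube D S) (h : S ⊂ R) : R ∈ splitCubes D := by
  obtain ⟨x, hx⟩ := hD.nonempty hS
  obtain ⟨s, hs⟩ := hS
  -- The set `R` may persist over several levels; the last one, bounded by the level of `S`, is
  -- where it splits.
  obtain ⟨k, hk, hmax⟩ := Int.exists_greatest_of_bdd (P := fun k => R ∈ D k)
    ⟨s, fun z hz => by
      by_contra! hlt
      exact h.2 (hD.subset_of_le hlt.le hz hs (h.1 hx) hx)⟩ hR
  obtain ⟨T, hT, hxT⟩ := hD.exists_mem (k + 1) x
  have hTR : T ⊆ R := hD.subset_of_le (by omega) hT hk hxT (h.1 hx)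
  have hne : ¬ R ⊆ T := fun hRT => by
    have := hmax (k + 1) (by rwa [Set.Subset.antisymm hRT hTR])
    omega
  obtain ⟨y, hyR, hyT⟩ := Set.not_subset.1 hne
  obtain ⟨T', hT', hyT'⟩ := hD.exists_mem (k + 1) y
  exact Set.mem_iUnion.2 ⟨k, splitLevel_of_two hk hT hT' hTR
    (hD.subset_of_le (by omega) hT' hk hyT' hyR) (by rintro rfl; exact hyT hyT')⟩

/-- If one parent were strictly inside the other, it would lie in a child of the larger one. By
disjointness that child is `R`, which is strictly smaller than its parent. -/
theorem parent_unique (hD : IsDyadicFamily d lam D) {Q Q' R : Set X} (h : R ∈ children D Q)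
    (h' : R ∈ children D Q') : Q = Q' := by
  have key : ∀ Q Q' : Set X, R ∈ children D Q → R ∈ children D Q' → Q ⊆ Q' → Q' ⊆ Q := by
    intro Q Q' h h' hsub
    by_contra hn
    obtain ⟨R', hR', hQR'⟩ := hD.exists_child_superset (mem_splitCubes_of_mem_children h')
      (isCube_of_mem_splitCubes (mem_splitCubes_of_mem_children h)) ⟨hsub, hn⟩
    obtain ⟨x, hx⟩ := hD.nonempty (isCube_of_mem_children h)
    obtain rfl := hD.children_eq_of_mem h' hR' hx (hQR' (subset_of_mem_children h hx))
    exact (hD.children_ssubset h).2 hQR'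
  obtain ⟨x, hx⟩ := hD.nonempty (isCube_of_mem_children h)
  rcases hD.subset_or_subset (isCube_of_mem_splitCubes (mem_splitCubes_of_mem_children h))
    (isCube_of_mem_splitCubes (mem_splitCubes_of_mem_children h'))
    (subset_of_mem_children h hx) (subset_of_mem_children h' hx) with hs | hs
  · exact hs.antisymm (key _ _ h h' hs)
  · exact (key _ _ h' h hs).antisymm hs

/-- Two points of a quadrant lie in a common cube. -/
theorem exists_common_cube (hD : IsDyadicFamily d lam D) (hq : IsQuadrant D) (x y : X) :
    ∃ Q, IsCube D Q ∧ x ∈ Q ∧ y ∈ Q := by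
  obtain ⟨j, Q, hQ, hu⟩ := hq
  obtain ⟨z, hz⟩ := hD.nonempty ⟨j, hQ⟩
  have hx : x ∈ quadrant D Q := by rw [hu]; trivial
  have hy : y ∈ quadrant D Q := by rw [hu]; trivial
  obtain ⟨A, ⟨hA, hQA⟩, hxA⟩ := hx
  obtain ⟨B, ⟨hB, hQB⟩, hyB⟩ := hy
  rcases hD.subset_or_subset hA hB (hQA hz) (hQB hz) with h | h
  · exact ⟨B, hB, h hxA, hyB⟩
  · exact ⟨A, hA, hxA, h hyB⟩

theorem exists_quasi_triangle (hX : IsHomogeneousType d μ) :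
    ∃ K : ℝ, 1 ≤ K ∧ ∀ x y z, d x y ≤ K * (d x z + d z y) := by
  obtain ⟨K, hK⟩ := hX.quasiDist.quasi_triangle
  refine ⟨max K 1, le_max_right _ _, fun x y z => (hK x y z).trans ?_⟩
  exact mul_le_mul_of_nonneg_right (le_max_left _ _)
    (add_nonneg (hX.quasiDist.nonneg _ _) (hX.quasiDist.nonneg _ _))

/-- Two points of a cube of level `j` are at distance less than a multiple of `lam ^ j`. -/
theorem exists_dist_lt (hD : IsDyadicFamily d lam D) (hX : IsHomogeneousType d μ) :
    ∃ M : ℝ, 0 < M ∧ ∀ j, ∀ Q ∈ D j, ∀ x ∈ Q, ∀ y ∈ Q, d x y < M * lam ^ j := by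
  obtain ⟨K, hK1, hK⟩ := exists_quasi_triangle hX
  obtain ⟨a₁, a₂, h1, h2, hb⟩ := hD.inner_outer_ball
  refine ⟨K * (a₂ + a₂), by positivity, fun j Q hQ x hx y hy => ?_⟩
  obtain ⟨c, -, -, hc⟩ := hb j Q hQ
  have hx' : d c x < a₂ * lam ^ j := hc hx
  have hy' : d c y < a₂ * lam ^ j := hc hy
  rw [hX.quasiDist.symm] at hx'
  calc d x y ≤ K * (d x c + d c y) := hK _ _ _
    _ < K * (a₂ * lam ^ j + a₂ * lam ^ j) := by gcongr
    _ = _ := by ring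

theorem exists_zpow_lt (hD : IsDyadicFamily d lam D) {M ε : ℝ} (hM : 0 < M) (hε : 0 < ε) :
    ∃ b : ℤ, ∀ z : ℤ, ε ≤ M * lam ^ z → z ≤ b := by
  obtain ⟨n, hn⟩ := exists_pow_lt_of_lt_one (div_pos hε hM) hD.lam_lt_one
  refine ⟨n, fun z hz => ?_⟩
  by_contra! hlt
  have h1 : lam ^ z ≤ lam ^ (n : ℤ) :=
    zpow_le_zpow_right_of_le_one₀ hD.lam_pos hD.lam_lt_one.le hlt.le
  rw [zpow_natCast] at h1
  have h2 : M * lam ^ z < ε := by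
    calc M * lam ^ z ≤ M * lam ^ n := by gcongr
      _ < M * (ε / M) := by gcongr
      _ = ε := by field_simp
  linarith

/-- Two distinct points are separated by a smallest cube. -/
theorem exists_least_cube (hD : IsDyadicFamily d lam D) (hX : IsHomogeneousType d μ)
    (hq : IsQuadrant D) {x y : X} (hxy : x ≠ y) :
    ∃ Q ∈ splitCubes D, x ∈ Q ∧ y ∈ Q ∧ ∀ Q', IsCube D Q' → x ∈ Q' → y ∈ Q' → Q ⊆ Q' := by
  obtain ⟨M, hM, hdist⟩ := hD.exists_dist_lt hX
  have hpos : 0 < d x y := lt_of_le_of_ne (hX.quasiDist.nonneg x y)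
    fun h => hxy ((hX.quasiDist.eq_zero_iff x y).1 h.symm)
  obtain ⟨b, hb⟩ := hD.exists_zpow_lt hM hpos
  obtain ⟨Q₀, ⟨j₀, hj₀⟩, hx₀, hy₀⟩ := hD.exists_common_cube hq x y
  -- Cubes shrink like `lam ^ j`, so the levels of cubes containing both points are bounded above.
  -- The deepest such cube separates the points among its children.
  obtain ⟨j, ⟨Q, hQ, hxQ, hyQ⟩, hmax⟩ := Int.exists_greatest_of_bdd
    (P := fun j => ∃ Q ∈ D j, x ∈ Q ∧ y ∈ Q)
    ⟨b, fun z ⟨Q, hQ, hx, hy⟩ => hb z (hdist z Q hQ x hx y hy).le⟩ ⟨j₀, Q₀, hj₀, hx₀, hy₀⟩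
  obtain ⟨R, hR, hxR⟩ := hD.exists_mem (j + 1) x
  obtain ⟨R', hR', hyR'⟩ := hD.exists_mem (j + 1) y
  refine ⟨Q, Set.mem_iUnion.2 ⟨j, splitLevel_of_two hQ hR hR'
    (hD.subset_of_le (by omega) hR hQ hxR hxQ) (hD.subset_of_le (by omega) hR' hQ hyR' hyQ) ?_⟩,
    hxQ, hyQ, fun Q' ⟨i, hi⟩ hx hy => ?_⟩
  · rintro rfl
    have := hmax (j + 1) ⟨R, hR, hxR, hyR'⟩
    omega
  · exact hD.subset_of_le (hmax i ⟨Q', hi, hx, hy⟩) hQ hi hxQ hx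

theorem measure_ball_pos (hX : IsHomogeneousType d μ) (x : X) {r : ℝ} (hr : 0 < r) :
    0 < μ (ball d x r) := by
  obtain ⟨A, hA⟩ := hX.doubling
  have := (hA x (r / 2) (by positivity)).1
  rwa [mul_div_cancel₀ r two_ne_zero] at this

theorem measure_cube_pos (hD : IsDyadicFamily d lam D) (hX : IsHomogeneousType d μ) {Q : Set X}
    (hQ : IsCube D Q) : 0 < μ Q := by
  obtain ⟨j, hj⟩ := hQ
  obtain ⟨a₁, a₂, h1, h2, hb⟩ := hD.inner_outer_ball
  obtain ⟨x, -, hx, -⟩ := hb j Q hj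
  exact (measure_ball_pos hX x (mul_pos h1 (zpow_pos hD.lam_pos j))).trans_le (measure_mono hx)

theorem measure_cube_lt_top (hD : IsDyadicFamily d lam D) (hX : IsHomogeneousType d μ) {Q : Set X}
    (hQ : IsCube D Q) : μ Q < ⊤ := by
  obtain ⟨j, hj⟩ := hQ
  obtain ⟨a₁, a₂, h1, h2, hb⟩ := hD.inner_outer_ball
  obtain ⟨x, -, -, hx⟩ := hb j Q hj
  obtain ⟨A, hA⟩ := hX.doubling
  exact (measure_mono hx).trans_lt (hA x _ (mul_pos h2 (zpow_pos hD.lam_pos j))).2.2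

theorem exists_measure_ball_le (hX : IsHomogeneousType d μ) :
    ∃ A : ℝ≥0, ∀ (n : ℕ) (x : X) (r : ℝ), 0 < r → μ (ball d x (2 ^ n * r)) ≤ A ^ n * μ (ball d x r) := by
  obtain ⟨A, hA⟩ := hX.doubling
  refine ⟨A, fun n x r hr => ?_⟩
  induction n with
  | zero => simp
  | succ n ih =>
    calc μ (ball d x (2 ^ (n + 1) * r)) = μ (ball d x (2 * (2 ^ n * r))) := by ring_nf
      _ ≤ A * μ (ball d x (2 ^ n * r)) := (hA x _ (by positivity)).2.1
      _ ≤ A * (A ^ n * μ (ball d x r)) := by gcongr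
      _ = _ := by ring

/-- The measure of a cube is controlled by that of any of its children. -/
theorem exists_measure_le_child (hD : IsDyadicFamily d lam D) (hX : IsHomogeneousType d μ) :
    ∃ A : ℝ, 2 ≤ A ∧ ∀ Q, ∀ R ∈ children D Q, μ.real Q ≤ A * μ.real R := by
  obtain ⟨A, hA⟩ := exists_measure_ball_le hX
  obtain ⟨M, hM, hdist⟩ := hD.exists_dist_lt hX
  obtain ⟨a₁, a₂, h1, h2, hb⟩ := hD.inner_outer_ball
  have hl := hD.lam_pos
  -- With this `n`, the inner ball of the child, dilated `n` times by 2, swallows the parent: `M *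
  -- lam ^ j ≤ 2 ^ n * (a₁ * lam ^ (j + 1))`. The constant is taken at least 2 so that `1 - 1 / A`
  -- is positive later on.
  obtain ⟨n, hn⟩ := pow_unbounded_of_one_lt (M / (a₁ * lam)) (one_lt_two : (1 : ℝ) < 2)
  refine ⟨max 2 (A ^ n : ℝ≥0), le_max_left _ _, fun Q R hR => ?_⟩
  have hRc := isCube_of_mem_children hR
  have hfin := (hD.measure_cube_lt_top hX hRc).ne
  obtain ⟨j, hj, hRj, hRQ⟩ := hR
  obtain ⟨x, hxR, hx, -⟩ := hb (j + 1) R hRj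
  have hsub : Q ⊆ ball d x (2 ^ n * (a₁ * lam ^ (j + 1))) := fun y hy => by
    refine (hdist j Q hj.1 x (hRQ hxR) y hy).trans_le ?_
    rw [div_lt_iff₀ (by positivity)] at hn
    rw [zpow_add_one₀ hl.ne']
    calc M * lam ^ j ≤ (2 ^ n * (a₁ * lam)) * lam ^ j := by gcongr
      _ = _ := by ring
  have hle : μ Q ≤ (A ^ n : ℝ≥0) * μ R := by
    calc μ Q ≤ μ (ball d x (2 ^ n * (a₁ * lam ^ (j + 1)))) := measure_mono hsub
      _ ≤ A ^ n * μ (ball d x (a₁ * lam ^ (j + 1))) := hA n x _ (mul_pos h1 (zpow_pos hl _))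
      _ ≤ A ^ n * μ R := by gcongr
      _ = _ := by push_cast; rfl
  have hreal : μ.real Q ≤ (A ^ n : ℝ≥0) * μ.real R := by
    have := ENNReal.toReal_mono (ENNReal.mul_ne_top ENNReal.coe_ne_top hfin) hle
    simpa [Measure.real, ENNReal.toReal_mul] using this
  exact hreal.trans (mul_le_mul_of_nonneg_right (le_max_right _ _) measureReal_nonneg)

theorem sigmaFinite (hX : IsHomogeneousType d μ) : SigmaFinite μ := by
  obtain ⟨A, hA⟩ := hX.doubling
  rcases isEmpty_or_nonempty X with h | ⟨⟨x⟩⟩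
  · have : μ = 0 := Measure.eq_zero_of_isEmpty μ
    rw [this]; infer_instance
  · refine ⟨⟨⟨fun n => ball d x (n + 1), fun _ => trivial,
      fun n => (hA x _ (by positivity)).2.2, ?_⟩⟩⟩
    refine Set.eq_univ_of_forall fun y => ?_
    obtain ⟨n, hn⟩ := exists_nat_gt (d x y)
    exact Set.mem_iUnion.2 ⟨n, show d x y < n + 1 by linarith⟩

/-- A disjoint family of sets of positive measure is countable in a σ-finite space. -/
theorem countable_level (hD : IsDyadicFamily d lam D) (hX : IsHomogeneousType d μ) (j : ℤ) :
    (D j).Countable := by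
  have := sigmaFinite hX
  have h := Measure.countable_meas_pos_of_disjoint_iUnion (μ := μ) (As := fun Q : D j => (Q : Set X))
    (fun Q => hD.measurableSet j Q Q.2)
    (fun Q Q' hne => hD.disjoint j Q Q.2 Q' Q'.2 fun h => hne (Subtype.ext h))
  have hall : {Q : D j | 0 < μ (Q : Set X)} = Set.univ :=
    Set.eq_univ_of_forall fun Q => hD.measure_cube_pos hX ⟨j, Q.2⟩
  rw [hall] at h
  exact Set.countable_coe_iff.1 (Set.countable_univ_iff.1 h)

theorem countable_cubes (hD : IsDyadicFamily d lam D) (hX : IsHomogeneousType d μ) :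
    {Q | IsCube D Q}.Countable := by
  have : {Q | IsCube D Q} = ⋃ j, D j := by ext Q; simp [IsCube]
  rw [this]
  exact Set.countable_iUnion fun j => hD.countable_level hX j

/-- Going up from the first level at which `S` occurs gives a strictly larger cube, hence a
splitting one. Such a first level exists because some cube also contains a point outside `S`. -/
theorem exists_parent (hD : IsDyadicFamily d lam D) (hq : IsQuadrant D) {S : Set X}
    (hS : IsCube D S) (hne : S ≠ Set.univ) : ∃ Q, S ∈ children D Q := by
  obtain ⟨x, hx⟩ := hD.nonempty hS
  obtain ⟨y, hy⟩ := (Set.ne_univ_iff_exists_notMem S).1 hne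
  obtain ⟨Q, ⟨i, hi⟩, hxQ, hyQ⟩ := hD.exists_common_cube hq x y
  obtain ⟨j, hj⟩ := hS
  -- the least level at which `S` is a cube
  obtain ⟨k, hk, hmin⟩ := Int.exists_least_of_bdd (P := fun k => S ∈ D k)
    ⟨i, fun z hz => by
      by_contra! hlt
      exact hy (hD.subset_of_le hlt.le hi hz hxQ hx hyQ)⟩ ⟨j, hj⟩
  obtain ⟨T, hT, hxT⟩ := hD.exists_mem (k - 1) x
  have hST : S ⊆ T := hD.subset_of_le (by omega) hk hT hx hxT
  have hTS : ¬ T ⊆ S := fun h => by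
    have := hmin (k - 1) (by rwa [hST.antisymm h])
    omega
  obtain ⟨z, hzT, hzS⟩ := Set.not_subset.1 hTS
  have hk1 : k - 1 + 1 = k := by omega
  obtain ⟨S', hS', hzS'⟩ := hD.exists_mem k z
  refine ⟨T, k - 1, splitLevel_of_two hT (by rwa [hk1]) (R' := S') (by rwa [hk1]) hST
    (hD.subset_of_le (by omega) hS' hT hzS' hzT) ?_, by rwa [hk1], hST⟩
  rintro rfl
  exact hzS hzS'

end IsDyadicFamily

end Geometry

/-! ### Geometric growth of measures, the dyadic metric, and bounds for Haar functions -/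

section Tree

variable {X : Type*}

theorem mem_splitCubes_of_mem_haarAt {D : ℤ → Set (Set X)} {H : Set (X → ℝ)} {Q : Set X}
    {h : X → ℝ} (hh : h ∈ haarAt D H Q) : Q ∈ splitCubes D := by
  obtain ⟨-, j, hj, -⟩ := hh
  exact Set.mem_iUnion.2 ⟨j, hj⟩

variable [MeasurableSpace X]

/-- A dyadic family on a space of homogeneous type of infinite measure that is a quadrant, with a
constant `A` that controls the measure of a cube by the measure of its children. -/
structure IsRegularTree (d : X → X → ℝ) (μ : Measure X) (lam : ℝ) (D : ℤ → Set (Set X))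
    (A : ℝ) : Prop where
  homogeneous : IsHomogeneousType d μ
  dyadic : IsDyadicFamily d lam D
  quadrant : IsQuadrant D
  two_le : 2 ≤ A
  measure_le_child : ∀ Q, ∀ R ∈ children D Q, μ.real Q ≤ A * μ.real R
  measure_univ : μ Set.univ = ⊤

namespace IsRegularTree

variable {d : X → X → ℝ} {μ : Measure X} {lam : ℝ} {D : ℤ → Set (Set X)} {A : ℝ}

theorem measure_ne_top (T : IsRegularTree d μ lam D A) {Q : Set X} (hQ : IsCube D Q) : μ Q ≠ ⊤ :=
  (T.dyadic.measure_cube_lt_top T.homogeneous hQ).ne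

theorem measureReal_pos (T : IsRegularTree d μ lam D A) {Q : Set X} (hQ : IsCube D Q) :
    0 < μ.real Q :=
  ENNReal.toReal_pos (T.dyadic.measure_cube_pos T.homogeneous hQ).ne' (T.measure_ne_top hQ)

theorem measureReal_le (T : IsRegularTree d μ lam D A) {Q Q' : Set X} (hQ' : IsCube D Q')
    (h : Q ⊆ Q') : μ.real Q ≤ μ.real Q' :=
  measureReal_mono h (T.measure_ne_top hQ')

theorem exists_parent (T : IsRegularTree d μ lam D A) {S : Set X} (hS : IsCube D S) :
    ∃ Q, S ∈ children D Q :=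
  T.dyadic.exists_parent T.quadrant hS fun h => T.measure_ne_top hS (h ▸ T.measure_univ)

/-- The children of a cube are finite in number, and their number is bounded. -/
theorem encard_children_le (T : IsRegularTree d μ lam D A) (Q : Set X) :
    (children D Q).encard ≤ (⌊A⌋₊ : ℕ) := by
  by_contra! hlt
  obtain ⟨t, ht, hcard⟩ := Set.exists_subset_encard_eq
    (show ((⌊A⌋₊ + 1 : ℕ) : ℕ∞) ≤ (children D Q).encard from by
      rw [Nat.cast_add_one]; exact Order.add_one_le_of_lt hlt)
  have hfin : t.Finite := Set.finite_of_encard_eq_coe hcard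
  obtain ⟨s, rfl⟩ := hfin.exists_finset_coe
  rw [Set.encard_coe_eq_coe_finsetCard] at hcard
  have hcard' : s.card = ⌊A⌋₊ + 1 := by exact_mod_cast hcard
  obtain ⟨R, hR⟩ : s.Nonempty := Finset.card_pos.1 (by omega)
  have hQ := mem_splitCubes_of_mem_children (ht hR)
  have hQc := isCube_of_mem_splitCubes hQ
  have hsum : ∑ R ∈ s, μ.real R ≤ μ.real Q := by
    rw [← measureReal_biUnion_finset (f := fun R => R)
      (fun R hR R' hR' hne => Set.disjoint_left.2 fun x hx hx' =>
        hne (T.dyadic.children_eq_of_mem (ht hR) (ht hR') hx hx'))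
      (fun R hR => T.dyadic.measurableSet_cube (isCube_of_mem_children (ht hR)))
      (fun R hR => T.measure_ne_top (isCube_of_mem_children (ht hR)))]
    exact T.measureReal_le hQc (Set.iUnion₂_subset fun R hR => subset_of_mem_children (ht hR))
  have hle : (s.card : ℝ) * μ.real Q ≤ A * μ.real Q := by
    calc (s.card : ℝ) * μ.real Q = ∑ R ∈ s, μ.real Q := by simp
      _ ≤ ∑ R ∈ s, A * μ.real R := Finset.sum_le_sum fun R hR => T.measure_le_child Q R (ht hR)
      _ ≤ A * μ.real Q := by
        rw [← Finset.mul_sum]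
        exact mul_le_mul_of_nonneg_left hsum (by linarith [T.two_le])
  have h1 := le_of_mul_le_mul_right hle (T.measureReal_pos hQc)
  have h2 := Nat.lt_floor_add_one A
  rw [hcard'] at h1
  push_cast at h1
  linarith

theorem finite_children (T : IsRegularTree d μ lam D A) (Q : Set X) : (children D Q).Finite :=
  Set.finite_of_encard_le_coe (T.encard_children_le Q)

/-- Measures grow geometrically along chains of splitting cubes. -/
theorem measureReal_le_of_ssubset (T : IsRegularTree d μ lam D A) {Q Q' : Set X}
    (hQ : IsCube D Q) (hQ' : IsCube D Q') (h : Q ⊂ Q') :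
    μ.real Q ≤ (1 - 1 / A) * μ.real Q' := by
  have hA : 0 < A := by linarith [T.two_le]
  have hsplit := T.dyadic.mem_splitCubes_of_ssubset hQ' hQ h
  obtain ⟨R, hR, hQR⟩ := T.dyadic.exists_child_superset hsplit hQ h
  obtain ⟨y, hy, hyR⟩ := Set.exists_of_ssubset (T.dyadic.children_ssubset hR)
  obtain ⟨R', hR', hyR'⟩ := T.dyadic.exists_child hsplit hy
  have hdisj : Disjoint Q R' := Set.disjoint_left.2 fun x hx hx' => by
    obtain rfl := T.dyadic.children_eq_of_mem hR hR' (hQR hx) hx'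
    exact hyR hyR'
  have hR'c := isCube_of_mem_children hR'
  have h1 : μ.real Q + μ.real R' ≤ μ.real Q' := by
    rw [← measureReal_union hdisj (T.dyadic.measurableSet_cube hR'c) (T.measure_ne_top hQ)
      (T.measure_ne_top hR'c)]
    exact T.measureReal_le hQ' (Set.union_subset h.1 (subset_of_mem_children hR'))
  have h2 := T.measure_le_child Q' R' hR'
  have h3 : 1 / A * μ.real Q' ≤ μ.real R' := by
    rw [div_mul_eq_mul_div, one_mul, div_le_iff₀ hA]
    linarith
  linarith

/-- The cubes containing `x` form a chain in which the reciprocal measures decrease with ratio at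
most `1 - 1 / A`; the geometric series of that ratio sums to `A`. -/
theorem sum_inv_measure_le (T : IsRegularTree d μ lam D A) (x : X) (s : Finset (Set X)) :
    (∀ Q ∈ s, IsCube D Q ∧ x ∈ Q) → ∀ m : ℝ, 0 < m → (∀ Q ∈ s, m ≤ μ.real Q) →
      ∑ Q ∈ s, 1 / μ.real Q ≤ A / m := by
  classical
  have hA : 0 < A := by linarith [T.two_le]
  have hθ : 0 < 1 - 1 / A := by
    have : 1 / A ≤ 1 / 2 := one_div_le_one_div_of_le two_pos T.two_le
    linarith
  induction s using Finset.strongInduction with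
  | H s ih =>
    intro hs m hm hms
    rcases s.eq_empty_or_nonempty with rfl | hne
    · simp only [Finset.sum_empty]; positivity
    obtain ⟨Q, hQs, hmin⟩ := s.exists_min_image (fun Q => μ.real Q) hne
    have hQpos := T.measureReal_pos (hs Q hQs).1
    -- All cubes other than the smallest have measure at least `μ.real Q / (1 - 1 / A)`, which
    -- becomes the lower bound in the induction.
    have hrest := ih (s.erase Q) (Finset.erase_ssubset hQs)
      (fun Q' hQ' => hs Q' (Finset.mem_of_mem_erase hQ')) (μ.real Q / (1 - 1 / A)) (by positivity)
      (fun Q' hQ' => by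
        have hQ's := Finset.mem_of_mem_erase hQ'
        have hle := hmin Q' hQ's
        rw [div_le_iff₀ hθ, mul_comm]
        refine T.measureReal_le_of_ssubset (hs Q hQs).1 (hs Q' hQ's).1 ?_
        have hneq : Q ≠ Q' := (Finset.ne_of_mem_erase hQ').symm
        rcases T.dyadic.subset_or_subset (hs Q hQs).1 (hs Q' hQ's).1 (hs Q hQs).2
          (hs Q' hQ's).2 with h | h
        · exact h.ssubset_of_ne hneq
        · exfalso
          have h1 := T.measureReal_le_of_ssubset (hs Q' hQ's).1 (hs Q hQs).1
            (h.ssubset_of_ne hneq.symm)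
          have : 0 < 1 / A * μ.real Q := by positivity
          linarith)
    rw [← Finset.add_sum_erase s _ hQs]
    calc 1 / μ.real Q + ∑ Q' ∈ s.erase Q, 1 / μ.real Q'
        ≤ 1 / μ.real Q + A / (μ.real Q / (1 - 1 / A)) := by gcongr
      _ = A / μ.real Q := by field_simp; ring
      _ ≤ A / m := by gcongr; exact hms Q hQs

theorem exists_dyadicDist_eq (T : IsRegularTree d μ lam D A) {x y : X} (hxy : x ≠ y) :
    ∃ Q ∈ splitCubes D, x ∈ Q ∧ y ∈ Q ∧ (∀ Q', IsCube D Q' → x ∈ Q' → y ∈ Q' → Q ⊆ Q') ∧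
      dyadicDist μ D x y = μ.real Q := by
  obtain ⟨Q, hQ, hx, hy, hmin⟩ := T.dyadic.exists_least_cube T.homogeneous T.quadrant hxy
  refine ⟨Q, hQ, hx, hy, hmin, ?_⟩
  rw [dyadicDist, if_neg hxy]
  refine IsLeast.csInf_eq ⟨⟨Q, hQ, hx, hy, rfl⟩, ?_⟩
  rintro r ⟨Q', hQ', hx', hy', rfl⟩
  have hc := isCube_of_mem_splitCubes hQ'
  exact T.measureReal_le hc (hmin Q' hc hx' hy')

theorem dyadicDist_self (x : X) : dyadicDist μ D x x = 0 := if_pos rfl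

theorem dyadicDist_comm (x y : X) : dyadicDist μ D x y = dyadicDist μ D y x := by
  unfold dyadicDist
  simp only [and_left_comm (a := x ∈ _)]
  congr 1
  exact propext eq_comm

theorem dyadicDist_pos (T : IsRegularTree d μ lam D A) {x y : X} (hxy : x ≠ y) :
    0 < dyadicDist μ D x y := by
  obtain ⟨Q, hQ, -, -, -, h⟩ := T.exists_dyadicDist_eq hxy
  rw [h]
  exact T.measureReal_pos (isCube_of_mem_splitCubes hQ)

/-- Every cube is contained in cubes of arbitrarily large measure. -/
theorem exists_superset_measure_gt (T : IsRegularTree d μ lam D A) (x : X) (M : ℝ) :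
    ∃ Q, IsCube D Q ∧ x ∈ Q ∧ M < μ.real Q := by
  by_contra! hcon
  -- The cubes of level `-n` around `x` increase to the whole space because `X` is a quadrant;
  -- bounded measures would contradict `μ univ = ⊤`.
  choose f hf hxf using fun n : ℕ => T.dyadic.exists_mem (-(n : ℤ)) x
  have hmono : Monotone f := monotone_nat_of_le_succ fun n =>
    T.dyadic.subset_of_le (by push_cast; omega) (hf n) (hf (n + 1)) (hxf n) (hxf (n + 1))
  have hunion : ⋃ n, f n = Set.univ := Set.eq_univ_of_forall fun y => by
    obtain ⟨Q, ⟨i, hi⟩, hx, hy⟩ := T.dyadic.exists_common_cube T.quadrant x y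
    exact Set.mem_iUnion.2 ⟨i.natAbs, T.dyadic.subset_of_le (by omega) hi (hf _) hx (hxf _) hy⟩
  have hle : μ (⋃ n, f n) ≤ ENNReal.ofReal M := by
    rw [hmono.measure_iUnion]
    refine iSup_le fun n => ?_
    rw [← ENNReal.ofReal_toReal (T.measure_ne_top ⟨_, hf n⟩)]
    exact ENNReal.ofReal_le_ofReal (hcon (f n) ⟨_, hf n⟩ (hxf n))
  rw [hunion, T.measure_univ] at hle
  exact absurd hle (by simp)

/-- A property that fails for all large cubes has maximal instances. -/
theorem exists_maximal_cube (T : IsRegularTree d μ lam D A) {p : Set X → Prop} {M : ℝ}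
    (hp : ∀ Q, IsCube D Q → p Q → μ.real Q ≤ M) {S : Set X} (hS : IsCube D S) (hpS : p S) :
    ∃ Q, IsCube D Q ∧ S ⊆ Q ∧ p Q ∧ ∀ Q', IsCube D Q' → Q ⊂ Q' → ¬ p Q' := by
  obtain ⟨x, hx⟩ := T.dyadic.nonempty hS
  obtain ⟨B, ⟨i, hi⟩, hxB, hMB⟩ := T.exists_superset_measure_gt x M
  obtain ⟨j, hj⟩ := hS
  -- The least level gives the largest cube. Levels are bounded below by that of `B`, since a cube
  -- containing `B` is too large to satisfy `p`.
  obtain ⟨k, ⟨Q, hQ, hxQ, hpQ⟩, hmin⟩ := Int.exists_least_of_bdd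
    (P := fun k => ∃ Q ∈ D k, x ∈ Q ∧ p Q)
    ⟨i, fun z ⟨Q, hQ, hxQ, hpQ⟩ => by
      by_contra! hlt
      have h1 := T.measureReal_le ⟨z, hQ⟩ (T.dyadic.subset_of_le hlt.le hi hQ hxB hxQ)
      have h2 := hp Q ⟨z, hQ⟩ hpQ
      linarith⟩ ⟨j, S, hj, hx, hpS⟩
  refine ⟨Q, ⟨k, hQ⟩, T.dyadic.subset_of_le (hmin j ⟨S, hj, hx, hpS⟩) hj hQ hx hxQ, hpQ, ?_⟩
  rintro Q' ⟨l, hl⟩ hss hpQ'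
  have := hmin l ⟨Q', hl, hss.1 hxQ, hpQ'⟩
  exact hss.2 (T.dyadic.subset_of_le this hl hQ (hss.1 hxQ) hxQ)

end IsRegularTree

/-! ### Haar functions -/

namespace IsHaarSystem

variable {μ : Measure X} {D : ℤ → Set (Set X)} {H : Set (X → ℝ)}

/-- In a finite measure space the constant 1 is square integrable and orthogonal to all Haar
functions, since they have mean zero; completeness forces it to vanish. -/
theorem measure_univ_eq_top (hH : IsHaarSystem μ D H) (hpos : μ ≠ 0) : μ Set.univ = ⊤ := by
  by_contra htop
  have : IsFiniteMeasure μ := ⟨lt_top_iff_ne_top.2 htop⟩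
  obtain ⟨b, hb⟩ := hH.hilbertBasis
  have h1 : MemLp (fun _ : X => (1 : ℝ)) 2 μ := memLp_const 1
  have hzero : h1.toLp _ = 0 := by
    refine b.repr.map_eq_zero_iff.1 (lp.ext (funext fun i => ?_))
    rw [b.repr_apply_apply, L2.inner_def, lp.coeFn_zero, Pi.zero_apply,
      ← hH.integral_eq_zero i i.2]
    refine integral_congr_ae ?_
    filter_upwards [hb i, h1.coeFn_toLp] with x hx hx'
    rw [hx, hx']
    simp
  have := h1.coeFn_toLp
  rw [hzero] at this
  have h2 : ∀ᵐ x ∂μ, False := by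
    filter_upwards [this, Lp.coeFn_zero ℝ 2 μ] with x hx hx'
    rw [hx'] at hx
    simp at hx
  exact hpos (by simpa using h2)

theorem mem_childConst (hH : IsHaarSystem μ D H) {Q : Set X} (hQ : Q ∈ splitCubes D) {h : X → ℝ}
    (hh : h ∈ haarAt D H Q) : h ∈ childConst D Q := by
  rw [← hH.span_eq Q hQ]
  exact Submodule.subset_span (Set.mem_insert_of_mem _ hh)

theorem exists_mem_haarAt (hH : IsHaarSystem μ D H) {h : X → ℝ} (hh : h ∈ H) :
    ∃ Q, h ∈ haarAt D H Q := by
  obtain ⟨j, ⟨Q, hQ⟩, -⟩ := hH.cube h hh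
  exact ⟨Q, hh, j, hQ⟩

theorem eq_zero_of_notMem (hH : IsHaarSystem μ D H) {Q : Set X} {h : X → ℝ}
    (hh : h ∈ haarAt D H Q) {x : X} (hx : x ∉ Q) : h x = 0 :=
  (hH.mem_childConst (mem_splitCubes_of_mem_haarAt hh) hh).1 x hx

variable {d : X → X → ℝ} {lam A : ℝ}

/-- A Haar function is constant on the cubes strictly inside its cube. -/
theorem const_of_ssubset (hH : IsHaarSystem μ D H) (T : IsRegularTree d μ lam D A) {Q S : Set X}
    {h : X → ℝ} (hh : h ∈ haarAt D H Q) (hS : IsCube D S) (hSQ : S ⊂ Q) {x y : X} (hx : x ∈ S)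
    (hy : y ∈ S) : h x = h y := by
  have hQ := mem_splitCubes_of_mem_haarAt hh
  obtain ⟨R, hR, hSR⟩ := T.dyadic.exists_child_superset hQ hS hSQ
  exact (hH.mem_childConst hQ hh).2 R hR x (hSR hx) y (hSR hy)

/-- The value of `h` at `x` is taken on a whole child `R`, so `h x ^ 2 * μ.real R` is at most the
squared norm of `h`, which is 1. Passing from `R` to `Q` costs a factor `A`, and `√A ≤ A`. -/
theorem abs_le (hH : IsHaarSystem μ D H) (T : IsRegularTree d μ lam D A) {Q : Set X}
    {h : X → ℝ} (hh : h ∈ haarAt D H Q) (x : X) : |h x| ≤ A / √(μ.real Q) := by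
  have hA : 0 < A := by linarith [T.two_le]
  have hQ := mem_splitCubes_of_mem_haarAt hh
  have hQc := isCube_of_mem_splitCubes hQ
  have hQpos := T.measureReal_pos hQc
  by_cases hx : x ∈ Q
  swap
  · rw [hH.eq_zero_of_notMem hh hx, abs_zero]; positivity
  obtain ⟨R, hR, hxR⟩ := T.dyadic.exists_child hQ hx
  have hRc := isCube_of_mem_children hR
  have hint : ∫ y in Q, h y * h y ∂μ = 1 :=
    hH.norm_eq_one Q hQ h (Set.mem_insert_of_mem _ hh)
  have hle : ∫ y in R, h y * h y ∂μ ≤ ∫ y in Q, h y * h y ∂μ := by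
    refine setIntegral_mono_set ?_ (Filter.Eventually.of_forall fun y => mul_self_nonneg _)
      (Filter.Eventually.of_forall (subset_of_mem_children hR))
    -- Integrability of the square over `Q` comes for free: a non-integrable function would have
    -- integral 0, not 1.
    by_contra hni
    rw [integral_undef hni] at hint
    exact zero_ne_one hint
  have hconst : ∫ y in R, h y * h y ∂μ = μ.real R * (h x * h x) := by
    rw [setIntegral_congr_fun (g := fun _ => h x * h x) (T.dyadic.measurableSet_cube hRc)
      (fun y hy => by
        simp only [(hH.mem_childConst hQ hh).2 R hR y hy x hxR])]
    simp
  rw [hconst, hint] at hle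
  have h1 := T.measure_le_child Q R hR
  have h2 : μ.real Q * (h x * h x) ≤ A := by
    calc μ.real Q * (h x * h x) ≤ A * μ.real R * (h x * h x) := by
          gcongr; exact mul_self_nonneg _
      _ = A * (μ.real R * (h x * h x)) := by ring
      _ ≤ A * 1 := by gcongr
      _ = A := mul_one A
  rw [le_div_iff₀ (by positivity), ← abs_of_nonneg (Real.sqrt_nonneg (μ.real Q)), ← abs_mul]
  refine abs_le_of_sq_le_sq ?_ hA.le
  rw [mul_pow, Real.sq_sqrt hQpos.le]
  nlinarith [T.two_le]

theorem encard_haarAt_le (hH : IsHaarSystem μ D H) (T : IsRegularTree d μ lam D A) (Q : Set X) :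
    (haarAt D H Q).encard ≤ (⌊A⌋₊ : ℕ) := by
  by_cases hQ : Q ∈ splitCubes D
  · refine le_trans ?_ (T.encard_children_le Q)
    rw [← hH.card Q hQ]
    exact le_self_add
  · have : haarAt D H Q = ∅ := Set.eq_empty_of_forall_notMem fun h hh =>
      hQ (mem_splitCubes_of_mem_haarAt hh)
    rw [this]
    simp

theorem finite_haarAt (hH : IsHaarSystem μ D H) (T : IsRegularTree d μ lam D A) (Q : Set X) :
    (haarAt D H Q).Finite :=
  Set.finite_of_encard_le_coe (hH.encard_haarAt_le T Q)

theorem card_haarAt_le (hH : IsHaarSystem μ D H) (T : IsRegularTree d μ lam D A) (Q : Set X) :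
    ((hH.finite_haarAt T Q).toFinset.card : ℝ) ≤ A := by
  have h := hH.encard_haarAt_le T Q
  rw [(hH.finite_haarAt T Q).encard_eq_coe_toFinset_card] at h
  have h3 : (hH.finite_haarAt T Q).toFinset.card ≤ ⌊A⌋₊ := by exact_mod_cast h
  exact (Nat.cast_le.2 h3).trans (Nat.floor_le (by linarith [T.two_le]))

end IsHaarSystem

end Tree

/-! ### The two orthogonal families of atoms -/

section Atoms

variable {X : Type*} [MeasurableSpace X] {d : X → X → ℝ} {μ : Measure X} {lam : ℝ}
  {D : ℤ → Set (Set X)} {A : ℝ}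

/-- A family of mutually orthogonal bounded functions `w Q`, one for each splitting cube `Q`, where
`w Q` lives on `Q` and is constant on every cube whose parent does not contain `Q`. -/
structure IsAtomFamily (μ : Measure X) (D : ℤ → Set (Set X)) (c : ℝ) (w : Set X → X → ℝ) :
    Prop where
  measurable : ∀ Q ∈ splitCubes D, Measurable (w Q)
  eq_zero_of_notMem : ∀ Q ∈ splitCubes D, ∀ x ∉ Q, w Q x = 0
  abs_le : ∀ Q ∈ splitCubes D, ∀ x, |w Q x| ≤ c / √(μ.real Q)
  const : ∀ Q ∈ splitCubes D, ∀ S P, S ∈ children D P → ¬ Q ⊆ P →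
    ∀ x ∈ S, ∀ y ∈ S, w Q x = w Q y
  orthogonal : ∀ Q ∈ splitCubes D, ∀ Q' ∈ splitCubes D, Q ≠ Q' → ∫ x, w Q x * w Q' x ∂μ = 0

theorem memLp_of_bounded_of_support {f : X → ℝ} (hf : Measurable f) {Q : Set X}
    (hQ : MeasurableSet Q) (hμQ : μ Q ≠ ⊤) (hzero : ∀ x ∉ Q, f x = 0) {M : ℝ}
    (hM : ∀ x, |f x| ≤ M) (p : ℝ≥0∞) : MemLp f p μ := by
  have hind : Q.indicator f = f := Set.indicator_eq_self.2 fun x hx => by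
    by_contra h
    exact hx (hzero x h)
  rw [← hind, memLp_indicator_iff_restrict hQ]
  have : IsFiniteMeasure (μ.restrict Q) := ⟨by simpa using lt_top_iff_ne_top.2 hμQ⟩
  exact MemLp.of_bound hf.aestronglyMeasurable M (Filter.Eventually.of_forall hM)

/-- The source of orthogonality for nested cubes: the smaller cube carries a function of mean zero,
and the other factor is constant there. -/
theorem integral_mul_eq_zero_of_const {f g : X → ℝ} {S : Set X} (hzero : ∀ x ∉ S, f x = 0)
    (hint : ∫ x, f x ∂μ = 0) (hconst : ∀ x ∈ S, ∀ y ∈ S, g x = g y) :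
    ∫ x, f x * g x ∂μ = 0 := by
  rcases S.eq_empty_or_nonempty with rfl | ⟨z, hz⟩
  · simp [fun x => hzero x (Set.notMem_empty x)]
  · have : (fun x => f x * g x) = fun x => f x * g z := by
      funext x
      by_cases hx : x ∈ S
      · rw [hconst x hx z hz]
      · rw [hzero x hx, zero_mul, zero_mul]
    rw [this, integral_mul_const, hint, zero_mul]

theorem coe_toL2 {f : X → ℝ} (hf : MemLp f 2 μ) : toL2 μ f =ᵐ[μ] f := by
  rw [toL2, dif_pos hf]
  exact hf.coeFn_toLp

theorem toL2_eq_toLp {f : X → ℝ} (hf : MemLp f 2 μ) : toL2 μ f = hf.toLp f := dif_pos hf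

theorem toL2_smul {f : X → ℝ} (hf : MemLp f 2 μ) (c : ℝ) : toL2 μ (c • f) = c • toL2 μ f := by
  rw [toL2_eq_toLp hf, toL2_eq_toLp (hf.const_smul c)]
  rfl

theorem toL2_sum {ι : Type*} (s : Finset ι) {f : ι → X → ℝ} (hf : ∀ i ∈ s, MemLp (f i) 2 μ) :
    toL2 μ (∑ i ∈ s, f i) = ∑ i ∈ s, toL2 μ (f i) := by
  classical
  induction s using Finset.induction_on with
  | empty =>
    have h0 : MemLp (0 : X → ℝ) 2 μ := MemLp.zero'
    rw [Finset.sum_empty, Finset.sum_empty, toL2_eq_toLp h0]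
    rfl
  | insert a s ha ih =>
    have h1 := hf a (Finset.mem_insert_self a s)
    have h2 : MemLp (∑ i ∈ s, f i) 2 μ :=
      memLp_finsetSum' s fun i hi => hf i (Finset.mem_insert_of_mem hi)
    rw [Finset.sum_insert ha, Finset.sum_insert ha, toL2_eq_toLp (h1.add h2),
      ← ih fun i hi => hf i (Finset.mem_insert_of_mem hi), toL2_eq_toLp h1, toL2_eq_toLp h2]
    rfl

theorem inner_toL2 (F : Lp ℝ 2 μ) {g : X → ℝ} (hg : MemLp g 2 μ) :
    inner ℝ F (toL2 μ g) = ∫ x, F x * g x ∂μ := by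
  rw [L2.inner_def]
  refine integral_congr_ae ?_
  filter_upwards [coe_toL2 hg] with x hx
  rw [hx, real_inner_comm]
  simp

theorem inner_toL2_toL2 {f g : X → ℝ} (hf : MemLp f 2 μ) (hg : MemLp g 2 μ) :
    inner ℝ (toL2 μ f) (toL2 μ g) = ∫ x, f x * g x ∂μ := by
  rw [inner_toL2 _ hg]
  refine integral_congr_ae ?_
  filter_upwards [coe_toL2 hf] with x hx
  rw [hx]

theorem IsAtomFamily.memLp {c : ℝ} {w : Set X → X → ℝ} (hw : IsAtomFamily μ D c w)
    (T : IsRegularTree d μ lam D A) {Q : Set X} (hQ : Q ∈ splitCubes D) (p : ℝ≥0∞) :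
    MemLp (w Q) p μ :=
  memLp_of_bounded_of_support (hw.measurable Q hQ)
    (T.dyadic.measurableSet_cube (isCube_of_mem_splitCubes hQ))
    (T.measure_ne_top (isCube_of_mem_splitCubes hQ)) (hw.eq_zero_of_notMem Q hQ) (hw.abs_le Q hQ) p

theorem IsAtomFamily.norm_sq_le {c : ℝ} {w : Set X → X → ℝ} (hw : IsAtomFamily μ D c w)
    (T : IsRegularTree d μ lam D A) {Q : Set X} (hQ : Q ∈ splitCubes D) :
    ‖toL2 μ (w Q)‖ ^ 2 ≤ c ^ 2 := by
  have hQc := isCube_of_mem_splitCubes hQ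
  have hpos := T.measureReal_pos hQc
  have hm := hw.memLp T hQ 2
  rw [← real_inner_self_eq_norm_sq, inner_toL2_toL2 hm hm]
  have hzero : ∀ x ∉ Q, w Q x * w Q x = 0 := fun x hx => by
    rw [hw.eq_zero_of_notMem Q hQ x hx, zero_mul]
  rw [← setIntegral_eq_integral_of_forall_compl_eq_zero hzero]
  have hle : ∀ x ∈ Q, ‖w Q x * w Q x‖ ≤ c ^ 2 / μ.real Q := fun x _ => by
    rw [Real.norm_eq_abs, abs_mul, ← sq]
    calc |w Q x| ^ 2 ≤ (c / √(μ.real Q)) ^ 2 := by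
          gcongr
          exact hw.abs_le Q hQ x
      _ = c ^ 2 / μ.real Q := by rw [div_pow, Real.sq_sqrt hpos.le]
  have := norm_setIntegral_le_of_norm_le_const
    (lt_top_iff_ne_top.2 (T.measure_ne_top hQc)) hle
  rw [div_mul_cancel₀ _ hpos.ne'] at this
  exact (le_abs_self _).trans this

/-- Orthogonality of a family attached to the cubes follows from the case of nested cubes. -/
theorem orthogonal_of_ssubset (T : IsRegularTree d μ lam D A) {w : Set X → X → ℝ}
    (hzero : ∀ Q ∈ splitCubes D, ∀ x ∉ Q, w Q x = 0)
    (hss : ∀ Q ∈ splitCubes D, ∀ Q' ∈ splitCubes D, Q ⊂ Q' → ∫ x, w Q x * w Q' x ∂μ = 0)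
    (Q : Set X) (hQ : Q ∈ splitCubes D) (Q' : Set X) (hQ' : Q' ∈ splitCubes D) (hne : Q ≠ Q') :
    ∫ x, w Q x * w Q' x ∂μ = 0 := by
  by_cases hd : Disjoint Q Q'
  · refine integral_eq_zero_of_ae (Filter.Eventually.of_forall fun x => ?_)
    by_cases hx : x ∈ Q
    · simp [hzero Q' hQ' x (Set.disjoint_left.1 hd hx)]
    · simp [hzero Q hQ x hx]
  · obtain ⟨x, hx, hx'⟩ := Set.not_disjoint_iff.1 hd
    rcases T.dyadic.subset_or_subset (isCube_of_mem_splitCubes hQ) (isCube_of_mem_splitCubes hQ')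
      hx hx' with h | h
    · exact hss Q hQ Q' hQ' (h.ssubset_of_ne hne)
    · simp_rw [mul_comm (w Q _)]
      exact hss Q' hQ' Q hQ (h.ssubset_of_ne hne.symm)

/-! ### The two families that make up the operator -/

/-- A weighted sum of the Haar functions that belong to a cube. -/
noncomputable def haarSum (D : ℤ → Set (Set X)) (H : Set (X → ℝ)) (β : (X → ℝ) → ℝ) (Q : Set X) : X → ℝ :=
  ∑ᶠ h ∈ haarAt D H Q, β h • h

/-- The sum of the `haarSum`s of the children of a cube. -/
noncomputable def childHaarSum (D : ℤ → Set (Set X)) (H : Set (X → ℝ)) (β : (X → ℝ) → ℝ) (Q : Set X) : X → ℝ :=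
  ∑ᶠ R ∈ children D Q, haarSum D H β R

variable {H : Set (X → ℝ)} {β : (X → ℝ) → ℝ} {B : ℝ}

namespace IsHaarSystem

theorem haarSum_eq (hH : IsHaarSystem μ D H) (T : IsRegularTree d μ lam D A) (Q : Set X) :
    haarSum D H β Q = ∑ h ∈ (hH.finite_haarAt T Q).toFinset, β h • h :=
  finsum_mem_eq_finite_toFinset_sum _ _

theorem haarSum_apply (hH : IsHaarSystem μ D H) (T : IsRegularTree d μ lam D A) (Q : Set X)
    (x : X) : haarSum D H β Q x = ∑ h ∈ (hH.finite_haarAt T Q).toFinset, β h * h x := by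
  rw [hH.haarSum_eq T, Finset.sum_apply]
  rfl

theorem measurable_haarSum (hH : IsHaarSystem μ D H) (T : IsRegularTree d μ lam D A) (Q : Set X) :
    Measurable (haarSum D H β Q) := by
  have : haarSum D H β Q = fun x => ∑ h ∈ (hH.finite_haarAt T Q).toFinset, β h * h x :=
    funext fun x => hH.haarSum_apply T Q x
  rw [this]
  exact Finset.measurable_fun_sum _ fun h hh =>
    (hH.measurable h ((hH.finite_haarAt T Q).mem_toFinset.1 hh).1).const_mul _

theorem haarSum_eq_zero (hH : IsHaarSystem μ D H) (T : IsRegularTree d μ lam D A) {Q : Set X}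
    {x : X} (hx : x ∉ Q) : haarSum D H β Q x = 0 := by
  rw [hH.haarSum_apply T]
  exact Finset.sum_eq_zero fun h hh => by
    rw [hH.eq_zero_of_notMem ((Set.Finite.mem_toFinset _).1 hh) hx, mul_zero]

theorem haarSum_const (hH : IsHaarSystem μ D H) (T : IsRegularTree d μ lam D A) {Q S : Set X}
    (hS : IsCube D S) (hSQ : S ⊂ Q) {x y : X} (hx : x ∈ S) (hy : y ∈ S) :
    haarSum D H β Q x = haarSum D H β Q y := by
  rw [hH.haarSum_apply T, hH.haarSum_apply T]
  exact Finset.sum_congr rfl fun h hh => by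
    rw [hH.const_of_ssubset T ((Set.Finite.mem_toFinset _).1 hh) hS hSQ hx hy]

theorem abs_haarSum_le (hH : IsHaarSystem μ D H) (T : IsRegularTree d μ lam D A)
    (hB : 0 ≤ B) (hβ : ∀ h ∈ H, |β h| ≤ B) (Q : Set X) (x : X) :
    |haarSum D H β Q x| ≤ A ^ 2 * B / √(μ.real Q) := by
  have hA : 0 ≤ A := by linarith [T.two_le]
  rw [hH.haarSum_apply T]
  calc |∑ h ∈ (hH.finite_haarAt T Q).toFinset, β h * h x|
      ≤ ∑ h ∈ (hH.finite_haarAt T Q).toFinset, |β h * h x| := Finset.abs_sum_le_sum_abs _ _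
    _ ≤ ∑ h ∈ (hH.finite_haarAt T Q).toFinset, B * (A / √(μ.real Q)) := by
      refine Finset.sum_le_sum fun h hh => ?_
      have hh' := (Set.Finite.mem_toFinset _).1 hh
      rw [abs_mul]
      exact mul_le_mul (hβ h hh'.1) (hH.abs_le T hh' x) (abs_nonneg _) hB
    _ = ((hH.finite_haarAt T Q).toFinset.card : ℝ) * (B * (A / √(μ.real Q))) := by
      rw [Finset.sum_const, nsmul_eq_mul]
    _ ≤ A * (B * (A / √(μ.real Q))) := by
      gcongr
      exact hH.card_haarAt_le T Q
    _ = _ := by ring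

theorem memLp_haar (hH : IsHaarSystem μ D H) (T : IsRegularTree d μ lam D A) {h : X → ℝ}
    (hh : h ∈ H) (p : ℝ≥0∞) : MemLp h p μ := by
  obtain ⟨Q, hQ⟩ := hH.exists_mem_haarAt hh
  have hQc := isCube_of_mem_splitCubes (mem_splitCubes_of_mem_haarAt hQ)
  exact memLp_of_bounded_of_support (hH.measurable h hh) (T.dyadic.measurableSet_cube hQc)
    (T.measure_ne_top hQc) (fun x hx => hH.eq_zero_of_notMem hQ hx) (hH.abs_le T hQ) p

theorem memLp_haarSum (hH : IsHaarSystem μ D H) (T : IsRegularTree d μ lam D A) (Q : Set X)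
    (p : ℝ≥0∞) : MemLp (haarSum D H β Q) p μ := by
  rw [hH.haarSum_eq T]
  exact memLp_finsetSum' _ fun h hh =>
    (hH.memLp_haar T ((Set.Finite.mem_toFinset _).1 hh).1 p).const_smul _

theorem integral_haarSum (hH : IsHaarSystem μ D H) (T : IsRegularTree d μ lam D A) (Q : Set X) :
    ∫ x, haarSum D H β Q x ∂μ = 0 := by
  simp_rw [hH.haarSum_apply T]
  rw [integral_finsetSum]
  · refine Finset.sum_eq_zero fun h hh => ?_
    rw [integral_const_mul, hH.integral_eq_zero h ((Set.Finite.mem_toFinset _).1 hh).1, mul_zero]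
  · intro h hh
    exact (memLp_one_iff_integrable.1
      (hH.memLp_haar T ((Set.Finite.mem_toFinset _).1 hh).1 1)).const_mul _

/-- A cube whose parent does not contain `Q` is either disjoint from `Q` or strictly inside it,
hence inside a child, where the Haar functions of `Q` are constant. -/
theorem isAtomFamily_haarSum (hH : IsHaarSystem μ D H) (T : IsRegularTree d μ lam D A)
    (hB : 0 ≤ B) (hβ : ∀ h ∈ H, |β h| ≤ B) : IsAtomFamily μ D (A ^ 2 * B) (haarSum D H β) where
  measurable Q _ := hH.measurable_haarSum T Q
  eq_zero_of_notMem Q _ x hx := hH.haarSum_eq_zero T hx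
  abs_le Q _ x := hH.abs_haarSum_le T hB hβ Q x
  const Q hQ S P hS hQP x hx y hy := by
    have hSc := isCube_of_mem_children hS
    by_cases hxQ : x ∈ Q
    · rcases T.dyadic.subset_or_subset hSc (isCube_of_mem_splitCubes hQ) hx hxQ with h | h
      · refine hH.haarSum_const T hSc (h.ssubset_of_ne ?_) hx hy
        rintro rfl
        exact hQP (subset_of_mem_children hS)
      · exact absurd (h.trans (subset_of_mem_children hS)) hQP
    · by_cases hyQ : y ∈ Q
      · rcases T.dyadic.subset_or_subset hSc (isCube_of_mem_splitCubes hQ) hy hyQ with h | h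
        · exact absurd (h hx) hxQ
        · exact absurd (h.trans (subset_of_mem_children hS)) hQP
      · rw [hH.haarSum_eq_zero T hxQ, hH.haarSum_eq_zero T hyQ]
  orthogonal := by
    refine orthogonal_of_ssubset T (fun Q _ x hx => hH.haarSum_eq_zero T hx)
      fun Q hQ Q' hQ' hss => ?_
    exact integral_mul_eq_zero_of_const (fun x hx => hH.haarSum_eq_zero T hx)
      (hH.integral_haarSum T Q)
      fun x hx y hy => hH.haarSum_const T (isCube_of_mem_splitCubes hQ) hss hx hy

theorem childHaarSum_eq (T : IsRegularTree d μ lam D A) (Q : Set X) :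
    childHaarSum D H β Q = ∑ R ∈ (T.finite_children Q).toFinset, haarSum D H β R :=
  finsum_mem_eq_finite_toFinset_sum _ _

theorem childHaarSum_apply (hH : IsHaarSystem μ D H) (T : IsRegularTree d μ lam D A)
    {Q R : Set X} (hR : R ∈ children D Q) {x : X} (hx : x ∈ R) :
    childHaarSum D H β Q x = haarSum D H β R x := by
  rw [childHaarSum_eq T, Finset.sum_apply]
  refine Finset.sum_eq_single_of_mem R ((Set.Finite.mem_toFinset _).2 hR) fun R' hR' hne => ?_
  refine hH.haarSum_eq_zero T fun hx' => hne ?_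
  exact T.dyadic.children_eq_of_mem ((Set.Finite.mem_toFinset _).1 hR') hR hx' hx

theorem childHaarSum_eq_zero (hH : IsHaarSystem μ D H) (T : IsRegularTree d μ lam D A) {Q : Set X}
    {x : X} (hx : x ∉ Q) : childHaarSum D H β Q x = 0 := by
  rw [childHaarSum_eq T, Finset.sum_apply]
  exact Finset.sum_eq_zero fun R hR => hH.haarSum_eq_zero T fun hxR =>
    hx (subset_of_mem_children ((Set.Finite.mem_toFinset _).1 hR) hxR)

theorem childHaarSum_const (hH : IsHaarSystem μ D H) (T : IsRegularTree d μ lam D A)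
    {Q R S : Set X} (hR : R ∈ children D Q) (hS : IsCube D S) (hSR : S ⊂ R) {x y : X}
    (hx : x ∈ S) (hy : y ∈ S) : childHaarSum D H β Q x = childHaarSum D H β Q y := by
  rw [hH.childHaarSum_apply T hR (hSR.1 hx), hH.childHaarSum_apply T hR (hSR.1 hy),
    hH.haarSum_const T hS hSR hx hy]

/-- Compared with `haarSum`, one more factor `A` pays for replacing the measure of a child by that
of `Q`, and constancy starts one generation lower. This is why the condition in `IsAtomFamily` is
stated through the parent of `S`: it excludes the children of `Q` themselves. -/
theorem isAtomFamily_childHaarSum (hH : IsHaarSystem μ D H) (T : IsRegularTree d μ lam D A)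
    (hB : 0 ≤ B) (hβ : ∀ h ∈ H, |β h| ≤ B) :
    IsAtomFamily μ D (A ^ 3 * B) (childHaarSum D H β) where
  measurable Q _ := by
    rw [childHaarSum_eq T, Finset.sum_fn]
    exact Finset.measurable_fun_sum _ fun R _ => hH.measurable_haarSum T R
  eq_zero_of_notMem Q _ x hx := hH.childHaarSum_eq_zero T hx
  abs_le Q hQ x := by
    have hA : 0 < A := by linarith [T.two_le]
    have hQpos := T.measureReal_pos (isCube_of_mem_splitCubes hQ)
    by_cases hx : x ∈ Q
    · obtain ⟨R, hR, hxR⟩ := T.dyadic.exists_child hQ hx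
      have hRpos := T.measureReal_pos (isCube_of_mem_children hR)
      rw [hH.childHaarSum_apply T hR hxR]
      refine (hH.abs_haarSum_le T hB hβ R x).trans ?_
      have hs : √(μ.real Q) ≤ A * √(μ.real R) := by
        rw [← Real.sqrt_sq hA.le, ← Real.sqrt_mul (sq_nonneg A)]
        refine Real.sqrt_le_sqrt ((T.measure_le_child Q R hR).trans ?_)
        gcongr
        nlinarith [T.two_le]
      rw [div_le_div_iff₀ (by positivity) (by positivity)]
      calc A ^ 2 * B * √(μ.real Q) ≤ A ^ 2 * B * (A * √(μ.real R)) := by gcongr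
        _ = _ := by ring
    · rw [hH.childHaarSum_eq_zero T hx, abs_zero]
      positivity
  const Q hQ S P hS hQP x hx y hy := by
    have hSc := isCube_of_mem_children hS
    have hQc := isCube_of_mem_splitCubes hQ
    by_cases hd : Disjoint Q S
    · rw [hH.childHaarSum_eq_zero T (Set.disjoint_right.1 hd hx),
        hH.childHaarSum_eq_zero T (Set.disjoint_right.1 hd hy)]
    · obtain ⟨z, hzQ, hzS⟩ := Set.not_disjoint_iff.1 hd
      rcases T.dyadic.subset_or_subset hSc hQc hzS hzQ with h | h
      · have hne : S ≠ Q := by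
          rintro rfl
          exact hQP (subset_of_mem_children hS)
        obtain ⟨R, hR, hSR⟩ := T.dyadic.exists_child_superset hQ hSc (h.ssubset_of_ne hne)
        refine hH.childHaarSum_const T hR hSc (hSR.ssubset_of_ne ?_) hx hy
        rintro rfl
        exact hQP (T.dyadic.parent_unique hR hS).subset
      · exact absurd (h.trans (subset_of_mem_children hS)) hQP
  orthogonal := by
    refine orthogonal_of_ssubset T (fun Q _ x hx => hH.childHaarSum_eq_zero T hx)
      fun Q hQ Q' hQ' hss => ?_
    -- `Q` may be a child of `Q'`, and then the larger atom need not be constant on `Q`. It is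
    -- constant on each child of `Q`, so the smaller atom is split into its parts on children, each
    -- of mean zero.
    obtain ⟨R', hR', hQR'⟩ :=
      T.dyadic.exists_child_superset hQ' (isCube_of_mem_splitCubes hQ) hss
    have hmem : MemLp (childHaarSum D H β Q') 2 μ := by
      rw [childHaarSum_eq T]
      exact memLp_finsetSum' _ fun R _ => hH.memLp_haarSum T R 2
    have hsum : ∀ x, childHaarSum D H β Q x * childHaarSum D H β Q' x =
        ∑ R ∈ (T.finite_children Q).toFinset, haarSum D H β R x * childHaarSum D H β Q' x := by
      intro x
      rw [childHaarSum_eq T Q, Finset.sum_apply, Finset.sum_mul]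
    simp_rw [hsum]
    rw [integral_finsetSum]
    · refine Finset.sum_eq_zero fun R hR => ?_
      have hRQ := (Set.Finite.mem_toFinset _).1 hR
      exact integral_mul_eq_zero_of_const (fun x hx => hH.haarSum_eq_zero T hx)
        (hH.integral_haarSum T R) fun x hx y hy => hH.childHaarSum_const T hR'
          (isCube_of_mem_children hRQ) ((T.dyadic.children_ssubset hRQ).trans_subset hQR') hx hy
    · intro R _
      exact (hH.memLp_haarSum T R 2).integrable_mul hmem

theorem toL2_haarSum (hH : IsHaarSystem μ D H) (T : IsRegularTree d μ lam D A) (Q : Set X) :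
    toL2 μ (haarSum D H β Q) = ∑ᶠ h ∈ haarAt D H Q, β h • toL2 μ h := by
  have hmem : ∀ h ∈ (hH.finite_haarAt T Q).toFinset, MemLp h 2 μ := fun h hh =>
    hH.memLp_haar T ((Set.Finite.mem_toFinset _).1 hh).1 2
  rw [hH.haarSum_eq T, finsum_mem_eq_finite_toFinset_sum _ (hH.finite_haarAt T Q),
    toL2_sum _ fun h hh => (hmem h hh).const_smul _]
  exact Finset.sum_congr rfl fun h hh => toL2_smul (hmem h hh) _

theorem toL2_childHaarSum (hH : IsHaarSystem μ D H) (T : IsRegularTree d μ lam D A) (Q : Set X) :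
    toL2 μ (childHaarSum D H β Q) = petermichlBlock μ D H β Q := by
  rw [childHaarSum_eq T, petermichlBlock,
    finsum_mem_eq_finite_toFinset_sum _ (T.finite_children Q),
    toL2_sum _ fun R _ => hH.memLp_haarSum T R 2]
  exact Finset.sum_congr rfl fun R _ => hH.toL2_haarSum T R

/-- The block does not depend on `h`, so the inner sum over `haarAt D H Q` collapses to the pairing
with the unweighted sum of these Haar functions, the case of weight 1. -/
theorem petermichlTerm_eq (hH : IsHaarSystem μ D H) (T : IsRegularTree d μ lam D A)
    (f : Lp ℝ 2 μ) (Q : Set X) :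
    petermichlTerm μ D H β f Q =
      inner ℝ f (toL2 μ (haarSum D H 1 Q)) • toL2 μ (childHaarSum D H β Q) := by
  rw [petermichlTerm, hH.toL2_childHaarSum T, hH.toL2_haarSum T,
    finsum_mem_eq_finite_toFinset_sum _ (hH.finite_haarAt T Q),
    finsum_mem_eq_finite_toFinset_sum _ (hH.finite_haarAt T Q), inner_sum, Finset.sum_smul]
  simp

end IsHaarSystem

end Atoms

/-! ### Rank one sums over orthogonal families in a Hilbert space -/

section Hilbert

variable {ι E : Type*} [NormedAddCommGroup E] [InnerProductSpace ℝ E]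

theorem norm_sum_sq_of_orthogonal {w : ι → E} (hw : ∀ i j, i ≠ j → inner ℝ (w i) (w j) = 0)
    (s : Finset ι) : ‖∑ i ∈ s, w i‖ ^ 2 = ∑ i ∈ s, ‖w i‖ ^ 2 := by
  rw [← real_inner_self_eq_norm_sq, sum_inner]
  refine Finset.sum_congr rfl fun i hi => ?_
  rw [inner_sum, ← real_inner_self_eq_norm_sq]
  exact Finset.sum_eq_single_of_mem i hi fun j _ hj => hw i j hj.symm

/-- Bessel's inequality without normalization, so that the vectors may vanish. The sum `S` is the
pairing of `f` with `∑ ⟨f, u i⟩ u i`, whose squared norm is at most `M * S`; Cauchy–Schwarz gives `S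
^ 2 ≤ ‖f‖ ^ 2 * (M * S)`. -/
theorem sum_inner_sq_le {u : ι → E} {M : ℝ} (hM0 : 0 ≤ M) (hu : ∀ i j, i ≠ j → inner ℝ (u i) (u j) = 0)
    (hM : ∀ i, ‖u i‖ ^ 2 ≤ M) (f : E) (s : Finset ι) :
    ∑ i ∈ s, (inner ℝ f (u i)) ^ 2 ≤ M * ‖f‖ ^ 2 := by
  set S := ∑ i ∈ s, (inner ℝ f (u i)) ^ 2 with hS
  have hS0 : 0 ≤ S := Finset.sum_nonneg fun _ _ => sq_nonneg _
  have h1 : S = inner ℝ f (∑ i ∈ s, inner ℝ f (u i) • u i) := by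
    rw [inner_sum, hS]
    exact Finset.sum_congr rfl fun i _ => by rw [inner_smul_right, sq]
  have h2 : ‖∑ i ∈ s, inner ℝ f (u i) • u i‖ ^ 2 ≤ M * S := by
    rw [norm_sum_sq_of_orthogonal (w := fun i => inner ℝ f (u i) • u i) (fun i j hij => by
      rw [inner_smul_left, inner_smul_right, hu i j hij, mul_zero, mul_zero]), hS, Finset.mul_sum]
    refine Finset.sum_le_sum fun i _ => ?_
    rw [norm_smul, mul_pow, Real.norm_eq_abs, sq_abs, mul_comm]
    exact mul_le_mul_of_nonneg_right (hM i) (sq_nonneg _)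
  have h3 : S ^ 2 ≤ ‖f‖ ^ 2 * (M * S) := by
    calc S ^ 2 ≤ (‖f‖ * ‖∑ i ∈ s, inner ℝ f (u i) • u i‖) ^ 2 := by
          rw [sq_le_sq₀ hS0 (by positivity)]
          rw [h1]
          exact real_inner_le_norm _ _
      _ ≤ ‖f‖ ^ 2 * (M * S) := by
          rw [mul_pow]
          gcongr
  rcases hS0.eq_or_lt with h0 | hpos
  · rw [← h0]
    positivity
  · refine le_of_mul_le_mul_right ?_ hpos
    calc S * S = S ^ 2 := (sq S).symm
      _ ≤ ‖f‖ ^ 2 * (M * S) := h3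
      _ = M * ‖f‖ ^ 2 * S := by ring

theorem norm_sum_inner_smul_sq_le {u v : ι → E} {N : ℝ}
    (hv : ∀ i j, i ≠ j → inner ℝ (v i) (v j) = 0) (hN' : ∀ i, ‖v i‖ ^ 2 ≤ N) (f : E) (s : Finset ι) :
    ‖∑ i ∈ s, inner ℝ f (u i) • v i‖ ^ 2 ≤ N * ∑ i ∈ s, (inner ℝ f (u i)) ^ 2 := by
  rw [norm_sum_sq_of_orthogonal (w := fun i => inner ℝ f (u i) • v i) (fun i j hij => by
    rw [inner_smul_left, inner_smul_right, hv i j hij, mul_zero, mul_zero]), Finset.mul_sum]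
  refine Finset.sum_le_sum fun i _ => ?_
  rw [norm_smul, mul_pow, Real.norm_eq_abs, sq_abs, mul_comm]
  exact mul_le_mul_of_nonneg_right (hN' i) (sq_nonneg _)

/-- A sum of rank one operators built from two bounded orthogonal families is a bounded operator. -/
theorem exists_hasSum_inner_smul [CompleteSpace E] {u v : ι → E} {M N : ℝ} (hM0 : 0 ≤ M)
    (hN : 0 ≤ N)
    (hu : ∀ i j, i ≠ j → inner ℝ (u i) (u j) = 0) (hv : ∀ i j, i ≠ j → inner ℝ (v i) (v j) = 0)
    (hM : ∀ i, ‖u i‖ ^ 2 ≤ M) (hN' : ∀ i, ‖v i‖ ^ 2 ≤ N) :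
    ∃ P : E →L[ℝ] E, ∀ f, HasSum (fun i => inner ℝ f (u i) • v i) (P f) := by
  have hsq : ∀ f, Summable fun i => (inner ℝ f (u i)) ^ 2 := fun f =>
    summable_of_sum_le (fun _ => sq_nonneg _) (sum_inner_sq_le hM0 hu hM f)
  have hsum : ∀ f, Summable fun i => inner ℝ f (u i) • v i := by
    intro f
    rw [summable_iff_vanishing_norm]
    intro ε hε
    -- The tail of the vector series is controlled by `N` times the tail of the squared
    -- coefficients; `N + 1` avoids division by zero.
    obtain ⟨s, hs⟩ := summable_iff_vanishing_norm.1 (hsq f) (ε ^ 2 / (N + 1)) (by positivity)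
    refine ⟨s, fun t ht => ?_⟩
    have h1 := (le_abs_self _).trans_lt (hs t ht)
    have h2 := norm_sum_inner_smul_sq_le (u := u) hv hN' f t
    refine lt_of_pow_lt_pow_left₀ 2 hε.le (h2.trans_lt ?_)
    rw [lt_div_iff₀ (by positivity)] at h1
    have h3 : 0 ≤ ∑ i ∈ t, (inner ℝ f (u i)) ^ 2 := Finset.sum_nonneg fun _ _ => sq_nonneg _
    linarith
  let L : E →ₗ[ℝ] E :=
    { toFun := fun f => ∑' i, inner ℝ f (u i) • v i
      map_add' := fun f g => by
        rw [← (hsum f).tsum_add (hsum g)]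
        simp_rw [inner_add_left, add_smul]
      map_smul' := fun c f => by
        rw [RingHom.id_apply, ← (hsum f).tsum_const_smul]
        simp_rw [real_inner_smul_left, mul_smul] }
  refine ⟨L.mkContinuous (√(N * M)) fun f => ?_, fun f => (hsum f).hasSum⟩
  refine le_of_tendsto (hsum f).hasSum.norm (Filter.Eventually.of_forall fun s => ?_)
  refine le_of_sq_le_sq ?_ (by positivity)
  rw [mul_pow, Real.sq_sqrt (by positivity), mul_assoc]
  exact (norm_sum_inner_smul_sq_le (u := u) hv hN' f s).trans
    (mul_le_mul_of_nonneg_left (sum_inner_sq_le hM0 hu hM f s) hN)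

end Hilbert

/-! ### Kernel estimates and the representation formula -/

section Kernel

variable {X : Type*} {D : ℤ → Set (Set X)} {u v : Set X → X → ℝ}

/-- The kernel of the sum of the rank one operators `f ↦ ⟨f, u Q⟩ v Q`. -/
noncomputable def atomKernel (D : ℤ → Set (Set X)) (u v : Set X → X → ℝ) (x y : X) : ℝ :=
  ∑' Q : splitCubes D, u Q x * v Q y

theorem atomKernel_comm (x y : X) : atomKernel D u v x y = atomKernel D v u y x :=
  tsum_congr fun _ => mul_comm _ _

variable [MeasurableSpace X] {d : X → X → ℝ} {μ : Measure X} {lam A a b : ℝ}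

/-- A term vanishes unless its cube contains both points, and is then at most `a * b / μ.real Q`;
the geometric growth of measures sums these. The bound `m` is kept free because it is also applied
with points moving in a region. -/
theorem sum_abs_atoms_le (T : IsRegularTree d μ lam D A) (hu : IsAtomFamily μ D a u)
    (hv : IsAtomFamily μ D b v) (ha : 0 ≤ a) (hb : 0 ≤ b) {x y : X} {m : ℝ} (hm : 0 < m)
    (hxy : ∀ Q, IsCube D Q → x ∈ Q → y ∈ Q → m ≤ μ.real Q) (s : Finset (splitCubes D)) :
    ∑ Q ∈ s, |u Q x * v Q y| ≤ a * b * A / m := by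
  classical
  have hterm : ∀ Q : splitCubes D, |u Q x * v Q y| ≤ a * b * (1 / μ.real (Q : Set X)) := by
    intro Q
    have h0 := T.measureReal_pos (isCube_of_mem_splitCubes Q.2)
    rw [abs_mul]
    calc |u Q x| * |v Q y| ≤ a / √(μ.real (Q : Set X)) * (b / √(μ.real (Q : Set X))) := by
          gcongr
          · exact hu.abs_le Q Q.2 x
          · exact hv.abs_le Q Q.2 y
      _ = a * b * (1 / μ.real (Q : Set X)) := by
          rw [div_mul_div_comm, Real.mul_self_sqrt h0.le]
          ring
  set t := s.filter fun Q : splitCubes D => x ∈ (Q : Set X) ∧ y ∈ (Q : Set X) with ht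
  have h1 : ∑ Q ∈ s, |u Q x * v Q y| = ∑ Q ∈ t, |u Q x * v Q y| := by
    rw [ht, Finset.sum_filter_of_ne]
    intro Q _ hne
    by_contra hnot
    rcases not_and_or.1 hnot with h | h
    · simp [hu.eq_zero_of_notMem Q Q.2 x h] at hne
    · simp [hv.eq_zero_of_notMem Q Q.2 y h] at hne
  have hmem : ∀ Q ∈ t.map (Function.Embedding.subtype _), IsCube D Q ∧ x ∈ Q ∧ y ∈ Q := by
    intro Q hQ
    obtain ⟨Q', hQ', rfl⟩ := Finset.mem_map.1 hQ
    exact ⟨isCube_of_mem_splitCubes Q'.2, (Finset.mem_filter.1 hQ').2⟩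
  have h2 := T.sum_inv_measure_le x (t.map (Function.Embedding.subtype _))
    (fun Q hQ => ⟨(hmem Q hQ).1, (hmem Q hQ).2.1⟩) m hm
    (fun Q hQ => hxy Q (hmem Q hQ).1 (hmem Q hQ).2.1 (hmem Q hQ).2.2)
  rw [Finset.sum_map] at h2
  calc ∑ Q ∈ s, |u Q x * v Q y| = ∑ Q ∈ t, |u Q x * v Q y| := h1
    _ ≤ ∑ Q ∈ t, a * b * (1 / μ.real (Q : Set X)) := Finset.sum_le_sum fun Q _ => hterm Q
    _ = a * b * ∑ Q ∈ t, 1 / μ.real (Q : Set X) := by rw [Finset.mul_sum]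
    _ ≤ a * b * (A / m) := by
        gcongr
        exact h2
    _ = _ := by ring

theorem summable_atoms (T : IsRegularTree d μ lam D A) (hu : IsAtomFamily μ D a u)
    (hv : IsAtomFamily μ D b v) (ha : 0 ≤ a) (hb : 0 ≤ b) {x y : X} (hxy : x ≠ y) :
    Summable fun Q : splitCubes D => u Q x * v Q y := by
  obtain ⟨Q, hQ, -, -, hmin, -⟩ := T.exists_dyadicDist_eq hxy
  exact Summable.of_abs (summable_of_sum_le (fun _ => abs_nonneg _)
    (sum_abs_atoms_le T hu hv ha hb (T.measureReal_pos (isCube_of_mem_splitCubes hQ))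
      fun Q' hQ' hx hy => T.measureReal_le hQ' (hmin Q' hQ' hx hy)))

theorem abs_atomKernel_le (T : IsRegularTree d μ lam D A) (hu : IsAtomFamily μ D a u)
    (hv : IsAtomFamily μ D b v) (ha : 0 ≤ a) (hb : 0 ≤ b) {x y : X} {m : ℝ} (hm : 0 < m)
    (hxy : ∀ Q, IsCube D Q → x ∈ Q → y ∈ Q → m ≤ μ.real Q) :
    |atomKernel D u v x y| ≤ a * b * A / m := by
  have h := sum_abs_atoms_le T hu hv ha hb hm hxy
  have hs : Summable fun Q : splitCubes D => ‖u Q x * v Q y‖ :=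
    summable_of_sum_le (fun _ => norm_nonneg _) h
  exact (norm_tsum_le_tsum_norm hs).trans (hs.tsum_le_of_sum_le h)

theorem abs_atomKernel_le_div (T : IsRegularTree d μ lam D A) (hu : IsAtomFamily μ D a u)
    (hv : IsAtomFamily μ D b v) (ha : 0 ≤ a) (hb : 0 ≤ b) {x y : X} (hxy : x ≠ y) :
    |atomKernel D u v x y| ≤ a * b * A / dyadicDist μ D x y := by
  obtain ⟨Q, -, -, -, hmin, hδ⟩ := T.exists_dyadicDist_eq hxy
  refine abs_atomKernel_le T hu hv ha hb (T.dyadicDist_pos hxy) fun Q' hQ' hx hy => ?_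
  rw [hδ]
  exact T.measureReal_le hQ' (hmin Q' hQ' hx hy)

/-- Let `Q₀` be the least cube of `x, y`, `Q₁` that of `y, y'`, and `P` the parent of `Q₁`. If `Q₀ ⊆
P`, then `δ(x, y) ≤ μ(P) ≤ A δ(y, y')` and the size bounds at both points suffice. Otherwise `x ∉
P`, so no cube containing `x` lies in `P`; every atom that matters is constant on `Q₁` and the two
kernel values agree. -/
theorem abs_atomKernel_sub_le (T : IsRegularTree d μ lam D A) (hu : IsAtomFamily μ D a u)
    (hv : IsAtomFamily μ D b v) (ha : 0 ≤ a) (hb : 0 ≤ b) {x y y' : X} (hxy : x ≠ y)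
    (hy : 2 * dyadicDist μ D y' y ≤ dyadicDist μ D x y) :
    |atomKernel D u v x y' - atomKernel D u v x y| ≤
      2 * (a * b * A) * A * (dyadicDist μ D y y' / dyadicDist μ D x y ^ 2) := by
  have hA : 0 < A := by linarith [T.two_le]
  have hpos := T.dyadicDist_pos hxy
  rw [IsRegularTree.dyadicDist_comm y' y] at hy
  rcases eq_or_ne y y' with rfl | hyy
  · rw [sub_self, abs_zero, IsRegularTree.dyadicDist_self]
    simp
  have hpos' := T.dyadicDist_pos hyy
  obtain ⟨Q₀, hQ₀, hxQ₀, hyQ₀, hmin₀, hδ₀⟩ := T.exists_dyadicDist_eq hxy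
  obtain ⟨Q₁, hQ₁, hyQ₁, hyQ₁', hmin₁, hδ₁⟩ := T.exists_dyadicDist_eq hyy
  have hQ₁c := isCube_of_mem_splitCubes hQ₁
  have hxQ₁ : x ∉ Q₁ := fun hx => by
    have := T.measureReal_le hQ₁c (hmin₀ Q₁ hQ₁c hx hyQ₁)
    linarith
  -- The size bound at `(x, y')` must be in terms of `δ(x, y)`. Since `x ∉ Q₁`, a cube containing
  -- `x` and `y'` contains all of `Q₁`, hence `y`.
  have hbig : ∀ Q, IsCube D Q → x ∈ Q → y' ∈ Q → dyadicDist μ D x y ≤ μ.real Q := by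
    intro Q hQ hxQ hyQ
    rw [hδ₀]
    rcases T.dyadic.subset_or_subset hQ hQ₁c hyQ hyQ₁' with h | h
    · exact absurd (h hxQ) hxQ₁
    · exact T.measureReal_le hQ (hmin₀ Q hQ hxQ (h hyQ₁))
  obtain ⟨P, hP⟩ := T.exists_parent hQ₁c
  by_cases hcase : Q₀ ⊆ P
  · have hcomp : dyadicDist μ D x y ≤ A * dyadicDist μ D y y' := by
      rw [hδ₀, hδ₁]
      exact (T.measureReal_le (isCube_of_mem_splitCubes (mem_splitCubes_of_mem_children hP))
        hcase).trans (T.measure_le_child P Q₁ hP)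
    have h1 := abs_atomKernel_le T hu hv ha hb hpos hbig
    have h2 := abs_atomKernel_le_div T hu hv ha hb hxy
    calc |atomKernel D u v x y' - atomKernel D u v x y|
        ≤ |atomKernel D u v x y'| + |atomKernel D u v x y| := abs_sub _ _
      _ ≤ a * b * A / dyadicDist μ D x y + a * b * A / dyadicDist μ D x y := add_le_add h1 h2
      _ = 2 * (a * b * A) * (dyadicDist μ D x y / dyadicDist μ D x y ^ 2) := by
          field_simp
          ring
      _ ≤ 2 * (a * b * A) * (A * dyadicDist μ D y y' / dyadicDist μ D x y ^ 2) := by gcongr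
      _ = _ := by ring
  · have heq : atomKernel D u v x y' = atomKernel D u v x y := by
      refine tsum_congr fun Q => ?_
      by_cases hxQ : x ∈ (Q : Set X)
      swap
      · rw [hu.eq_zero_of_notMem Q Q.2 x hxQ, zero_mul, zero_mul]
      congr 1
      refine hv.const Q Q.2 Q₁ P hP (fun hQP => ?_) y' hyQ₁' y hyQ₁
      have hQc := isCube_of_mem_splitCubes Q.2
      have hPc := isCube_of_mem_splitCubes (mem_splitCubes_of_mem_children hP)
      exact hcase (hmin₀ P hPc (hQP hxQ) (subset_of_mem_children hP hyQ₁))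
    rw [heq, sub_self, abs_zero]
    positivity

theorem aestronglyMeasurable_atomKernel (T : IsRegularTree d μ lam D A)
    (hu : IsAtomFamily μ D a u) (hv : IsAtomFamily μ D b v) (ha : 0 ≤ a) (hb : 0 ≤ b)
    {E : Set (X × X)} (hE : MeasurableSet E) (hne : ∀ z ∈ E, z.1 ≠ z.2) :
    AEStronglyMeasurable (fun z : X × X => atomKernel D u v z.1 z.2)
      ((μ.prod μ).restrict E) := by
  have hcount : Countable (splitCubes D) :=
    ((T.dyadic.countable_cubes T.homogeneous).mono
      fun Q hQ => isCube_of_mem_splitCubes hQ).to_subtype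
  refine aestronglyMeasurable_of_tendsto_ae Filter.atTop
    (f := fun s : Finset (splitCubes D) => fun z : X × X => ∑ Q ∈ s, u Q z.1 * v Q z.2)
    (fun s => ?_) ?_
  · refine Measurable.aestronglyMeasurable (Finset.measurable_fun_sum _ fun Q _ => ?_)
    exact ((hu.measurable Q Q.2).comp measurable_fst).mul
      ((hv.measurable Q Q.2).comp measurable_snd)
  · filter_upwards [ae_restrict_mem hE] with z hz
    exact (summable_atoms T hu hv ha hb (hne z hz)).hasSum

/-- With `r = δ(x, y)`, the two balls lie in the distinct children of the least common cube that
contain `x` and `y`. On the product of these children the kernel is bounded and the measure is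
finite. -/
theorem exists_integrableOn_atomKernel (T : IsRegularTree d μ lam D A)
    (hu : IsAtomFamily μ D a u) (hv : IsAtomFamily μ D b v) (ha : 0 ≤ a) (hb : 0 ≤ b) {x y : X}
    (hxy : x ≠ y) : ∃ r : ℝ, 0 < r ∧
      IntegrableOn (fun z : X × X => atomKernel D u v z.1 z.2)
        (ball (dyadicDist μ D) x r ×ˢ ball (dyadicDist μ D) y r) (μ.prod μ) := by
  have := IsDyadicFamily.sigmaFinite T.homogeneous
  obtain ⟨Q₀, hQ₀, hxQ₀, hyQ₀, hmin₀, hδ₀⟩ := T.exists_dyadicDist_eq hxy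
  have hQ₀c := isCube_of_mem_splitCubes hQ₀
  have hpos := T.dyadicDist_pos hxy
  have hball : ∀ z ∈ Q₀, ∀ R ∈ children D Q₀, z ∈ R →
      ball (dyadicDist μ D) z (dyadicDist μ D x y) ⊆ R := by
    intro z hz R hR hzR w hw
    rcases eq_or_ne z w with rfl | hzw
    · exact hzR
    obtain ⟨Q, hQ, hzQ, hwQ, -, hδ⟩ := T.exists_dyadicDist_eq hzw
    have hQc := isCube_of_mem_splitCubes hQ
    have hlt : μ.real Q < μ.real Q₀ := by rw [← hδ, ← hδ₀]; exact hw
    rcases T.dyadic.subset_or_subset hQc hQ₀c hzQ hz with h | h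
    · obtain ⟨R', hR', hQR'⟩ := T.dyadic.exists_child_superset hQ₀ hQc
        (h.ssubset_of_ne (by rintro rfl; exact hlt.false))
      obtain rfl := T.dyadic.children_eq_of_mem hR hR' hzR (hQR' hzQ)
      exact hQR' hwQ
    · have := T.measureReal_le hQc h
      linarith
  obtain ⟨R, hR, hxR⟩ := T.dyadic.exists_child hQ₀ hxQ₀
  obtain ⟨R', hR', hyR'⟩ := T.dyadic.exists_child hQ₀ hyQ₀
  have hRc := isCube_of_mem_children hR
  have hRc' := isCube_of_mem_children hR'
  have hRy : y ∉ R := fun h =>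
    (T.dyadic.children_ssubset hR).2 (hmin₀ R hRc hxR h)
  have hsep : ∀ z ∈ R, ∀ w ∈ R', ∀ Q, IsCube D Q → z ∈ Q → w ∈ Q →
      dyadicDist μ D x y ≤ μ.real Q := by
    intro z hz w hw Q hQ hzQ hwQ
    rw [hδ₀]
    rcases T.dyadic.subset_or_subset hQ hRc hzQ hz with h | h
    · obtain rfl := T.dyadic.children_eq_of_mem hR hR' (h hwQ) hw
      exact absurd hyR' hRy
    rcases T.dyadic.subset_or_subset hQ hRc' hwQ hw with h' | h'
    · obtain rfl := T.dyadic.children_eq_of_mem hR hR' hz (h' hzQ)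
      exact absurd hyR' hRy
    exact T.measureReal_le hQ (hmin₀ Q hQ (h hxR) (h' hyR'))
  refine ⟨dyadicDist μ D x y, hpos, IntegrableOn.mono_set (t := R ×ˢ R') ?_
    (Set.prod_mono (hball x hxQ₀ R hR hxR) (hball y hyQ₀ R' hR' hyR'))⟩
  have hmeas : MeasurableSet (R ×ˢ R') :=
    (T.dyadic.measurableSet_cube hRc).prod (T.dyadic.measurableSet_cube hRc')
  have hfin : (μ.prod μ) (R ×ˢ R') < ⊤ := by
    rw [Measure.prod_prod]
    exact ENNReal.mul_lt_top (T.measure_ne_top hRc).lt_top (T.measure_ne_top hRc').lt_top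
  refine ⟨aestronglyMeasurable_atomKernel T hu hv ha hb hmeas ?_,
    HasFiniteIntegral.restrict_of_bounded (a * b * A / dyadicDist μ D x y) hfin ?_⟩
  · rintro ⟨z, w⟩ ⟨hz, hw⟩ hzw
    obtain rfl : z = w := hzw
    obtain rfl := T.dyadic.children_eq_of_mem hR hR' hz hw
    exact hRy hyR'
  · filter_upwards [ae_restrict_mem hmeas] with z hz
    exact abs_atomKernel_le T hu hv ha hb hpos (hsep z.1 hz.1 z.2 hz.2)

/-- Dominated convergence for the finite partial sums: on the supports the points are at distance at
least `ε`, so `sum_abs_atoms_le` bounds all partial sums uniformly. -/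
theorem hasSum_integral_atoms (T : IsRegularTree d μ lam D A) (hu : IsAtomFamily μ D a u)
    (hv : IsAtomFamily μ D b v) (ha : 0 ≤ a) (hb : 0 ≤ b) {φ ψ : X → ℝ} (hφm : Measurable φ)
    (hψm : Measurable ψ) (hφ : Integrable φ μ) (hψ : Integrable ψ μ) {ε : ℝ} (hε : 0 < ε)
    (hsep : ∀ x y, φ x ≠ 0 → ψ y ≠ 0 → x ≠ y ∧ ε ≤ dyadicDist μ D x y)
    (hφu : ∀ Q ∈ splitCubes D, Integrable (fun x => u Q x * φ x) μ)
    (hψv : ∀ Q ∈ splitCubes D, Integrable (fun x => v Q x * ψ x) μ) :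
    Integrable (fun z : X × X => atomKernel D u v z.1 z.2 * φ z.1 * ψ z.2) (μ.prod μ) ∧
    HasSum (fun Q : splitCubes D => (∫ x, u Q x * φ x ∂μ) * ∫ y, v Q y * ψ y ∂μ)
      (∫ z : X × X, atomKernel D u v z.1 z.2 * φ z.1 * ψ z.2 ∂(μ.prod μ)) := by
  have := IsDyadicFamily.sigmaFinite T.homogeneous
  have hcount : Countable (splitCubes D) :=
    ((T.dyadic.countable_cubes T.homogeneous).mono
      fun Q hQ => isCube_of_mem_splitCubes hQ).to_subtype
  have hlim : ∀ z : X × X, HasSum (fun Q : splitCubes D => u Q z.1 * v Q z.2 * φ z.1 * ψ z.2)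
      (atomKernel D u v z.1 z.2 * φ z.1 * ψ z.2) := by
    intro z
    by_cases h : φ z.1 = 0 ∨ ψ z.2 = 0
    · have h0 : ∀ c : ℝ, c * φ z.1 * ψ z.2 = 0 := fun c => by rcases h with h | h <;> simp [h]
      simp only [h0]
      exact hasSum_zero
    · push Not at h
      exact ((summable_atoms T hu hv ha hb (hsep _ _ h.1 h.2).1).hasSum.mul_right _).mul_right _
  have hbound : ∀ (s : Finset (splitCubes D)) (z : X × X),
      ‖∑ Q ∈ s, u Q z.1 * v Q z.2 * φ z.1 * ψ z.2‖ ≤ a * b * A / ε * (|φ z.1| * |ψ z.2|) := by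
    intro s z
    rw [← Finset.sum_mul, ← Finset.sum_mul, Real.norm_eq_abs, abs_mul, abs_mul, mul_assoc]
    by_cases h : φ z.1 = 0 ∨ ψ z.2 = 0
    · rcases h with h | h <;> simp [h]
    · push Not at h
      obtain ⟨hne, hle⟩ := hsep _ _ h.1 h.2
      gcongr
      refine (Finset.abs_sum_le_sum_abs _ _).trans
        (sum_abs_atoms_le T hu hv ha hb hε (fun Q hQ hx hy => hle.trans ?_) s)
      obtain ⟨Q', -, -, -, hmin, hδ⟩ := T.exists_dyadicDist_eq hne
      rw [hδ]
      exact T.measureReal_le hQ (hmin Q hQ hx hy)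
  have hbint : Integrable (fun z : X × X => a * b * A / ε * (|φ z.1| * |ψ z.2|)) (μ.prod μ) :=
    (hφ.abs.mul_prod hψ.abs).const_mul _
  have hmeas : ∀ s : Finset (splitCubes D), AEStronglyMeasurable
      (fun z : X × X => ∑ Q ∈ s, u Q z.1 * v Q z.2 * φ z.1 * ψ z.2) (μ.prod μ) := fun s =>
    Measurable.aestronglyMeasurable (Finset.measurable_fun_sum _ fun Q _ =>
      ((((hu.measurable Q Q.2).comp measurable_fst).mul
        ((hv.measurable Q Q.2).comp measurable_snd)).mul (hφm.comp measurable_fst)).mul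
        (hψm.comp measurable_snd))
  constructor
  · refine hbint.mono' (aestronglyMeasurable_of_tendsto_ae Filter.atTop hmeas
      (Filter.Eventually.of_forall hlim)) (Filter.Eventually.of_forall fun z => ?_)
    exact le_of_tendsto (hlim z).norm (Filter.Eventually.of_forall fun s => hbound s z)
  · have := tendsto_integral_filter_of_dominated_convergence _
      (Filter.Eventually.of_forall hmeas)
      (Filter.Eventually.of_forall fun s => Filter.Eventually.of_forall (hbound s)) hbint
      (Filter.Eventually.of_forall hlim)
    refine this.congr fun s => ?_
    have hsplit : ∀ (Q : splitCubes D) (z : X × X), u Q z.1 * v Q z.2 * φ z.1 * ψ z.2 =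
        (u Q z.1 * φ z.1) * (v Q z.2 * ψ z.2) := fun Q z => by ring
    simp_rw [hsplit]
    rw [integral_finsetSum _ fun (Q : splitCubes D) _ => (hφu Q Q.2).mul_prod (hψv Q Q.2)]
    exact Finset.sum_congr rfl fun Q _ => integral_prod_mul (fun x => u Q x * φ x)
      fun y => v Q y * ψ y

/-! ### Linear combinations of Haar functions -/

variable {H : Set (X → ℝ)}

namespace IsHaarSystem

theorem measurable_of_mem_span (hH : IsHaarSystem μ D H) {φ : X → ℝ}
    (hφ : φ ∈ Submodule.span ℝ H) : Measurable φ := by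
  induction hφ using Submodule.span_induction with
  | mem h hh => exact hH.measurable h hh
  | zero => exact measurable_const
  | add f g _ _ hf hg => exact hf.add hg
  | smul c f _ hf => exact hf.const_smul c

theorem memLp_of_mem_span (hH : IsHaarSystem μ D H) (T : IsRegularTree d μ lam D A) {φ : X → ℝ}
    (hφ : φ ∈ Submodule.span ℝ H) (p : ℝ≥0∞) : MemLp φ p μ := by
  induction hφ using Submodule.span_induction with
  | mem h hh => exact hH.memLp_haar T hh p
  | zero => exact MemLp.zero'
  | add f g _ _ hf hg => exact hf.add hg
  | smul c f _ hf => exact hf.const_smul c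

/-- A combination of Haar functions does not vary at small distances. -/
theorem exists_dyadicDist_ge_of_mem_span (hH : IsHaarSystem μ D H)
    (T : IsRegularTree d μ lam D A) {φ : X → ℝ} (hφ : φ ∈ Submodule.span ℝ H) :
    ∃ ε : ℝ, 0 < ε ∧ ∀ x y, φ x ≠ φ y → ε ≤ dyadicDist μ D x y := by
  induction hφ using Submodule.span_induction with
  | mem h hh =>
    obtain ⟨Q, hQ⟩ := hH.exists_mem_haarAt hh
    have hQc := isCube_of_mem_splitCubes (mem_splitCubes_of_mem_haarAt hQ)
    refine ⟨μ.real Q, T.measureReal_pos hQc, fun x y hne => ?_⟩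
    obtain ⟨Q', hQ', hx, hy, -, hδ⟩ := T.exists_dyadicDist_eq (ne_of_apply_ne h hne)
    have hQ'c := isCube_of_mem_splitCubes hQ'
    rw [hδ]
    refine T.measureReal_le hQ'c ?_
    by_contra hnot
    have key : ∀ z ∈ Q', z ∈ Q → Q' ⊂ Q := fun z hz hz' => by
      rcases T.dyadic.subset_or_subset hQ'c hQc hz hz' with h | h
      · exact ⟨h, hnot⟩
      · exact absurd h hnot
    by_cases hxQ : x ∈ Q
    · exact hne (hH.const_of_ssubset T hQ hQ'c (key x hx hxQ) hx hy)
    · by_cases hyQ : y ∈ Q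
      · exact hne (hH.const_of_ssubset T hQ hQ'c (key y hy hyQ) hx hy)
      · exact hne (by rw [hH.eq_zero_of_notMem hQ hxQ, hH.eq_zero_of_notMem hQ hyQ])
  | zero => exact ⟨1, one_pos, fun x y h => absurd rfl h⟩
  | add f g _ _ hf hg =>
    obtain ⟨ε, hε, h⟩ := hf
    obtain ⟨ε', hε', h'⟩ := hg
    refine ⟨min ε ε', lt_min hε hε', fun x y hne => ?_⟩
    by_cases hfe : f x = f y
    · refine (min_le_right _ _).trans (h' x y fun hge => hne ?_)
      simp [hfe, hge]
    · exact (min_le_left _ _).trans (h x y hfe)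
  | smul c f _ hf =>
    obtain ⟨ε, hε, h⟩ := hf
    exact ⟨ε, hε, fun x y hne => h x y fun he => hne (by simp [he])⟩

end IsHaarSystem

theorem isCalderonZygmund_of_hasSum (T : IsRegularTree d μ lam D A) (hH : IsHaarSystem μ D H)
    (hu : IsAtomFamily μ D a u) (hv : IsAtomFamily μ D b v) (ha : 0 ≤ a) (hb : 0 ≤ b)
    {P : Lp ℝ 2 μ →L[ℝ] Lp ℝ 2 μ}
    (hP : ∀ f, HasSum (fun Q : splitCubes D => inner ℝ f (toL2 μ (u Q)) • toL2 μ (v Q)) (P f)) :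
    IsCalderonZygmund (dyadicDist μ D) μ (Submodule.span ℝ H) P := by
  have hA : 0 < A := by linarith [T.two_le]
  -- Puts the estimate in the required form with `γ = 1`; adding 1 makes the constant strictly
  -- positive.
  have hpow : ∀ {x y x' y' : X}, x ≠ y →
      2 * (a * b * A) * A * (dyadicDist μ D x' y' / dyadicDist μ D x y ^ 2) ≤
        (2 * (a * b * A) * A + 1) *
          (dyadicDist μ D x' y' ^ (1 : ℝ) / dyadicDist μ D x y ^ (1 + 1 : ℝ)) := by
    intro x y x' y' hxy
    have h0 : 0 ≤ dyadicDist μ D x' y' := by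
      rcases eq_or_ne x' y' with rfl | h
      · rw [IsRegularTree.dyadicDist_self]
      · exact (T.dyadicDist_pos h).le
    have h2 : dyadicDist μ D x y ^ (1 + 1 : ℝ) = dyadicDist μ D x y ^ 2 := by
      rw [one_add_one_eq_two]
      exact Real.rpow_two _
    rw [Real.rpow_one, h2]
    gcongr
    linarith
  refine ⟨atomKernel D u v, fun x y hxy => exists_integrableOn_atomKernel T hu hv ha hb hxy,
    ⟨a * b * A + 1, by positivity, fun x y hxy => ?_⟩,
    ⟨2 * (a * b * A) * A + 1, 1, by positivity, one_pos, fun x x' y hxy hx => ?_,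
      fun x y y' hxy hy => ?_⟩, ?_⟩
  · refine (abs_atomKernel_le_div T hu hv ha hb hxy).trans ?_
    have := T.dyadicDist_pos hxy
    gcongr
    linarith
  -- Regularity in the first variable is regularity in the second for the kernel with `u` and `v`
  -- exchanged.
  · rw [atomKernel_comm x' y, atomKernel_comm x y]
    rw [IsRegularTree.dyadicDist_comm x y] at hx
    have := abs_atomKernel_sub_le T hv hu hb ha hxy.symm hx
    rw [mul_comm b a] at this
    replace this := this.trans (hpow hxy.symm)
    rwa [IsRegularTree.dyadicDist_comm x' x, IsRegularTree.dyadicDist_comm x y]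
  · exact (abs_atomKernel_sub_le T hu hv ha hb hxy hy).trans (hpow hxy)
  · intro φ hφ ψ hψ hdisj F G hF hG
    obtain ⟨ε, hε, hεφ⟩ := hH.exists_dyadicDist_ge_of_mem_span T hφ
    have hφ2 := hH.memLp_of_mem_span T hφ 2
    have hψ2 := hH.memLp_of_mem_span T hψ 2
    -- Disjoint supports make `φ` vanish at `y`, so `φ` takes different values at `x` and `y`, and a
    -- combination of Haar functions cannot vary at distances below `ε`.
    have hsep : ∀ x y, φ x ≠ 0 → ψ y ≠ 0 → x ≠ y ∧ ε ≤ dyadicDist μ D x y := by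
      intro x y hx hy
      have hφy : φ y = 0 := by
        by_contra h
        exact Set.disjoint_left.1 hdisj h hy
      have hne : φ x ≠ φ y := by rwa [hφy]
      exact ⟨ne_of_apply_ne φ hne, hεφ x y hne⟩
    obtain ⟨hint, hsum⟩ := hasSum_integral_atoms T hu hv ha hb (hH.measurable_of_mem_span hφ)
      (hH.measurable_of_mem_span hψ) (memLp_one_iff_integrable.1 (hH.memLp_of_mem_span T hφ 1))
      (memLp_one_iff_integrable.1 (hH.memLp_of_mem_span T hψ 1)) hε hsep
      (fun Q hQ => (hu.memLp T hQ 2).integrable_mul hφ2)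
      (fun Q hQ => (hv.memLp T hQ 2).integrable_mul hψ2)
    refine ⟨hint, ?_⟩
    have h1 := (hP F).mapL (innerSL ℝ G)
    have h2 : inner ℝ (P F) G = innerSL ℝ G (P F) := by
      rw [innerSL_apply_apply, real_inner_comm]
    rw [h2]
    refine h1.unique (hsum.congr_fun fun Q => ?_)
    rw [map_smul, innerSL_apply_apply, smul_eq_mul, inner_toL2 _ (hu.memLp T Q.2 2),
      inner_toL2 _ (hv.memLp T Q.2 2)]
    congr 1
    · refine integral_congr_ae ?_
      filter_upwards [hF] with x hx
      rw [hx, mul_comm]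
    · refine integral_congr_ae ?_
      filter_upwards [hG] with x hx
      rw [hx, mul_comm]

end Kernel

/-! ### The weak type estimate on $L^1\cap L^2$ -/

section WeakType

variable {X : Type*} [MeasurableSpace X] {d : X → X → ℝ} {μ : Measure X} {lam : ℝ}
  {D : ℤ → Set (Set X)} {A a b : ℝ} {u v : Set X → X → ℝ}

/-- `f` is constant on every cube of level `J`. -/
def IsLevelConst (D : ℤ → Set (Set X)) (J : ℤ) (f : X → ℝ) : Prop :=
  ∀ Q ∈ D J, ∀ x ∈ Q, ∀ y ∈ Q, f x = f y

theorem IsLevelConst.measurable (T : IsRegularTree d μ lam D A) {J : ℤ} {f : X → ℝ}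
    (hf : IsLevelConst D J f) : Measurable f := by
  intro s _
  have : f ⁻¹' s = ⋃ Q ∈ {Q ∈ D J | Q ⊆ f ⁻¹' s}, Q := by
    ext x
    simp only [Set.mem_iUnion, Set.mem_ofPred_eq, exists_prop]
    constructor
    · intro hx
      obtain ⟨Q, hQ, hxQ⟩ := T.dyadic.exists_mem J x
      refine ⟨Q, ⟨hQ, fun y hy => ?_⟩, hxQ⟩
      rw [Set.mem_preimage, hf Q hQ y hy x hxQ]
      exact hx
    · rintro ⟨Q, ⟨-, hQ⟩, hx⟩
      exact hQ hx
  rw [this]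
  exact MeasurableSet.biUnion ((T.dyadic.countable_level T.homogeneous J).mono fun Q hQ => hQ.1)
    fun Q hQ => T.dyadic.measurableSet J Q hQ.1

theorem lintegral_le_of_pieces {C : Set (Set X)} (hC : C.Countable)
    (hmeas : ∀ Q ∈ C, MeasurableSet Q) (hdisj : C.PairwiseDisjoint id) {F G : X → ℝ≥0∞}
    (hle : ∀ Q ∈ C, ∫⁻ x in Q, F x ∂μ ≤ ∫⁻ x in Q, G x ∂μ) (hoff : ∀ x ∉ ⋃₀ C, F x ≤ G x) :
    ∫⁻ x, F x ∂μ ≤ ∫⁻ x, G x ∂μ := by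
  have hm : MeasurableSet (⋃ Q ∈ C, Q) := MeasurableSet.biUnion hC hmeas
  rw [← lintegral_add_compl F hm, ← lintegral_add_compl G hm]
  refine add_le_add ?_ (setLIntegral_mono' hm.compl fun x hx => hoff x ?_)
  · rw [lintegral_biUnion hC hmeas hdisj, lintegral_biUnion hC hmeas hdisj]
    exact ENNReal.tsum_le_tsum fun Q => hle Q Q.2
  · rw [Set.sUnion_eq_biUnion]
    exact hx

theorem integral_eq_zero_of_pieces {C : Set (Set X)} (hC : C.Countable)
    (hmeas : ∀ Q ∈ C, MeasurableSet Q) (hdisj : C.PairwiseDisjoint id) {F : X → ℝ}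
    (hF : Integrable F μ) (hzero : ∀ Q ∈ C, ∫ x in Q, F x ∂μ = 0) (hoff : ∀ x ∉ ⋃₀ C, F x = 0) :
    ∫ x, F x ∂μ = 0 := by
  have hcount : Countable C := hC.to_subtype
  rw [← setIntegral_eq_integral_of_forall_compl_eq_zero hoff, Set.sUnion_eq_iUnion,
    integral_iUnion (fun Q : C => hmeas Q Q.2)
      (fun Q Q' hne => hdisj Q.2 Q'.2 fun h => hne (Subtype.ext h)) hF.integrableOn]
  simp_rw [fun Q : C => hzero Q Q.2, tsum_zero]

theorem measure_lt_abs_le_ofReal (F : Lp ℝ 2 μ) {t : ℝ} (ht : 0 < t) :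
    μ {x | t < |F x|} ≤ ENNReal.ofReal (‖F‖ ^ 2 / t ^ 2) := by
  have h := meas_ge_le_mul_pow_eLpNorm_enorm μ (two_ne_zero : (2 : ℝ≥0∞) ≠ 0) ENNReal.ofNat_ne_top
    (Lp.aestronglyMeasurable F) (ε := ENNReal.ofReal t) (by simpa using ht) (by simp)
  have h1 : {x | t < |F x|} ⊆ {x | ENNReal.ofReal t ≤ ‖F x‖ₑ} := fun x hx => by
    rw [Set.mem_ofPred_eq, Real.enorm_eq_ofReal_abs]
    exact ENNReal.ofReal_le_ofReal (le_of_lt hx)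
  refine (measure_mono h1).trans (h.trans (le_of_eq ?_))
  rw [← Lp.enorm_def, ← ofReal_norm, ENNReal.toReal_ofNat, ENNReal.rpow_two,
    ENNReal.rpow_two, ← ENNReal.ofReal_inv_of_pos ht, ← ENNReal.ofReal_pow (by positivity),
    ← ENNReal.ofReal_pow (by positivity), ← ENNReal.ofReal_mul (by positivity)]
  congr 1
  field_simp

theorem toL2_sub {f g : X → ℝ} (hf : MemLp f 2 μ) (hg : MemLp g 2 μ) :
    toL2 μ (f - g) = toL2 μ f - toL2 μ g := by
  rw [toL2_eq_toLp hf, toL2_eq_toLp hg, toL2_eq_toLp (hf.sub hg)]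
  rfl

/-- If `f` has no component along the atoms that do not vanish outside `E`, then `P f` vanishes
outside `E`. -/
theorem ae_eq_zero_of_hasSum (T : IsRegularTree d μ lam D A) (hv : IsAtomFamily μ D b v)
    {P : Lp ℝ 2 μ →L[ℝ] Lp ℝ 2 μ}
    (hP : ∀ f, HasSum (fun Q : splitCubes D => inner ℝ f (toL2 μ (u Q)) • toL2 μ (v Q)) (P f))
    {F : Lp ℝ 2 μ} {E : Set X} (hE : MeasurableSet E)
    (hF : ∀ Q ∈ splitCubes D, inner ℝ F (toL2 μ (u Q)) ≠ 0 → Q ⊆ E) :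
    ∀ᵐ x ∂μ, x ∉ E → P F x = 0 := by
  -- `P F` is tested against its own restriction to the complement of `E`: every term of the series
  -- pairs to zero, so the norm of that restriction is zero.
  have hmem : MemLp (Eᶜ.indicator (P F)) 2 μ := (Lp.memLp _).indicator hE.compl
  have h1 := (hP F).mapL (innerSL ℝ (toL2 μ (Eᶜ.indicator (P F))))
  have h2 : ∀ Q : splitCubes D, innerSL ℝ (toL2 μ (Eᶜ.indicator (P F)))
      (inner ℝ F (toL2 μ (u Q)) • toL2 μ (v Q)) = 0 := by
    intro Q
    rw [map_smul, smul_eq_mul, mul_eq_zero, or_iff_not_imp_left]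
    intro hne
    rw [innerSL_apply_apply, inner_toL2_toL2 hmem (hv.memLp T Q.2 2)]
    refine integral_eq_zero_of_ae (Filter.Eventually.of_forall fun x => ?_)
    by_cases hx : x ∈ E
    · simp [hx]
    · simp [hv.eq_zero_of_notMem Q Q.2 x fun h => hx (hF Q Q.2 hne h)]
  simp only [h2] at h1
  have h3 := h1.unique hasSum_zero
  rw [innerSL_apply_apply, real_inner_comm, inner_toL2 _ hmem] at h3
  have h4 : ∀ x, P F x * Eᶜ.indicator (P F) x = (Eᶜ.indicator (P F) x) ^ 2 := fun x => by
    by_cases hx : x ∈ E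
    · simp [hx]
    · simp [hx, sq]
  simp_rw [h4] at h3
  rw [integral_eq_zero_iff_of_nonneg (fun x => sq_nonneg _)
    ((memLp_two_iff_integrable_sq hmem.1).1 hmem)] at h3
  filter_upwards [h3] with x hx hxE
  simpa [hxE] using hx

/-- The Calderón–Zygmund decomposition of a function that is constant on the cubes of some
level. -/
theorem exists_calderonZygmund_decomposition (T : IsRegularTree d μ lam D A) {J : ℤ} {f : X → ℝ}
    (hfJ : IsLevelConst D J f) (hf : Integrable f μ) {t : ℝ} (ht : 0 < t) :
    ∃ (C : Set (Set X)) (g : X → ℝ), C.Countable ∧ (∀ Q ∈ C, IsCube D Q) ∧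
      C.PairwiseDisjoint id ∧ (∀ Q ∈ C, t * μ.real Q ≤ ∫ x in Q, |f x| ∂μ) ∧
      Measurable g ∧ Integrable g μ ∧ (∀ x, |g x| ≤ A * t) ∧
      ∫ x, |g x| ∂μ ≤ ∫ x, |f x| ∂μ ∧ (∀ x ∉ ⋃₀ C, g x = f x) ∧
      ∀ Q ∈ C, ∫ x in Q, (f - g) x ∂μ = 0 := by
  classical
  have hA : 0 < A := by linarith [T.two_le]
  -- Stopping cubes are the maximal ones on which the average of `|f|` exceeds `t`; bad cubes have
  -- measure at most `‖f‖₁ / t`, so maximal ones exist.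
  set bad : Set X → Prop := fun Q => t * μ.real Q < ∫ x in Q, |f x| ∂μ with hbad
  have hbad_le : ∀ Q, IsCube D Q → bad Q → μ.real Q ≤ (∫ x, |f x| ∂μ) / t := by
    intro Q hQ h
    rw [le_div_iff₀ ht, mul_comm]
    exact h.le.trans (setIntegral_le_integral hf.abs
      (Filter.Eventually.of_forall fun x => abs_nonneg _))
  set C : Set (Set X) := {Q | IsCube D Q ∧ bad Q ∧ ∀ Q', IsCube D Q' → Q ⊂ Q' → ¬ bad Q'} with hC
  have hcube : ∀ Q ∈ C, IsCube D Q := fun Q hQ => hQ.1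
  have hcount : C.Countable := (T.dyadic.countable_cubes T.homogeneous).mono hcube
  have hunique : ∀ Q ∈ C, ∀ Q' ∈ C, ∀ x, x ∈ Q → x ∈ Q' → Q = Q' := by
    intro Q hQ Q' hQ' x hx hx'
    by_contra hne
    rcases T.dyadic.subset_or_subset hQ.1 hQ'.1 hx hx' with h | h
    · exact hQ.2.2 Q' hQ'.1 (h.ssubset_of_ne hne) hQ'.2.1
    · exact hQ'.2.2 Q hQ.1 (h.ssubset_of_ne (Ne.symm hne)) hQ.2.1
  have hdisj : C.PairwiseDisjoint id := fun Q hQ Q' hQ' hne =>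
    Set.disjoint_left.2 fun x hx hx' => hne (hunique Q hQ Q' hQ' x hx hx')
  have hmeas : ∀ Q ∈ C, MeasurableSet Q := fun Q hQ => T.dyadic.measurableSet_cube hQ.1
  have hcover : ∀ Q, IsCube D Q → bad Q → ∃ Q' ∈ C, Q ⊆ Q' := by
    intro Q hQ hb
    obtain ⟨Q', hQ', hsub, hb', hmax⟩ := T.exists_maximal_cube hbad_le hQ hb
    exact ⟨Q', ⟨hQ', hb', hmax⟩, hsub⟩
  have havg : ∀ Q ∈ C, ∫ x in Q, |f x| ∂μ ≤ A * t * μ.real Q := by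
    intro Q hQ
    obtain ⟨P, hP⟩ := T.exists_parent hQ.1
    have hnb := hQ.2.2 P (isCube_of_mem_splitCubes (mem_splitCubes_of_mem_children hP))
      (T.dyadic.children_ssubset hP)
    calc ∫ x in Q, |f x| ∂μ ≤ ∫ x in P, |f x| ∂μ :=
          setIntegral_mono_set hf.abs.integrableOn
            (Filter.Eventually.of_forall fun x => abs_nonneg _)
            (Filter.Eventually.of_forall (subset_of_mem_children hP))
      _ ≤ t * μ.real P := not_lt.1 hnb
      _ ≤ t * (A * μ.real Q) := by
          gcongr
          exact T.measure_le_child P Q hP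
      _ = _ := by ring
  have hsetint : ∀ Q, IsCube D Q → ∀ F : X → ℝ, ∀ x ∈ Q, (∀ y ∈ Q, F y = F x) →
      ∫ y in Q, F y ∂μ = μ.real Q * F x := by
    intro Q hQ F x hx hF
    rw [setIntegral_congr_fun (g := fun _ => F x) (T.dyadic.measurableSet_cube hQ)
      (fun y hy => hF y hy)]
    simp
  -- Stopping cubes are unions of cubes of level `J`. If one were strictly inside a cube of that
  -- level, `|f|` would have the same average on the larger cube, against maximality. Hence `g` is
  -- again constant at level `J`, and so measurable.
  have hlevel : ∀ S ∈ D J, ∀ Q ∈ C, ∀ x, x ∈ S → x ∈ Q → S ⊆ Q := by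
    intro S hS Q hQ x hxS hxQ
    rcases T.dyadic.subset_or_subset ⟨J, hS⟩ hQ.1 hxS hxQ with h | h
    · exact h
    by_contra hnot
    have hSpos := T.measureReal_pos ⟨J, hS⟩
    have hQpos := T.measureReal_pos hQ.1
    have h1 := hQ.2.1
    refine hQ.2.2 S ⟨J, hS⟩ ⟨h, hnot⟩ ?_
    simp only [hbad] at h1 ⊢
    rw [hsetint Q hQ.1 (fun y => |f y|) x hxQ
      (fun y hy => congrArg abs (hfJ S hS y (h hy) x hxS)), mul_comm] at h1
    rw [hsetint S ⟨J, hS⟩ (fun y => |f y|) x hxS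
      (fun y hy => congrArg abs (hfJ S hS y hy x hxS)), mul_comm]
    exact mul_lt_mul_of_pos_left (lt_of_mul_lt_mul_left h1 hQpos.le) hSpos
  set g : X → ℝ := fun x => if h : ∃ Q ∈ C, x ∈ Q then (∫ y in h.choose, f y ∂μ) / μ.real h.choose
    else f x with hg
  have hgQ : ∀ Q ∈ C, ∀ x ∈ Q, g x = (∫ y in Q, f y ∂μ) / μ.real Q := by
    intro Q hQ x hx
    have h : ∃ Q ∈ C, x ∈ Q := ⟨Q, hQ, hx⟩
    have heq : h.choose = Q := hunique _ h.choose_spec.1 Q hQ x h.choose_spec.2 hx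
    simp only [hg, dif_pos h, heq]
  have hgoff : ∀ x ∉ ⋃₀ C, g x = f x := fun x hx => by
    have h : ¬ ∃ Q ∈ C, x ∈ Q := hx
    simp only [hg, dif_neg h]
  have hgJ : IsLevelConst D J g := by
    intro S hS x hx y hy
    by_cases h : ∃ Q ∈ C, x ∈ Q
    · obtain ⟨Q, hQ, hxQ⟩ := h
      rw [hgQ Q hQ x hxQ, hgQ Q hQ y (hlevel S hS Q hQ x hx hxQ hy)]
    · have h' : ¬ ∃ Q ∈ C, y ∈ Q := by
        rintro ⟨Q, hQ, hyQ⟩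
        exact h ⟨Q, hQ, hlevel S hS Q hQ y hy hyQ hx⟩
      rw [hgoff x h, hgoff y h']
      exact hfJ S hS x hx y hy
  have hgm := hgJ.measurable T
  have hgbound : ∀ x, |g x| ≤ A * t := by
    intro x
    by_cases h : ∃ Q ∈ C, x ∈ Q
    · obtain ⟨Q, hQ, hxQ⟩ := h
      have hQpos := T.measureReal_pos hQ.1
      rw [hgQ Q hQ x hxQ, abs_div, abs_of_pos hQpos, div_le_iff₀ hQpos]
      exact abs_integral_le_integral_abs.trans (havg Q hQ)
    · rw [hgoff x h]
      -- Off the stopping cubes `|f x|` is exactly the average over the cube of level `J` around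
      -- `x`, so a large value would make that cube bad.
      by_contra! hlt
      obtain ⟨S, hS, hxS⟩ := T.dyadic.exists_mem J x
      have hSpos := T.measureReal_pos ⟨J, hS⟩
      have hbS : bad S := by
        simp only [hbad]
        rw [hsetint S ⟨J, hS⟩ (fun y => |f y|) x hxS
          (fun y hy => congrArg abs (hfJ S hS y hy x hxS)), mul_comm]
        have : t ≤ A * t := by nlinarith [T.two_le]
        exact mul_lt_mul_of_pos_left (this.trans_lt hlt) hSpos
      obtain ⟨Q, hQ, hSQ⟩ := hcover S ⟨J, hS⟩ hbS
      exact h ⟨Q, hQ, hSQ hxS⟩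
  have hgint : ∀ Q ∈ C, ∫ x in Q, g x ∂μ = ∫ x in Q, f x ∂μ := by
    intro Q hQ
    obtain ⟨x, hx⟩ := T.dyadic.nonempty hQ.1
    have hQpos := T.measureReal_pos hQ.1
    rw [hsetint Q hQ.1 g x hx (fun y hy => by rw [hgQ Q hQ y hy, hgQ Q hQ x hx]), hgQ Q hQ x hx,
      mul_div_cancel₀ _ hQpos.ne']
  have hglint : ∫⁻ x, ‖g x‖ₑ ∂μ ≤ ∫⁻ x, ‖f x‖ₑ ∂μ := by
    refine lintegral_le_of_pieces hcount hmeas hdisj (fun Q hQ => ?_) fun x hx => by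
      rw [hgoff x hx]
    obtain ⟨x, hx⟩ := T.dyadic.nonempty hQ.1
    have hQpos := T.measureReal_pos hQ.1
    rw [setLIntegral_congr_fun (g := fun _ => ‖g x‖ₑ) (hmeas Q hQ)
      (fun y hy => by simp only [hgQ Q hQ y hy, hgQ Q hQ x hx]), setLIntegral_const]
    have hμ : μ Q = ‖μ.real Q‖ₑ := by
      rw [Real.enorm_of_nonneg hQpos.le, ofReal_measureReal (T.measure_ne_top hQ.1)]
    rw [hμ, ← enorm_mul, hgQ Q hQ x hx, div_mul_cancel₀ _ hQpos.ne']
    exact enorm_integral_le_lintegral_enorm _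
  have hgi : Integrable g μ := ⟨hgm.aestronglyMeasurable, hglint.trans_lt hf.2⟩
  refine ⟨C, g, hcount, hcube, hdisj, fun Q hQ => hQ.2.1.le, hgm, hgi, hgbound, ?_, hgoff,
    fun Q hQ => ?_⟩
  · simp_rw [← Real.norm_eq_abs]
    rw [integral_norm_eq_lintegral_enorm hgi.1, integral_norm_eq_lintegral_enorm hf.1]
    exact ENNReal.toReal_mono hf.2.ne hglint
  · simp_rw [Pi.sub_apply]
    rw [integral_sub hf.integrableOn hgi.integrableOn, hgint Q hQ, sub_self]

/-- The exceptional set `E` is the union of the parents of the stopping cubes, of measure at most `A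
‖f‖₁ / t`. The image of the bad part vanishes off `E`, so there only `P g` counts, without halving
`t`; Chebyshev and `‖g‖₂² ≤ A t ‖f‖₁` finish. -/
theorem measure_lt_abs_le_of_levelConst (T : IsRegularTree d μ lam D A)
    (hu : IsAtomFamily μ D a u) (hv : IsAtomFamily μ D b v) {P : Lp ℝ 2 μ →L[ℝ] Lp ℝ 2 μ}
    (hP : ∀ f, HasSum (fun Q : splitCubes D => inner ℝ f (toL2 μ (u Q)) • toL2 μ (v Q)) (P f))
    {J : ℤ} {f : X → ℝ} (hfJ : IsLevelConst D J f) (hf1 : Integrable f μ) (hf2 : MemLp f 2 μ)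
    {t : ℝ} (ht : 0 < t) :
    μ {x | t < |P (toL2 μ f) x|} ≤
      ENNReal.ofReal (A * (1 + ‖P‖ ^ 2) * (∫ x, |f x| ∂μ) / t) := by
  have hA : 0 < A := by linarith [T.two_le]
  obtain ⟨C, g, hcount, hcube, hdisj, hbad, hgm, hg1, hgle, hgint, hgoff, hmean⟩ :=
    exists_calderonZygmund_decomposition T hfJ hf1 ht
  have hmeas : ∀ Q ∈ C, MeasurableSet Q := fun Q hQ => T.dyadic.measurableSet_cube (hcube Q hQ)
  have hI : 0 ≤ ∫ x, |f x| ∂μ := integral_nonneg fun x => abs_nonneg _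
  have hgsq : ∀ x, g x ^ 2 ≤ A * t * |g x| := fun x => by
    rw [← sq_abs, sq]
    exact mul_le_mul_of_nonneg_right (hgle x) (abs_nonneg _)
  have hgsqi : Integrable (fun x => g x ^ 2) μ :=
    (hg1.abs.const_mul (A * t)).mono' (hgm.pow_const 2).aestronglyMeasurable
      (Filter.Eventually.of_forall fun x => by
        rw [Real.norm_of_nonneg (sq_nonneg _)]; exact hgsq x)
  have hg2 : MemLp g 2 μ := (memLp_two_iff_integrable_sq hgm.aestronglyMeasurable).2 hgsqi
  have hgnorm : ‖toL2 μ g‖ ^ 2 ≤ A * t * ∫ x, |f x| ∂μ := by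
    rw [← real_inner_self_eq_norm_sq, inner_toL2_toL2 hg2 hg2]
    calc ∫ x, g x * g x ∂μ = ∫ x, g x ^ 2 ∂μ := by simp_rw [sq]
      _ ≤ ∫ x, A * t * |g x| ∂μ := integral_mono hgsqi (hg1.abs.const_mul _) hgsq
      _ = A * t * ∫ x, |g x| ∂μ := integral_const_mul _ _
      _ ≤ _ := by gcongr
  choose! par hpar using fun (Q : Set X) (hQ : Q ∈ C) => T.exists_parent (hcube Q hQ)
  have hparc : ∀ Q ∈ C, IsCube D (par Q) := fun Q hQ =>
    isCube_of_mem_splitCubes (mem_splitCubes_of_mem_children (hpar Q hQ))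
  set E : Set X := ⋃ Q ∈ C, par Q with hE
  have hEm : MeasurableSet E :=
    MeasurableSet.biUnion hcount fun Q hQ => T.dyadic.measurableSet_cube (hparc Q hQ)
  have hμE : μ E ≤ ENNReal.ofReal (A * (∫ x, |f x| ∂μ) / t) := by
    have hpiece : ∀ Q ∈ C, μ (par Q) ≤ ENNReal.ofReal (A / t) * ∫⁻ x in Q, ‖f x‖ₑ ∂μ := by
      intro Q hQ
      rw [← ofReal_measureReal (T.measure_ne_top (hparc Q hQ)),
        ← ofReal_integral_norm_eq_lintegral_enorm hf1.integrableOn,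
        ← ENNReal.ofReal_mul (by positivity)]
      refine ENNReal.ofReal_le_ofReal ((T.measure_le_child _ _ (hpar Q hQ)).trans ?_)
      rw [div_mul_eq_mul_div, le_div_iff₀ ht, mul_assoc, mul_comm _ t]
      exact mul_le_mul_of_nonneg_left (hbad Q hQ) hA.le
    calc μ E ≤ ∑' Q : C, μ (par Q) := measure_biUnion_le μ hcount _
      _ ≤ ∑' Q : C, ENNReal.ofReal (A / t) * ∫⁻ x in (Q : Set X), ‖f x‖ₑ ∂μ :=
          ENNReal.tsum_le_tsum fun Q => hpiece Q Q.2
      _ = ENNReal.ofReal (A / t) * ∫⁻ x in ⋃ Q ∈ C, Q, ‖f x‖ₑ ∂μ := by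
          rw [ENNReal.tsum_mul_left, lintegral_biUnion hcount hmeas hdisj]
      _ ≤ ENNReal.ofReal (A / t) * ∫⁻ x, ‖f x‖ₑ ∂μ := by
          exact mul_le_mul' le_rfl (setLIntegral_le_lintegral _ _)
      _ = _ := by
          rw [← ofReal_integral_norm_eq_lintegral_enorm hf1, ← ENNReal.ofReal_mul (by positivity)]
          simp_rw [Real.norm_eq_abs]
          congr 1
          ring
  have hb2 : MemLp (f - g) 2 μ := hf2.sub hg2
  have hboff : ∀ x ∉ ⋃₀ C, (f - g) x = 0 := fun x hx => by simp [hgoff x hx]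
  have hvanish : ∀ᵐ x ∂μ, x ∉ E → P (toL2 μ (f - g)) x = 0 := by
    refine ae_eq_zero_of_hasSum T hv hP hEm fun Q hQ hne => ?_
    by_contra hnot
    refine hne ?_
    rw [inner_toL2_toL2 hb2 (hu.memLp T hQ 2)]
    refine integral_eq_zero_of_pieces hcount hmeas hdisj
      (hb2.integrable_mul (hu.memLp T hQ 2)) (fun S hS => ?_) fun x hx => by
        rw [hboff x hx, zero_mul]
    obtain ⟨z, hz⟩ := T.dyadic.nonempty (hcube S hS)
    -- As `Q` is not inside `E`, it is not inside the parent of `S`; so `u Q` is constant on `S`,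
    -- where the bad part has mean zero.
    have hconst := hu.const Q hQ S (par S) (hpar S hS)
      fun h => hnot (h.trans (Set.subset_biUnion_of_mem hS))
    rw [setIntegral_congr_fun (g := fun x => (f - g) x * u Q z) (hmeas S hS)
      (fun x hx => by simp only [hconst x hx z hz]), integral_mul_const, hmean S hS, zero_mul]
  have hsub : μ {x | t < |P (toL2 μ f) x|} ≤ μ (E ∪ {x | t < |P (toL2 μ g) x|}) := by
    refine measure_mono_ae ?_
    have hadd : P (toL2 μ f) = P (toL2 μ (f - g)) + P (toL2 μ g) := by
      rw [toL2_sub hf2 hg2, map_sub, sub_add_cancel]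
    filter_upwards [hvanish, Lp.coeFn_add (P (toL2 μ (f - g))) (P (toL2 μ g))] with x hx hx' hlt
    by_cases hxE : x ∈ E
    · exact Or.inl hxE
    · refine Or.inr ?_
      have hlt' : t < |P (toL2 μ f) x| := hlt
      rw [hadd, hx', Pi.add_apply, hx hxE, zero_add] at hlt'
      exact hlt'
  calc μ {x | t < |P (toL2 μ f) x|} ≤ μ E + μ {x | t < |P (toL2 μ g) x|} :=
        hsub.trans (measure_union_le _ _)
    _ ≤ ENNReal.ofReal (A * (∫ x, |f x| ∂μ) / t) +
          ENNReal.ofReal (A * ‖P‖ ^ 2 * (∫ x, |f x| ∂μ) / t) := by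
        refine add_le_add hμE ((measure_lt_abs_le_ofReal _ ht).trans
          (ENNReal.ofReal_le_ofReal ?_))
        have h1 : ‖P (toL2 μ g)‖ ^ 2 ≤ ‖P‖ ^ 2 * (A * t * ∫ x, |f x| ∂μ) := by
          calc ‖P (toL2 μ g)‖ ^ 2 ≤ (‖P‖ * ‖toL2 μ g‖) ^ 2 := by
                gcongr
                exact P.le_opNorm _
            _ ≤ _ := by
                rw [mul_pow]
                gcongr
        rw [div_le_div_iff₀ (by positivity) ht]
        calc ‖P (toL2 μ g)‖ ^ 2 * t ≤ ‖P‖ ^ 2 * (A * t * ∫ x, |f x| ∂μ) * t := by gcongr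
          _ = _ := by ring
    _ = _ := by
        rw [← ENNReal.ofReal_add (by positivity) (by positivity)]
        congr 1
        ring

/-! ### Density of the functions that are constant on the cubes of some level -/

theorem IsLevelConst.mono (T : IsRegularTree d μ lam D A) {i j : ℤ} (hij : i ≤ j) {f : X → ℝ}
    (hf : IsLevelConst D i f) : IsLevelConst D j f := by
  intro Q hQ x hx y hy
  obtain ⟨R, hR, hxR⟩ := T.dyadic.exists_mem i x
  exact hf R hR x hxR y (T.dyadic.subset_of_le hij hQ hR hx hxR hy)

theorem IsRegularTree.exists_cube_superset (T : IsRegularTree d μ lam D A) {Q Q' : Set X}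
    (hQ : IsCube D Q) (hQ' : IsCube D Q') : ∃ R, IsCube D R ∧ Q ⊆ R ∧ Q' ⊆ R := by
  obtain ⟨x, hx⟩ := T.dyadic.nonempty hQ
  obtain ⟨y, hy⟩ := T.dyadic.nonempty hQ'
  obtain ⟨S, hS, hxS, hyS⟩ := T.dyadic.exists_common_cube T.quadrant x y
  rcases T.dyadic.subset_or_subset hQ hS hx hxS with h | h
  · rcases T.dyadic.subset_or_subset hQ' hS hy hyS with h' | h'
    · exact ⟨S, hS, h, h'⟩
    · exact ⟨Q', hQ', h.trans h', subset_rfl⟩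
  · rcases T.dyadic.subset_or_subset hQ hQ' (h hyS) hy with h' | h'
    · exact ⟨Q', hQ', h', subset_rfl⟩
    · exact ⟨Q, hQ, subset_rfl, h'⟩

variable {H : Set (X → ℝ)}

namespace IsHaarSystem

theorem exists_levelConst_of_mem_haarAt (hH : IsHaarSystem μ D H)
    (T : IsRegularTree d μ lam D A) {Q : Set X} {h : X → ℝ} (hh : h ∈ haarAt D H Q) :
    ∃ J, IsLevelConst D J h := by
  obtain ⟨-, j, hj, -⟩ := id hh
  refine ⟨j + 1, fun S hS x hx y hy => ?_⟩
  by_cases hxQ : x ∈ Q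
  · have hSQ := T.dyadic.subset_of_le (by omega) hS hj.1 hx hxQ
    exact (hH.mem_childConst (mem_splitCubes_of_mem_haarAt hh) hh).2 S ⟨j, hj, hS, hSQ⟩ x hx y hy
  · have hyQ : y ∉ Q := fun hyQ => hxQ (T.dyadic.subset_of_le (by omega) hS hj.1 hy hyQ hx)
    rw [hH.eq_zero_of_notMem hh hxQ, hH.eq_zero_of_notMem hh hyQ]

/-- Functions in `L²` are approximated by functions that live on a cube and are constant on the
cubes of some level. -/
theorem exists_levelConst_approx (hH : IsHaarSystem μ D H) (T : IsRegularTree d μ lam D A)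
    (F : Lp ℝ 2 μ) {ε : ℝ} (hε : 0 < ε) :
    ∃ (J : ℤ) (φ : X → ℝ) (Q : Set X), IsCube D Q ∧ IsLevelConst D J φ ∧ MemLp φ 2 μ ∧
      (∀ x ∉ Q, φ x = 0) ∧ ‖F - toL2 μ φ‖ < ε := by
  obtain ⟨B, hB⟩ := hH.hilbertBasis
  have hmem : F ∈ (Submodule.span ℝ (Set.range B)).topologicalClosure := by
    rw [B.dense_span]; trivial
  obtain ⟨s, hs, hFs⟩ := Metric.mem_closure_iff.1 hmem ε hε
  rw [dist_eq_norm] at hFs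
  obtain ⟨J, φ, Q, hQ, hφ, hzero, hsφ⟩ : ∃ (J : ℤ) (φ : X → ℝ) (Q : Set X), IsCube D Q ∧
      IsLevelConst D J φ ∧ (∀ x ∉ Q, φ x = 0) ∧ s =ᵐ[μ] φ := by
    clear hFs
    induction hs using Submodule.span_induction with
    | mem f hf =>
      obtain ⟨h, rfl⟩ := hf
      obtain ⟨Q, hQ⟩ := hH.exists_mem_haarAt h.2
      obtain ⟨J, hJ⟩ := hH.exists_levelConst_of_mem_haarAt T hQ
      exact ⟨J, h, Q, isCube_of_mem_splitCubes (mem_splitCubes_of_mem_haarAt hQ), hJ,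
        fun x hx => hH.eq_zero_of_notMem hQ hx, hB h⟩
    | zero =>
      obtain ⟨j, Q, hQ, -⟩ := T.quadrant
      exact ⟨0, 0, Q, ⟨j, hQ⟩, fun _ _ _ _ _ _ => rfl, fun _ _ => rfl, Lp.coeFn_zero _ _ _⟩
    | add f g _ _ hf hg =>
      obtain ⟨J, φ, Q, hQ, hφ, hz, he⟩ := hf
      obtain ⟨J', φ', Q', hQ', hφ', hz', he'⟩ := hg
      obtain ⟨R, hR, hQR, hQR'⟩ := T.exists_cube_superset hQ hQ'
      refine ⟨max J J', φ + φ', R, hR, fun S hS x hx y hy => ?_, fun x hx => ?_,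
        (Lp.coeFn_add _ _).trans (he.add he')⟩
      · rw [Pi.add_apply, Pi.add_apply, hφ.mono T (le_max_left J J') S hS x hx y hy,
          hφ'.mono T (le_max_right J J') S hS x hx y hy]
      · rw [Pi.add_apply, hz x fun h => hx (hQR h), hz' x fun h => hx (hQR' h), add_zero]
    | smul c f _ hf =>
      obtain ⟨J, φ, Q, hQ, hφ, hz, he⟩ := hf
      refine ⟨J, c • φ, Q, hQ, fun S hS x hx y hy => ?_, fun x hx => ?_,
        (Lp.coeFn_smul _ _).trans (he.const_smul c)⟩
      · rw [Pi.smul_apply, Pi.smul_apply, hφ S hS x hx y hy]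
      · rw [Pi.smul_apply, hz x hx, smul_zero]
  have hφ2 : MemLp φ 2 μ := (memLp_congr_ae hsφ).1 (Lp.memLp s)
  refine ⟨J, φ, Q, hQ, hφ, hφ2, hzero, ?_⟩
  have : toL2 μ φ = s := Lp.ext ((coe_toL2 hφ2).trans hsφ.symm)
  rwa [this]

/-- Functions in `L¹ ∩ L²` are approximated by functions that are constant on the cubes of some
level, without increasing the norm in `L¹` by much. -/
theorem exists_levelConst_approx_of_integrable (hH : IsHaarSystem μ D H)
    (T : IsRegularTree d μ lam D A) (F : Lp ℝ 2 μ) (hF : Integrable F μ) {ε : ℝ} (hε : 0 < ε) :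
    ∃ (J : ℤ) (φ : X → ℝ), IsLevelConst D J φ ∧ Integrable φ μ ∧ MemLp φ 2 μ ∧
      ‖F - toL2 μ φ‖ ≤ ε ∧ ∫ x, |φ x| ∂μ ≤ ∫ x, |F x| ∂μ + ε := by
  -- The first approximation serves to find a cube `Q` outside which `F` is small in `L²`. The
  -- second, accurate relative to `μ(Q)`, is then cut off to `Q`.
  obtain ⟨J₀, φ₀, Q, hQ, -, hφ₀, hzero, h₀⟩ := hH.exists_levelConst_approx T F (half_pos hε)
  have hQm := T.dyadic.measurableSet_cube hQ
  have hQpos := T.measureReal_pos hQ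
  set η : ℝ := min (ε / 2) (ε / √(μ.real Q)) with hη
  obtain ⟨J₁, φ₁, -, -, hφ₁, hφ₁2, -, h₁⟩ :=
    hH.exists_levelConst_approx T F (ε := η) (lt_min (half_pos hε) (by positivity))
  obtain ⟨k, hk⟩ := id hQ
  have hφ2 : MemLp (Q.indicator φ₁) 2 μ := hφ₁2.indicator hQm
  have hfinQ : IsFiniteMeasure (μ.restrict Q) :=
    ⟨by simpa using (T.measure_ne_top hQ).lt_top⟩
  have hφ1 : Integrable (Q.indicator φ₁) μ := by
    rw [integrable_indicator_iff hQm]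
    exact (hφ₁2.restrict Q).integrable one_le_two
  refine ⟨max J₁ k, Q.indicator φ₁, fun S hS x hx y hy => ?_, hφ1, hφ2, ?_, ?_⟩
  · by_cases hxQ : x ∈ Q
    · have hyQ := T.dyadic.subset_of_le (le_max_right J₁ k) hS hk hx hxQ hy
      rw [Set.indicator_of_mem hxQ, Set.indicator_of_mem hyQ,
        hφ₁.mono T (le_max_left J₁ k) S hS x hx y hy]
    · have hyQ : y ∉ Q := fun hyQ =>
        hxQ (T.dyadic.subset_of_le (le_max_right J₁ k) hS hk hy hyQ hx)
      rw [Set.indicator_of_notMem hxQ, Set.indicator_of_notMem hyQ]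
  -- On `Q` the error is that of `φ₁`; off `Q` both the cut-off and `φ₀` vanish, and the error is
  -- that of `φ₀`.
  · have hle : ‖F - toL2 μ (Q.indicator φ₁)‖ ≤ ‖|F - toL2 μ φ₁| + |F - toL2 μ φ₀|‖ := by
      refine Lp.norm_le_norm_of_ae_le ?_
      filter_upwards [Lp.coeFn_sub F (toL2 μ (Q.indicator φ₁)), Lp.coeFn_sub F (toL2 μ φ₁),
        Lp.coeFn_sub F (toL2 μ φ₀), coe_toL2 hφ2, coe_toL2 hφ₁2, coe_toL2 hφ₀,
        Lp.coeFn_add |F - toL2 μ φ₁| |F - toL2 μ φ₀|, Lp.coeFn_abs (F - toL2 μ φ₁),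
        Lp.coeFn_abs (F - toL2 μ φ₀)] with x e1 e2 e3 e4 e5 e6 e7 e8 e9
      rw [e1, e7, Pi.add_apply, e8, e9, e2, e3, Pi.sub_apply, Pi.sub_apply, Pi.sub_apply, e4, e5,
        e6, Real.norm_eq_abs, Real.norm_of_nonneg (by positivity)]
      by_cases hx : x ∈ Q
      · rw [Set.indicator_of_mem hx]
        exact le_add_of_nonneg_right (abs_nonneg _)
      · rw [Set.indicator_of_notMem hx, hzero x hx]
        exact le_add_of_nonneg_left (abs_nonneg _)
    refine hle.trans ((norm_add_le _ _).trans ?_)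
    rw [norm_abs_eq_norm, norm_abs_eq_norm]
    have := min_le_left (ε / 2) (ε / √(μ.real Q))
    linarith
  · have hone : MemLp (Q.indicator fun _ => (1 : ℝ)) 2 μ :=
      memLp_indicator_const 2 hQm 1 (Or.inr (T.measure_ne_top hQ))
    have hnorm1 : ‖toL2 μ (Q.indicator fun _ => (1 : ℝ))‖ = √(μ.real Q) := by
      rw [eq_comm, Real.sqrt_eq_iff_mul_self_eq hQpos.le (norm_nonneg _), ← sq,
        ← real_inner_self_eq_norm_sq, inner_toL2_toL2 hone hone]
      have : (fun x => Q.indicator (fun _ => (1 : ℝ)) x * Q.indicator (fun _ => (1 : ℝ)) x) =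
          Q.indicator fun _ => (1 : ℝ) := by
        funext x
        by_cases hx : x ∈ Q <;> simp [hx]
      rw [this, integral_indicator_const _ hQm]
      simp
    -- Cauchy–Schwarz on `Q`: the choice of `η ≤ ε / √μ(Q)` turns the `L²` error into an `L¹` error
    -- of at most `ε`.
    have hcs : ∫ x, |(F - toL2 μ φ₁)| x * Q.indicator (fun _ => (1 : ℝ)) x ∂μ ≤ ε := by
      rw [← inner_toL2 _ hone]
      refine (real_inner_le_norm _ _).trans ?_
      rw [norm_abs_eq_norm, hnorm1, ← le_div_iff₀ (by positivity)]
      exact h₁.le.trans (min_le_right _ _)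
    have hi : Integrable (fun x => |(F - toL2 μ φ₁)| x * Q.indicator (fun _ => (1 : ℝ)) x) μ :=
      (Lp.memLp _).integrable_mul hone
    calc ∫ x, |Q.indicator φ₁ x| ∂μ
        ≤ ∫ x, (|F x| + |(F - toL2 μ φ₁)| x * Q.indicator (fun _ => (1 : ℝ)) x) ∂μ := by
          refine integral_mono_ae hφ1.abs (hF.abs.add hi) ?_
          filter_upwards [Lp.coeFn_sub F (toL2 μ φ₁), coe_toL2 hφ₁2,
            Lp.coeFn_abs (F - toL2 μ φ₁)] with x e1 e2 e3
          simp only [e3, e1, Pi.sub_apply, e2]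
          by_cases hx : x ∈ Q
          · rw [Set.indicator_of_mem hx, Set.indicator_of_mem hx, mul_one]
            have := abs_sub_abs_le_abs_sub (φ₁ x) (F x)
            rw [abs_sub_comm] at this
            linarith
          · rw [Set.indicator_of_notMem hx, Set.indicator_of_notMem hx, mul_zero, abs_zero,
              add_zero]
            exact abs_nonneg _
      _ = ∫ x, |F x| ∂μ +
            ∫ x, |(F - toL2 μ φ₁)| x * Q.indicator (fun _ => (1 : ℝ)) x ∂μ :=
          integral_add hF.abs hi
      _ ≤ _ := by gcongr

theorem measure_lt_abs_le_of_integrable (hH : IsHaarSystem μ D H) (T : IsRegularTree d μ lam D A)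
    (hu : IsAtomFamily μ D a u) (hv : IsAtomFamily μ D b v) {P : Lp ℝ 2 μ →L[ℝ] Lp ℝ 2 μ}
    (hP : ∀ f, HasSum (fun Q : splitCubes D => inner ℝ f (toL2 μ (u Q)) • toL2 μ (v Q)) (P f))
    (F : Lp ℝ 2 μ) (hF : Integrable F μ) {t : ℝ} (ht : 0 < t) :
    μ {x | t < |P F x|} ≤
      ENNReal.ofReal (2 * (A * (1 + ‖P‖ ^ 2)) * (∫ x, |F x| ∂μ) / t) := by
  have hA : 0 < A := by linarith [T.two_le]
  have hI : 0 ≤ ∫ x, |F x| ∂μ := integral_nonneg fun x => abs_nonneg _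
  -- Half of the height `t` goes to the level-constant approximation, half to the `L²` error, whose
  -- Chebyshev bound disappears as `ε → 0`. This doubles the constant.
  set bound : ℝ → ℝ := fun ε => A * (1 + ‖P‖ ^ 2) * ((∫ x, |F x| ∂μ) + ε) / (t / 2) +
    (‖P‖ * ε) ^ 2 / (t / 2) ^ 2 with hbound
  have key : ∀ ε > 0, μ {x | t < |P F x|} ≤ ENNReal.ofReal (bound ε) := by
    intro ε hε
    obtain ⟨J, φ, hφ, hφ1, hφ2, hnorm, hint⟩ :=
      hH.exists_levelConst_approx_of_integrable T F hF hε
    have h1 := measure_lt_abs_le_of_levelConst T hu hv hP hφ hφ1 hφ2 (half_pos ht)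
    have h2 := measure_lt_abs_le_ofReal (P (F - toL2 μ φ)) (half_pos ht)
    have hadd : P F = P (toL2 μ φ) + P (F - toL2 μ φ) := by
      rw [map_sub, add_sub_cancel]
    have hsub : μ {x | t < |P F x|} ≤
        μ ({x | t / 2 < |P (toL2 μ φ) x|} ∪ {x | t / 2 < |P (F - toL2 μ φ) x|}) := by
      refine measure_mono_ae ?_
      filter_upwards [Lp.coeFn_add (P (toL2 μ φ)) (P (F - toL2 μ φ))] with x hx hlt
      have hlt' : t < |P F x| := hlt
      rw [hadd, hx, Pi.add_apply] at hlt'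
      by_contra hnot
      rcases not_or.1 hnot with ⟨h3, h4⟩
      have h3' : |P (toL2 μ φ) x| ≤ t / 2 := not_lt.1 h3
      have h4' : |P (F - toL2 μ φ) x| ≤ t / 2 := not_lt.1 h4
      have := abs_add_le (P (toL2 μ φ) x) (P (F - toL2 μ φ) x)
      linarith
    refine (hsub.trans (measure_union_le _ _)).trans ((add_le_add h1 h2).trans ?_)
    rw [← ENNReal.ofReal_add (by positivity) (by positivity)]
    refine ENNReal.ofReal_le_ofReal (add_le_add ?_ ?_)
    · gcongr
    · gcongr
      exact (P.le_opNorm _).trans (by gcongr)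
  have hlim : Filter.Tendsto (fun ε => ENNReal.ofReal (bound ε)) (nhdsWithin 0 (Set.Ioi 0))
      (nhds (ENNReal.ofReal (bound 0))) := by
    have hc : Continuous bound := by
      simp only [hbound]
      fun_prop
    exact ((ENNReal.continuous_ofReal.comp hc).tendsto 0).mono_left nhdsWithin_le_nhds
  have h0 : bound 0 = 2 * (A * (1 + ‖P‖ ^ 2)) * (∫ x, |F x| ∂μ) / t := by
    simp only [hbound]
    field_simp
    ring
  rw [← h0]
  exact ge_of_tendsto hlim (by filter_upwards [self_mem_nhdsWithin] with ε hε using key ε hε)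

end IsHaarSystem

end WeakType

/-! ### Extension of a weak type operator to $L^1$ -/

section Extension

variable {X : Type*} [MeasurableSpace X] {μ : Measure X}

/-- Functions in `Lᵖ` are approximated by functions in `L² ∩ Lᵖ`. -/
theorem exists_memLp_two_approx {p : ℝ≥0∞} (hp0 : p ≠ 0) (hp : p ≠ ⊤) {f : X → ℝ}
    (hf : MemLp f p μ) {ε : ℝ≥0∞} (hε : ε ≠ 0) :
    ∃ U : Lp ℝ 2 μ, MemLp U p μ ∧ eLpNorm (f - ⇑U) p μ < ε := by
  obtain ⟨g, hg, hgp⟩ := hf.exists_simpleFunc_eLpNorm_sub_lt hp hε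
  have hg2 : MemLp g 2 μ := (SimpleFunc.memLp_iff two_ne_zero ENNReal.ofNat_ne_top).2
    ((SimpleFunc.memLp_iff hp0 hp).1 hgp)
  have hae : toL2 μ g =ᵐ[μ] g := coe_toL2 hg2
  refine ⟨toL2 μ g, (memLp_congr_ae hae).2 hgp, ?_⟩
  rwa [eLpNorm_congr_ae ((Filter.EventuallyEq.refl _ f).sub hae)]

theorem exists_integrable_approx (f : Lp ℝ 1 μ) {ε : ℝ} (hε : 0 < ε) :
    ∃ U : Lp ℝ 2 μ, Integrable U μ ∧ ∫ x, |f x - U x| ∂μ ≤ ε := by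
  obtain ⟨U, hU, hlt⟩ := exists_memLp_two_approx one_ne_zero ENNReal.one_ne_top (Lp.memLp f)
    (ε := ENNReal.ofReal ε) (by simpa using hε)
  refine ⟨U, memLp_one_iff_integrable.1 hU, ?_⟩
  have hi : Integrable (⇑f - ⇑U) μ := memLp_one_iff_integrable.1 ((Lp.memLp f).sub hU)
  have h1 : ∫ x, |f x - U x| ∂μ = (eLpNorm (⇑f - ⇑U) 1 μ).toReal := by
    rw [eLpNorm_one_eq_lintegral_enorm, ← integral_norm_eq_lintegral_enorm hi.1]
    rfl
  rw [h1]
  exact ENNReal.toReal_le_of_le_ofReal hε.le hlt.le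

theorem measure_le_of_forall_ofReal {s : Set X} {g : ℝ → ℝ} (hg : Continuous g)
    (h : ∀ ε > 0, μ s ≤ ENNReal.ofReal (g ε)) : μ s ≤ ENNReal.ofReal (g 0) := by
  have hlim : Filter.Tendsto (fun ε => ENNReal.ofReal (g ε)) (nhdsWithin 0 (Set.Ioi 0))
      (nhds (ENNReal.ofReal (g 0))) :=
    ((ENNReal.continuous_ofReal.comp hg).tendsto 0).mono_left nhdsWithin_le_nhds
  exact ge_of_tendsto hlim (by filter_upwards [self_mem_nhdsWithin] with ε hε using h ε hε)

theorem measure_lt_abs_add_le (F G : X → ℝ) (s t : ℝ) :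
    μ {x | s + t < |F x + G x|} ≤ μ {x | s < |F x|} + μ {x | t < |G x|} := by
  refine (measure_mono fun x hx => ?_).trans (measure_union_le _ _)
  have hx' : s + t < |F x + G x| := hx
  by_contra hnot
  have h1 : |F x| ≤ s := not_lt.1 fun h => hnot (Or.inl h)
  have h2 : |G x| ≤ t := not_lt.1 fun h => hnot (Or.inr h)
  have := abs_add_le (F x) (G x)
  linarith

variable {T : Lp ℝ 2 μ →L[ℝ] Lp ℝ 2 μ} {C : ℝ}

theorem weak_bound_sub
    (h : ∀ F : Lp ℝ 2 μ, Integrable F μ → ∀ t : ℝ, 0 < t →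
      μ {x | t < |T F x|} ≤ ENNReal.ofReal (C * (∫ x, |F x| ∂μ) / t))
    {U V : Lp ℝ 2 μ} (hU : Integrable U μ) (hV : Integrable V μ) {t : ℝ} (ht : 0 < t) :
    μ {x | t < |T U x - T V x|} ≤ ENNReal.ofReal (C * (∫ x, |U x - V x| ∂μ) / t) := by
  have hsub := Lp.coeFn_sub U V
  have h1 := h (U - V) ((integrable_congr hsub).2 (hU.sub hV)) t ht
  have h2 : ∫ x, |(U - V : Lp ℝ 2 μ) x| ∂μ = ∫ x, |U x - V x| ∂μ := by
    refine integral_congr_ae ?_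
    filter_upwards [hsub] with x hx
    rw [hx, Pi.sub_apply]
  rw [h2] at h1
  refine le_trans (le_of_eq (measure_congr ?_)) h1
  rw [map_sub]
  filter_upwards [Lp.coeFn_sub (T U) (T V)] with x hx
  change (t < _) = (t < _)
  rw [hx, Pi.sub_apply]

/-- An operator of weak type on `L¹ ∩ L²` has a limit value at every function in `L¹`. -/
theorem exists_weak_limit (hC : 0 ≤ C)
    (h : ∀ F : Lp ℝ 2 μ, Integrable F μ → ∀ t : ℝ, 0 < t →
      μ {x | t < |T F x|} ≤ ENNReal.ofReal (C * (∫ x, |F x| ∂μ) / t)) (f : Lp ℝ 1 μ) :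
    ∃ F : X →ₘ[μ] ℝ, ∀ V : Lp ℝ 2 μ, Integrable V μ → ∀ t : ℝ, 0 < t →
      μ {x | t < |F x - T V x|} ≤ ENNReal.ofReal (C * (∫ x, |f x - V x| ∂μ) / t) := by
  have hf : Integrable f μ := memLp_one_iff_integrable.1 (Lp.memLp f)
  -- The rate `4⁻ⁿ` beats the height `2⁻ⁿ`: the sets where consecutive images differ by more than
  -- `2⁻ⁿ` have measures at most `2 C 2⁻ⁿ`, and Borel–Cantelli gives convergence almost everywhere.
  choose U hU hfU using fun n : ℕ =>
    exists_integrable_approx f (ε := (1 / 4 : ℝ) ^ n) (by positivity)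
  have hUU : ∀ n, ∫ x, |U (n + 1) x - U n x| ∂μ ≤ 2 * (1 / 4 : ℝ) ^ n := by
    intro n
    calc ∫ x, |U (n + 1) x - U n x| ∂μ
        ≤ ∫ x, (|f x - U (n + 1) x| + |f x - U n x|) ∂μ := by
          refine integral_mono ((hU _).sub (hU _)).abs
            ((hf.sub (hU _)).abs.add (hf.sub (hU _)).abs) fun x => ?_
          calc |U (n + 1) x - U n x| = |(f x - U n x) - (f x - U (n + 1) x)| := by ring_nf
            _ ≤ |f x - U n x| + |f x - U (n + 1) x| := abs_sub _ _
            _ = _ := add_comm _ _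
      _ = ∫ x, |f x - U (n + 1) x| ∂μ + ∫ x, |f x - U n x| ∂μ :=
          integral_add (hf.sub (hU _)).abs (hf.sub (hU _)).abs
      _ ≤ (1 / 4 : ℝ) ^ (n + 1) + (1 / 4 : ℝ) ^ n := add_le_add (hfU _) (hfU _)
      _ ≤ 2 * (1 / 4 : ℝ) ^ n := by
          rw [pow_succ]
          have : (0 : ℝ) < (1 / 4) ^ n := by positivity
          linarith
  have hmeas : ∀ n, μ {x | (1 / 2 : ℝ) ^ n < |T (U (n + 1)) x - T (U n) x|} ≤
      ENNReal.ofReal (2 * C * (1 / 2 : ℝ) ^ n) := by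
    intro n
    refine (weak_bound_sub h (hU _) (hU _) (by positivity)).trans (ENNReal.ofReal_le_ofReal ?_)
    rw [div_le_iff₀ (by positivity)]
    calc C * ∫ x, |U (n + 1) x - U n x| ∂μ ≤ C * (2 * (1 / 4 : ℝ) ^ n) := by
          gcongr
          exact hUU n
      _ = 2 * C * (1 / 2 : ℝ) ^ n * (1 / 2 : ℝ) ^ n := by
          rw [mul_assoc, ← mul_pow]
          norm_num
          ring
  have hsum : ∑' n, μ {x | (1 / 2 : ℝ) ^ n < |T (U (n + 1)) x - T (U n) x|} ≠ ⊤ := by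
    refine ne_top_of_le_ne_top ?_ (ENNReal.tsum_le_tsum hmeas)
    rw [← ENNReal.ofReal_tsum_of_nonneg (fun n => by positivity)
      (summable_geometric_two.mul_left _)]
    exact ENNReal.ofReal_ne_top
  have hlim : ∀ᵐ x ∂μ, ∃ l, Filter.Tendsto (fun n => T (U n) x) Filter.atTop (nhds l) := by
    filter_upwards [ae_eventually_notMem hsum] with x hx
    refine cauchySeq_tendsto_of_complete (cauchySeq_of_summable_dist ?_)
    refine Summable.of_norm_bounded_eventually_nat summable_geometric_two ?_
    filter_upwards [hx] with n hn
    rw [Real.norm_of_nonneg dist_nonneg, dist_comm, Real.dist_eq]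
    exact not_lt.1 hn
  obtain ⟨F, hF, hFlim⟩ := exists_stronglyMeasurable_limit_of_tendsto_ae
    (fun n => Lp.aestronglyMeasurable (T (U n))) hlim
  obtain ⟨F', hF'⟩ : ∃ F' : X →ₘ[μ] ℝ, F' =ᵐ[μ] F :=
    ⟨AEEqFun.mk F hF.aestronglyMeasurable, AEEqFun.coeFn_mk _ _⟩
  refine ⟨F', fun V hV t ht => ?_⟩
  -- The set in question lies, up to null sets, in the increasing union of the `S N`, and each `S N`
  -- is bounded by the weak estimate for `U n - V` with `n → ∞`.
  set S : ℕ → Set X := fun N => {x | ∀ n, N ≤ n → t < |T (U n) x - T V x|} with hS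
  have hmono : Monotone S := fun N M hNM x hx n hn => hx n (hNM.trans hn)
  have hsub : μ {x | t < |F' x - T V x|} ≤ μ (⋃ N, S N) := by
    refine measure_mono_ae ?_
    filter_upwards [hFlim, hF'] with x hx hx' hlt
    have hlt' : t < |F' x - T V x| := hlt
    rw [hx'] at hlt'
    obtain ⟨N, hN⟩ := Filter.eventually_atTop.1
      (((hx.sub_const (T V x)).abs).eventually (lt_mem_nhds hlt'))
    exact Set.mem_iUnion.2 ⟨N, hN⟩
  refine hsub.trans ?_
  rw [hmono.measure_iUnion]
  refine iSup_le fun N => ?_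
  have hb : Filter.Tendsto
      (fun n : ℕ => ENNReal.ofReal (C * (∫ x, |f x - V x| ∂μ + (1 / 4 : ℝ) ^ n) / t)) Filter.atTop
      (nhds (ENNReal.ofReal (C * (∫ x, |f x - V x| ∂μ + 0) / t))) := by
    refine (ENNReal.continuous_ofReal.tendsto _).comp ?_
    exact ((tendsto_const_nhds.add (tendsto_pow_atTop_nhds_zero_of_lt_one (by norm_num)
      (by norm_num))).const_mul C).div_const t
  rw [add_zero] at hb
  refine ge_of_tendsto hb (Filter.eventually_atTop.2 ⟨N, fun n hn => ?_⟩)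
  calc μ (S N) ≤ μ {x | t < |T (U n) x - T V x|} := measure_mono fun x hx => hx n hn
    _ ≤ ENNReal.ofReal (C * (∫ x, |U n x - V x| ∂μ) / t) := weak_bound_sub h (hU n) hV ht
    _ ≤ _ := by
        refine ENNReal.ofReal_le_ofReal ?_
        gcongr
        calc ∫ x, |U n x - V x| ∂μ ≤ ∫ x, (|f x - V x| + |f x - U n x|) ∂μ := by
              refine integral_mono ((hU _).sub hV).abs
                ((hf.sub hV).abs.add (hf.sub (hU _)).abs) fun x => ?_
              calc |U n x - V x| = |(f x - V x) - (f x - U n x)| := by ring_nf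
                _ ≤ _ := abs_sub _ _
          _ = ∫ x, |f x - V x| ∂μ + ∫ x, |f x - U n x| ∂μ :=
              integral_add (hf.sub hV).abs (hf.sub (hU _)).abs
          _ ≤ _ := add_le_add le_rfl (hfU n)

theorem ae_eq_zero_of_measure_lt_abs {F : X → ℝ} (h : ∀ t : ℝ, 0 < t → μ {x | t < |F x|} = 0) :
    F =ᵐ[μ] 0 := by
  have : ∀ᵐ x ∂μ, ∀ n : ℕ, |F x| ≤ 1 / (n + 1 : ℝ) := by
    rw [ae_all_iff]
    intro n
    have := h (1 / (n + 1 : ℝ)) (by positivity)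
    rw [ae_iff]
    simpa using this
  filter_upwards [this] with x hx
  have h0 : |F x| ≤ 0 := ge_of_tendsto' tendsto_one_div_add_atTop_nhds_zero_nat hx
  simpa using h0

/-- The estimate of `exists_weak_limit` against every `V` determines the limit almost everywhere, so
linearity follows by approximating both sides. Taking `V = f` shows that the operator is extended;
taking `V = 0` gives the weak type bound. -/
theorem isWeakTypeOneOne_of_bound (hC : 0 ≤ C)
    (h : ∀ F : Lp ℝ 2 μ, Integrable F μ → ∀ t : ℝ, 0 < t →
      μ {x | t < |T F x|} ≤ ENNReal.ofReal (C * (∫ x, |F x| ∂μ) / t)) :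
    IsWeakTypeOneOne T := by
  choose T₁ hT₁ using exists_weak_limit hC h
  have hint : ∀ f : Lp ℝ 1 μ, Integrable f μ := fun f => memLp_one_iff_integrable.1 (Lp.memLp f)
  have hadd : ∀ f g, T₁ (f + g) = T₁ f + T₁ g := by
    intro f g
    refine AEEqFun.ext ?_
    have hzero : (fun x => T₁ (f + g) x - (T₁ f x + T₁ g x)) =ᵐ[μ] 0 := by
      refine ae_eq_zero_of_measure_lt_abs fun t ht => ?_
      refine le_antisymm ?_ zero_le
      have := measure_le_of_forall_ofReal (μ := μ)
        (s := {x | t < |T₁ (f + g) x - (T₁ f x + T₁ g x)|})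
        (g := fun ε => C * (2 * ε) / (t / 2) + C * ε / (t / 4) + C * ε / (t / 4)) (by fun_prop)
        fun ε hε => ?_
      · simpa using this
      obtain ⟨U, hU, hfU⟩ := exists_integrable_approx f hε
      obtain ⟨V, hV, hgV⟩ := exists_integrable_approx g hε
      have hUV : Integrable (U + V : Lp ℝ 2 μ) μ :=
        (integrable_congr (Lp.coeFn_add U V)).2 (hU.add hV)
      have e1 : ∫ x, |(f + g : Lp ℝ 1 μ) x - (U + V : Lp ℝ 2 μ) x| ∂μ ≤ 2 * ε := by
        calc ∫ x, |(f + g : Lp ℝ 1 μ) x - (U + V : Lp ℝ 2 μ) x| ∂μ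
            ≤ ∫ x, (|f x - U x| + |g x - V x|) ∂μ := by
              refine integral_mono_ae ((hint _).sub hUV).abs
                (((hint f).sub hU).abs.add ((hint g).sub hV).abs) ?_
              filter_upwards [Lp.coeFn_add f g, Lp.coeFn_add U V] with x hx hx'
              simp only [hx, hx', Pi.add_apply]
              rw [add_sub_add_comm]
              exact abs_add_le _ _
          _ = ∫ x, |f x - U x| ∂μ + ∫ x, |g x - V x| ∂μ :=
              integral_add ((hint f).sub hU).abs ((hint g).sub hV).abs
          _ ≤ 2 * ε := by linarith
      have m1 := hT₁ (f + g) (U + V) hUV (t / 2) (by positivity)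
      have m2 := hT₁ f U hU (t / 4) (by positivity)
      have m3 := hT₁ g V hV (t / 4) (by positivity)
      have hle : μ {x | t < |T₁ (f + g) x - (T₁ f x + T₁ g x)|} ≤
          μ {x | t / 2 < |T₁ (f + g) x - T (U + V) x|} +
            (μ {x | t / 4 < |T₁ f x - T U x|} + μ {x | t / 4 < |T₁ g x - T V x|}) := by
        calc μ {x | t < |T₁ (f + g) x - (T₁ f x + T₁ g x)|}
            = μ {x | t / 2 + (t / 4 + t / 4) < |(T₁ (f + g) x - T (U + V) x) +
                (-(T₁ f x - T U x) + -(T₁ g x - T V x))|} := by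
              refine measure_congr ?_
              rw [map_add]
              filter_upwards [Lp.coeFn_add (T U) (T V)] with x hx
              change (t < _) = (_ < _)
              rw [hx, Pi.add_apply]
              ring_nf
          _ ≤ _ := by
              refine (measure_lt_abs_add_le _ _ _ _).trans (add_le_add le_rfl ?_)
              refine (measure_lt_abs_add_le _ _ _ _).trans ?_
              simp_rw [abs_neg]
              exact le_rfl
      refine hle.trans ?_
      rw [ENNReal.ofReal_add (by positivity) (by positivity),
        ENNReal.ofReal_add (by positivity) (by positivity), add_assoc]
      refine add_le_add (m1.trans (ENNReal.ofReal_le_ofReal ?_))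
        (add_le_add (m2.trans (ENNReal.ofReal_le_ofReal ?_))
          (m3.trans (ENNReal.ofReal_le_ofReal ?_))) <;> gcongr
    filter_upwards [hzero, AEEqFun.coeFn_add (T₁ f) (T₁ g)] with x hx hx'
    rw [hx', Pi.add_apply]
    exact sub_eq_zero.1 hx
  have hsmul : ∀ (c : ℝ) f, T₁ (c • f) = c • T₁ f := by
    intro c f
    refine AEEqFun.ext ?_
    have hzero : (fun x => T₁ (c • f) x - c * T₁ f x) =ᵐ[μ] 0 := by
      refine ae_eq_zero_of_measure_lt_abs fun t ht => ?_
      refine le_antisymm ?_ zero_le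
      -- The height `t / (2 * (|c| + 1))` makes `|c|` times it at most `t / 2`, also when `c = 0`.
      have := measure_le_of_forall_ofReal (μ := μ)
        (s := {x | t < |T₁ (c • f) x - c * T₁ f x|})
        (g := fun ε => C * (|c| * ε) / (t / 2) + C * ε / (t / (2 * (|c| + 1)))) (by fun_prop)
        fun ε hε => ?_
      · simpa using this
      obtain ⟨U, hU, hfU⟩ := exists_integrable_approx f hε
      have hcU : Integrable (c • U : Lp ℝ 2 μ) μ :=
        (integrable_congr (Lp.coeFn_smul c U)).2 (hU.smul c)
      have e1 : ∫ x, |(c • f : Lp ℝ 1 μ) x - (c • U : Lp ℝ 2 μ) x| ∂μ ≤ |c| * ε := by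
        calc ∫ x, |(c • f : Lp ℝ 1 μ) x - (c • U : Lp ℝ 2 μ) x| ∂μ
            = ∫ x, |c| * |f x - U x| ∂μ := by
              refine integral_congr_ae ?_
              filter_upwards [Lp.coeFn_smul c f, Lp.coeFn_smul c U] with x hx hx'
              simp only [hx, hx', Pi.smul_apply, smul_eq_mul]
              rw [← mul_sub, abs_mul]
          _ = |c| * ∫ x, |f x - U x| ∂μ := integral_const_mul _ _
          _ ≤ _ := by gcongr
      have m1 := hT₁ (c • f) (c • U) hcU (t / 2) (by positivity)
      have m2 := hT₁ f U hU (t / (2 * (|c| + 1))) (by positivity)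
      have hle : μ {x | t < |T₁ (c • f) x - c * T₁ f x|} ≤
          μ {x | t / 2 < |T₁ (c • f) x - T (c • U) x|} +
            μ {x | t / (2 * (|c| + 1)) < |T₁ f x - T U x|} := by
        calc μ {x | t < |T₁ (c • f) x - c * T₁ f x|}
            = μ {x | t / 2 + t / 2 < |(T₁ (c • f) x - T (c • U) x) +
                -(c * (T₁ f x - T U x))|} := by
              refine measure_congr ?_
              rw [map_smul]
              filter_upwards [Lp.coeFn_smul c (T U)] with x hx
              change (t < _) = (_ < _)
              rw [hx, Pi.smul_apply, smul_eq_mul]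
              ring_nf
          _ ≤ _ := by
              refine (measure_lt_abs_add_le _ _ _ _).trans
                (add_le_add le_rfl (measure_mono fun x hx => ?_))
              have hx' : t / 2 < |-(c * (T₁ f x - T U x))| := hx
              change t / (2 * (|c| + 1)) < |T₁ f x - T U x|
              rw [abs_neg, abs_mul] at hx'
              rw [div_lt_iff₀ (by positivity)]
              nlinarith [abs_nonneg (T₁ f x - T U x)]
      refine hle.trans ?_
      rw [ENNReal.ofReal_add (by positivity) (by positivity)]
      refine add_le_add (m1.trans (ENNReal.ofReal_le_ofReal ?_))
        (m2.trans (ENNReal.ofReal_le_ofReal ?_)) <;> gcongr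
    filter_upwards [hzero, AEEqFun.coeFn_smul c (T₁ f)] with x hx hx'
    rw [hx', Pi.smul_apply, smul_eq_mul]
    exact sub_eq_zero.1 hx
  refine ⟨{ toFun := T₁, map_add' := hadd, map_smul' := hsmul }, fun f g hfg => ?_, C,
    fun f t ht => ?_⟩
  · have hf : Integrable f μ := (integrable_congr hfg).2 (hint g)
    have hzero : (fun x => T₁ g x - T f x) =ᵐ[μ] 0 := by
      refine ae_eq_zero_of_measure_lt_abs fun t ht => ?_
      have h1 := hT₁ g f hf t ht
      have h2 : ∫ x, |g x - f x| ∂μ = 0 := by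
        refine integral_eq_zero_of_ae ?_
        filter_upwards [hfg] with x hx
        simp [hx]
      rw [h2, mul_zero, zero_div, ENNReal.ofReal_zero] at h1
      exact le_antisymm h1 zero_le
    filter_upwards [hzero] with x hx
    exact sub_eq_zero.1 hx
  · have h1 := hT₁ f 0 (integrable_congr (Lp.coeFn_zero ℝ 2 μ) |>.2 (integrable_zero _ _ _)) t ht
    have h2 : ∫ x, |f x - (0 : Lp ℝ 2 μ) x| ∂μ = ‖f‖ := by
      rw [L1.norm_eq_integral_norm]
      refine integral_congr_ae ?_
      filter_upwards [Lp.coeFn_zero ℝ 2 μ] with x hx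
      rw [hx, Pi.zero_apply, sub_zero, Real.norm_eq_abs]
    rw [h2] at h1
    refine le_trans (le_of_eq (measure_congr ?_)) h1
    rw [map_zero]
    filter_upwards [Lp.coeFn_zero ℝ 2 μ] with x hx
    change (t < _) = (t < _)
    rw [hx, Pi.zero_apply, sub_zero]
    rfl

end Extension

/-! ### Marcinkiewicz interpolation and duality -/

section Interpolation

variable {X : Type*} [MeasurableSpace X] {μ : Measure X} {T : Lp ℝ 2 μ →L[ℝ] Lp ℝ 2 μ} {C : ℝ}

theorem enorm_rpow_eq_ofReal {p : ℝ} (hp : 0 ≤ p) (y : ℝ) :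
    ‖y‖ₑ ^ p = ENNReal.ofReal (|y| ^ p) := by
  rw [Real.enorm_eq_ofReal_abs, ENNReal.ofReal_rpow_of_nonneg (abs_nonneg y) hp]

/-- The distribution function of `T F`, in terms of the large and the small values of `F`. -/
theorem measure_lt_abs_le_of_truncation (hC : 0 ≤ C)
    (h : ∀ F : Lp ℝ 2 μ, Integrable F μ → ∀ t : ℝ, 0 < t →
      μ {x | t < |T F x|} ≤ ENNReal.ofReal (C * (∫ x, |F x| ∂μ) / t))
    (F : Lp ℝ 2 μ) {t : ℝ} (ht : 0 < t) :
    μ {x | t < |T F x|} ≤ ENNReal.ofReal (2 * C / t) * ∫⁻ x in {x | t < |F x|}, ‖F x‖ₑ ∂μ +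
      ENNReal.ofReal (4 * ‖T‖ ^ 2 / t ^ 2) *
        ∫⁻ x in {x | |F x| ≤ t}, ENNReal.ofReal (|F x| ^ 2) ∂μ := by
  have hFm : Measurable F := (Lp.stronglyMeasurable F).measurable
  have hS : MeasurableSet {x | t < |F x|} := measurableSet_lt measurable_const hFm.abs
  have hS' : MeasurableSet {x | |F x| ≤ t} := measurableSet_le hFm.abs measurable_const
  set f₁ : X → ℝ := {x | t < |F x|}.indicator F with hf₁
  set f₂ : X → ℝ := {x | |F x| ≤ t}.indicator F with hf₂
  have m₁ : MemLp f₁ 2 μ := (Lp.memLp F).indicator hS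
  have m₂ : MemLp f₂ 2 μ := (Lp.memLp F).indicator hS'
  have hsum : F = toL2 μ f₁ + toL2 μ f₂ := by
    refine Lp.ext ?_
    filter_upwards [Lp.coeFn_add (toL2 μ f₁) (toL2 μ f₂), coe_toL2 m₁, coe_toL2 m₂]
      with x e1 e2 e3
    rw [e1, Pi.add_apply, e2, e3, hf₁, hf₂]
    by_cases hx : t < |F x|
    · rw [Set.indicator_of_mem (show x ∈ {x | t < |F x|} from hx),
        Set.indicator_of_notMem (show x ∉ {x | |F x| ≤ t} from not_le.2 hx), add_zero]
    · rw [Set.indicator_of_notMem (show x ∉ {x | t < |F x|} from hx),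
        Set.indicator_of_mem (show x ∈ {x | |F x| ≤ t} from not_lt.1 hx), zero_add]
  have hi₁ : Integrable f₁ μ := by
    -- The part of `F` above height `t` is integrable because it is dominated by `F ^ 2 / t`.
    have hsq : Integrable (fun x => F x ^ 2) μ :=
      (memLp_two_iff_integrable_sq (Lp.aestronglyMeasurable F)).1 (Lp.memLp F)
    refine (hsq.div_const t).mono' (hFm.indicator hS).aestronglyMeasurable
      (Filter.Eventually.of_forall fun x => ?_)
    rw [hf₁]
    by_cases hx : t < |F x|
    · rw [Set.indicator_of_mem (show x ∈ {x | t < |F x|} from hx), Real.norm_eq_abs,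
        le_div_iff₀ ht, ← sq_abs, sq]
      exact mul_le_mul_of_nonneg_left hx.le (abs_nonneg _)
    · rw [Set.indicator_of_notMem (show x ∉ {x | t < |F x|} from hx), norm_zero]
      positivity
  have hi₁' : Integrable (toL2 μ f₁) μ := (integrable_congr (coe_toL2 m₁)).2 hi₁
  have b₁ := h (toL2 μ f₁) hi₁' (t / 2) (half_pos ht)
  have b₂ := measure_lt_abs_le_ofReal (T (toL2 μ f₂)) (half_pos ht)
  have hle : μ {x | t < |T F x|} ≤
      μ {x | t / 2 < |T (toL2 μ f₁) x|} + μ {x | t / 2 < |T (toL2 μ f₂) x|} := by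
    refine le_trans (le_of_eq (measure_congr ?_)) (measure_lt_abs_add_le _ _ _ _)
    have hT : T F = T (toL2 μ f₁) + T (toL2 μ f₂) := by rw [← map_add, ← hsum]
    filter_upwards [Lp.coeFn_add (T (toL2 μ f₁)) (T (toL2 μ f₂))] with x hx
    change (t < _) = (_ < _)
    rw [hT, hx, add_halves]
    rfl
  refine hle.trans (add_le_add (b₁.trans (le_of_eq ?_)) (b₂.trans ?_))
  · have e : ENNReal.ofReal (∫ x, |toL2 μ f₁ x| ∂μ) = ∫⁻ x in {x | t < |F x|}, ‖F x‖ₑ ∂μ := by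
      have := ofReal_integral_norm_eq_lintegral_enorm hi₁'
      simp_rw [Real.norm_eq_abs] at this
      rw [this, ← lintegral_indicator hS]
      refine lintegral_congr_ae ?_
      filter_upwards [coe_toL2 m₁] with x hx
      rw [hx, hf₁, enorm_indicator_eq_indicator_enorm]
    rw [← e, ← ENNReal.ofReal_mul (by positivity)]
    congr 1
    field_simp
  · have e : ENNReal.ofReal (‖toL2 μ f₂‖ ^ 2) =
        ∫⁻ x in {x | |F x| ≤ t}, ENNReal.ofReal (|F x| ^ 2) ∂μ := by
      rw [← real_inner_self_eq_norm_sq, inner_toL2_toL2 m₂ m₂,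
        ofReal_integral_eq_lintegral_ofReal (f := fun x => f₂ x * f₂ x) (m₂.integrable_mul m₂)
          (Filter.Eventually.of_forall fun x => mul_self_nonneg _), ← lintegral_indicator hS']
      refine lintegral_congr fun x => ?_
      rw [hf₂]
      by_cases hx : |F x| ≤ t
      · rw [Set.indicator_of_mem (show x ∈ {x | |F x| ≤ t} from hx),
          Set.indicator_of_mem (show x ∈ {x | |F x| ≤ t} from hx), sq_abs, sq]
      · rw [Set.indicator_of_notMem (show x ∉ {x | |F x| ≤ t} from hx),
          Set.indicator_of_notMem (show x ∉ {x | |F x| ≤ t} from hx), mul_zero,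
          ENNReal.ofReal_zero]
    rw [← e, ← ENNReal.ofReal_mul (by positivity)]
    refine ENNReal.ofReal_le_ofReal ?_
    calc ‖T (toL2 μ f₂)‖ ^ 2 / (t / 2) ^ 2 ≤ (‖T‖ * ‖toL2 μ f₂‖) ^ 2 / (t / 2) ^ 2 := by
          gcongr
          exact T.le_opNorm _
      _ = _ := by
          field_simp
          norm_num

/-- The layer cake formula with exponent `p - 1` for the measure of density `|F|`; it needs `p > 1`.
-/
theorem lintegral_large_values {F : X → ℝ} (hF : Measurable F) {p : ℝ} (hp : 1 < p) :
    ∫⁻ t in Set.Ioi (0 : ℝ), (∫⁻ x in {x | t < |F x|}, ‖F x‖ₑ ∂μ) * ENNReal.ofReal (t ^ (p - 1 - 1))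
      = ENNReal.ofReal (1 / (p - 1)) * ∫⁻ x, ‖F x‖ₑ ^ p ∂μ := by
  have hp1 : 0 < p - 1 := by linarith
  have h := lintegral_rpow_eq_lintegral_meas_lt_mul (μ.withDensity fun x => ‖F x‖ₑ)
    (f := fun x => |F x|) (Filter.Eventually.of_forall fun x => abs_nonneg _)
    hF.abs.aemeasurable hp1
  rw [lintegral_withDensity_eq_lintegral_mul μ hF.enorm
    (hF.abs.pow_const (p - 1)).ennreal_ofReal] at h
  have e1 : ∀ x, ((fun x => ‖F x‖ₑ) * fun x => ENNReal.ofReal (|F x| ^ (p - 1))) x =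
      ‖F x‖ₑ ^ p := by
    intro x
    rw [Pi.mul_apply, enorm_rpow_eq_ofReal (by linarith), Real.enorm_eq_ofReal_abs,
      ← ENNReal.ofReal_mul (abs_nonneg _)]
    congr 1
    rcases (abs_nonneg (F x)).eq_or_lt with h0 | h0
    · rw [← h0, zero_mul, Real.zero_rpow (by linarith)]
    · rw [← Real.rpow_one_add' h0.le (by linarith)]
      congr 1
      ring
  simp_rw [e1, fun t : ℝ => withDensity_apply (μ := μ) (fun x => ‖F x‖ₑ)
    (measurableSet_lt (measurable_const (a := t)) hF.abs)] at h
  rw [h, ← mul_assoc, ← ENNReal.ofReal_mul (by positivity), one_div_mul_cancel hp1.ne',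
    ENNReal.ofReal_one, one_mul]

/-- Tonelli: the integral of `t ^ (p - 3)` over `t > |F x|` is `|F x| ^ (p - 2) / (2 - p)`, finite
since `p < 2`. -/
theorem lintegral_small_values [SFinite μ] {F : X → ℝ} (hF : Measurable F) {p : ℝ} (hp0 : 0 < p)
    (hp : p < 2) :
    ∫⁻ t in Set.Ioi (0 : ℝ), (∫⁻ x in {x | |F x| ≤ t}, ENNReal.ofReal (|F x| ^ 2) ∂μ) *
        ENNReal.ofReal (t ^ (p - 3)) ≤ ENNReal.ofReal (1 / (2 - p)) * ∫⁻ x, ‖F x‖ₑ ^ p ∂μ := by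
  have hp2 : 0 < 2 - p := by linarith
  set G : ℝ → X → ℝ≥0∞ := fun t x =>
    if |F x| ≤ t then ENNReal.ofReal (|F x| ^ 2) * ENNReal.ofReal (t ^ (p - 3)) else 0 with hG
  have hGm : Measurable (Function.uncurry G) := by
    refine Measurable.ite (measurableSet_le (hF.abs.comp measurable_snd) measurable_fst) ?_
      measurable_const
    exact (((hF.abs.comp measurable_snd).pow_const 2).ennreal_ofReal).mul
      ((measurable_fst.pow_const (p - 3)).ennreal_ofReal)
  have e1 : ∀ t : ℝ, (∫⁻ x in {x | |F x| ≤ t}, ENNReal.ofReal (|F x| ^ 2) ∂μ) *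
      ENNReal.ofReal (t ^ (p - 3)) = ∫⁻ x, G t x ∂μ := by
    intro t
    rw [← lintegral_mul_const' _ _ ENNReal.ofReal_ne_top,
      ← lintegral_indicator (measurableSet_le hF.abs measurable_const)]
    refine lintegral_congr fun x => ?_
    simp only [hG, Set.indicator_apply, Set.mem_ofPred_eq]
  simp_rw [e1]
  rw [lintegral_lintegral_swap hGm.aemeasurable, ← lintegral_const_mul' _ _ ENNReal.ofReal_ne_top]
  refine lintegral_mono fun x => ?_
  rcases (abs_nonneg (F x)).eq_or_lt with h0 | h0
  · have : ∀ t, G t x = 0 := fun t => by simp [hG, abs_eq_zero.1 h0.symm]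
    simp [this]
  calc ∫⁻ t in Set.Ioi (0 : ℝ), G t x
      = ∫⁻ t in Set.Ioi (0 : ℝ), (Set.Ici |F x|).indicator
          (fun t => ENNReal.ofReal (|F x| ^ 2) * ENNReal.ofReal (t ^ (p - 3))) t := by
        refine lintegral_congr fun t => ?_
        simp only [hG, Set.indicator_apply, Set.mem_Ici]
    _ ≤ ∫⁻ t, (Set.Ici |F x|).indicator
          (fun t => ENNReal.ofReal (|F x| ^ 2) * ENNReal.ofReal (t ^ (p - 3))) t :=
        setLIntegral_le_lintegral _ _
    _ = ENNReal.ofReal (|F x| ^ 2) * ∫⁻ t in Set.Ioi |F x|, ENNReal.ofReal (t ^ (p - 3)) := by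
        rw [lintegral_indicator measurableSet_Ici, lintegral_const_mul' _ _ ENNReal.ofReal_ne_top,
          setLIntegral_congr Ioi_ae_eq_Ici]
    _ = ENNReal.ofReal (|F x| ^ 2) * ENNReal.ofReal (|F x| ^ (p - 2) / (2 - p)) := by
        rw [← ofReal_integral_eq_lintegral_ofReal
          (integrableOn_Ioi_rpow_of_lt (by linarith) h0)
          (by filter_upwards [ae_restrict_mem measurableSet_Ioi] with t ht
              exact Real.rpow_nonneg (h0.trans ht).le _),
          integral_Ioi_rpow_of_lt (by linarith) h0]
        congr 2
        rw [show p - 3 + 1 = -(2 - p) by ring, neg_div_neg_eq, show -(2 - p) = p - 2 by ring]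
    _ = ENNReal.ofReal (1 / (2 - p)) * ‖F x‖ₑ ^ p := by
        rw [enorm_rpow_eq_ofReal hp0.le, ← ENNReal.ofReal_mul (by positivity),
          ← ENNReal.ofReal_mul (by positivity)]
        congr 1
        rw [← Real.rpow_two, mul_div_assoc', ← Real.rpow_add h0, add_sub_cancel]
        ring

/-- Interpolation between the weak type `(1,1)` and `L²`. -/
theorem exists_strong_bound_of_weak_bound [SFinite μ] (hC : 0 ≤ C)
    (h : ∀ F : Lp ℝ 2 μ, Integrable F μ → ∀ t : ℝ, 0 < t →
      μ {x | t < |T F x|} ≤ ENNReal.ofReal (C * (∫ x, |F x| ∂μ) / t))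
    {p : ℝ} (hp1 : 1 < p) (hp2 : p < 2) :
    ∃ K : ℝ, 0 ≤ K ∧
      ∀ F : Lp ℝ 2 μ, ∫⁻ x, ‖T F x‖ₑ ^ p ∂μ ≤ ENNReal.ofReal K * ∫⁻ x, ‖F x‖ₑ ^ p ∂μ := by
  have hp0 : 0 < p := by linarith
  have hq1 : 0 < p - 1 := by linarith
  have hq2 : 0 < 2 - p := by linarith
  refine ⟨p * (2 * C * (1 / (p - 1)) + 4 * ‖T‖ ^ 2 * (1 / (2 - p))), by positivity, fun F => ?_⟩
  have hFm : Measurable F := (Lp.stronglyMeasurable F).measurable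
  have hTFm : Measurable (T F) := (Lp.stronglyMeasurable (T F)).measurable
  simp_rw [enorm_rpow_eq_ofReal hp0.le (T F _)]
  rw [lintegral_rpow_eq_lintegral_meas_lt_mul μ (f := fun x => |T F x|)
    (Filter.Eventually.of_forall fun x => abs_nonneg _) hTFm.abs.aemeasurable hp0]
  -- Additivity of the integral needs only one measurable summand; this one is an antitone function
  -- of `t` times a power.
  have hmeas1 : Measurable fun t : ℝ => ENNReal.ofReal (2 * C) *
      ((∫⁻ x in {x | t < |F x|}, ‖F x‖ₑ ∂μ) * ENNReal.ofReal (t ^ (p - 1 - 1))) := by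
    refine Measurable.const_mul (Measurable.mul (Antitone.measurable fun s t hst => ?_) ?_) _
    · exact lintegral_mono_set fun x hx => lt_of_le_of_lt hst hx
    · exact (measurable_id.pow_const _).ennreal_ofReal
  calc ENNReal.ofReal p * ∫⁻ t in Set.Ioi (0 : ℝ), μ {x | t < |T F x|} *
        ENNReal.ofReal (t ^ (p - 1))
      ≤ ENNReal.ofReal p * ∫⁻ t in Set.Ioi (0 : ℝ), (ENNReal.ofReal (2 * C) *
          ((∫⁻ x in {x | t < |F x|}, ‖F x‖ₑ ∂μ) * ENNReal.ofReal (t ^ (p - 1 - 1))) +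
        ENNReal.ofReal (4 * ‖T‖ ^ 2) *
          ((∫⁻ x in {x | |F x| ≤ t}, ENNReal.ofReal (|F x| ^ 2) ∂μ) *
            ENNReal.ofReal (t ^ (p - 3)))) := by
        refine mul_le_mul' le_rfl (setLIntegral_mono' measurableSet_Ioi fun t ht => ?_)
        have ht0 : (0 : ℝ) < t := ht
        refine (mul_le_mul' (measure_lt_abs_le_of_truncation hC h F ht0) le_rfl).trans
          (le_of_eq ?_)
        rw [add_mul]
        congr 1
        · rw [mul_right_comm, ← ENNReal.ofReal_mul (by positivity), mul_left_comm,
            ← ENNReal.ofReal_mul (by positivity), mul_comm]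
          congr 2
          rw [Real.rpow_sub_one ht0.ne' (p - 1)]
          ring
        · rw [mul_right_comm, ← ENNReal.ofReal_mul (by positivity), mul_left_comm,
            ← ENNReal.ofReal_mul (by positivity), mul_comm]
          congr 2
          rw [show p - 3 = p - 1 - 2 by ring, Real.rpow_sub ht0 (p - 1) 2, Real.rpow_two]
          ring
    _ = ENNReal.ofReal p * (ENNReal.ofReal (2 * C) * (ENNReal.ofReal (1 / (p - 1)) *
          ∫⁻ x, ‖F x‖ₑ ^ p ∂μ) + ENNReal.ofReal (4 * ‖T‖ ^ 2) *
          ∫⁻ t in Set.Ioi (0 : ℝ), (∫⁻ x in {x | |F x| ≤ t}, ENNReal.ofReal (|F x| ^ 2) ∂μ) *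
            ENNReal.ofReal (t ^ (p - 3))) := by
        rw [lintegral_add_left hmeas1, lintegral_const_mul' _ _ ENNReal.ofReal_ne_top,
          lintegral_const_mul' _ _ ENNReal.ofReal_ne_top, lintegral_large_values hFm hp1]
    _ ≤ ENNReal.ofReal p * (ENNReal.ofReal (2 * C) * (ENNReal.ofReal (1 / (p - 1)) *
          ∫⁻ x, ‖F x‖ₑ ^ p ∂μ) + ENNReal.ofReal (4 * ‖T‖ ^ 2) * (ENNReal.ofReal (1 / (2 - p)) *
          ∫⁻ x, ‖F x‖ₑ ^ p ∂μ)) := by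
        gcongr
        exact lintegral_small_values hFm hp0 hp2
    _ = _ := by
        rw [ENNReal.ofReal_mul hp0.le, ENNReal.ofReal_add (by positivity) (by positivity),
          ENNReal.ofReal_mul (p := 2 * C) (by positivity),
          ENNReal.ofReal_mul (p := 4 * ‖T‖ ^ 2) (by positivity)]
        ring

/-- If the adjoint of `T` is bounded on `L^q`, then `T` is bounded on the dual space. -/
theorem strong_bound_of_adjoint {T' : Lp ℝ 2 μ →L[ℝ] Lp ℝ 2 μ}
    (hadj : ∀ F G, inner ℝ (T F) G = inner ℝ F (T' G)) {p q : ℝ} (hpq : p.HolderConjugate q)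
    (hp : 2 ≤ p) {K : ℝ}
    (hT' : ∀ G : Lp ℝ 2 μ, ∫⁻ x, ‖T' G x‖ₑ ^ q ∂μ ≤ ENNReal.ofReal K * ∫⁻ x, ‖G x‖ₑ ^ q ∂μ)
    (F : Lp ℝ 2 μ) :
    ∫⁻ x, ‖T F x‖ₑ ^ p ∂μ ≤ ENNReal.ofReal K ^ (p / q) * ∫⁻ x, ‖F x‖ₑ ^ p ∂μ := by
  have hp0 : 0 < p := by linarith
  have hq0 : 0 < q := hpq.symm.pos
  set y : X → ℝ := fun x => T F x with hy
  have hym : Measurable y := (Lp.stronglyMeasurable (T F)).measurable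
  have hymem : MemLp y 2 μ := Lp.memLp (T F)
  have htrunc : ∀ n : ℕ, ∫⁻ x in {x | |y x| ≤ n}, ‖y x‖ₑ ^ p ∂μ ≤
      ENNReal.ofReal K ^ (p / q) * ∫⁻ x, ‖F x‖ₑ ^ p ∂μ := by
    intro n
    have hS : MeasurableSet {x | |y x| ≤ n} := measurableSet_le hym.abs measurable_const
    -- The extremal function for Hölder, `|g| ^ q = |y| ^ p` and `y g = |y| ^ p`. The truncation at
    -- height `n`, with `p ≥ 2`, keeps `g` in `L²` and the integral `I` finite.
    set g : X → ℝ := {x | |y x| ≤ n}.indicator fun x => y x * |y x| ^ (p - 2) with hg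
    have hgm : Measurable g := (hym.mul (hym.abs.pow_const _)).indicator hS
    have hgmem : MemLp g 2 μ := by
      refine hymem.of_le_mul (c := (n : ℝ) ^ (p - 2)) hgm.aestronglyMeasurable
        (Filter.Eventually.of_forall fun x => ?_)
      by_cases hx : |y x| ≤ n
      · rw [hg, Set.indicator_of_mem (show x ∈ {x | |y x| ≤ n} from hx), norm_mul,
          Real.norm_of_nonneg (Real.rpow_nonneg (abs_nonneg _) _), mul_comm]
        gcongr
      · rw [hg, Set.indicator_of_notMem (show x ∉ {x | |y x| ≤ n} from hx), norm_zero]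
        positivity
    set I : ℝ≥0∞ := ∫⁻ x in {x | |y x| ≤ n}, ‖y x‖ₑ ^ p ∂μ with hI
    have hIg : I = ∫⁻ x, ‖g x‖ₑ ^ q ∂μ := by
      rw [hI, ← lintegral_indicator hS]
      refine lintegral_congr fun x => ?_
      by_cases hx : |y x| ≤ n
      · rw [hg, Set.indicator_of_mem (show x ∈ {x | |y x| ≤ n} from hx),
          Set.indicator_of_mem (show x ∈ {x | |y x| ≤ n} from hx), enorm_rpow_eq_ofReal hp0.le,
          enorm_rpow_eq_ofReal hq0.le]
        congr 1
        rw [abs_mul, abs_of_nonneg (Real.rpow_nonneg (abs_nonneg _) _)]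
        rcases (abs_nonneg (y x)).eq_or_lt with h0 | h0
        · rw [← h0, zero_mul, Real.zero_rpow hp0.ne', Real.zero_rpow hq0.ne']
        · rw [← Real.rpow_one_add' h0.le (by linarith), ← Real.rpow_mul h0.le]
          congr 1
          have := hpq.sub_one_mul_conj
          linarith
      · rw [hg, Set.indicator_of_notMem (show x ∉ {x | |y x| ≤ n} from hx),
          Set.indicator_of_notMem (show x ∉ {x | |y x| ≤ n} from hx), enorm_zero,
          ENNReal.zero_rpow_of_pos hq0]
    have hIfin : I ≠ ⊤ := by
      have hsq := (memLp_two_iff_integrable_sq hymem.1).1 hymem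
      refine ne_top_of_le_ne_top (b := ENNReal.ofReal ((n : ℝ) ^ (p - 2)) *
        ∫⁻ x, ‖y x ^ 2‖ₑ ∂μ) (ENNReal.mul_ne_top ENNReal.ofReal_ne_top hsq.2.ne) ?_
      rw [hI, ← lintegral_const_mul' _ _ ENNReal.ofReal_ne_top]
      refine (setLIntegral_mono' hS fun x hx => ?_).trans (setLIntegral_le_lintegral _ _)
      have hx' : |y x| ≤ n := hx
      rw [enorm_rpow_eq_ofReal hp0.le, Real.enorm_of_nonneg (sq_nonneg _),
        ← ENNReal.ofReal_mul (by positivity)]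
      refine ENNReal.ofReal_le_ofReal ?_
      rcases (abs_nonneg (y x)).eq_or_lt with h0 | h0
      · rw [← h0, Real.zero_rpow hp0.ne']
        positivity
      · calc |y x| ^ p = |y x| ^ (p - 2) * |y x| ^ (2 : ℝ) := by
              rw [← Real.rpow_add h0]
              congr 1
              ring
          _ ≤ (n : ℝ) ^ (p - 2) * y x ^ 2 := by
              rw [Real.rpow_two, sq_abs]
              gcongr
    have hIle : I ≤ (∫⁻ x, ‖F x‖ₑ ^ p ∂μ) ^ (1 / p) * (ENNReal.ofReal K * I) ^ (1 / q) := by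
      have e1 : I = ∫⁻ x, ENNReal.ofReal (y x * g x) ∂μ := by
        rw [hI, ← lintegral_indicator hS]
        refine lintegral_congr fun x => ?_
        by_cases hx : |y x| ≤ n
        · rw [hg, Set.indicator_of_mem (show x ∈ {x | |y x| ≤ n} from hx),
            Set.indicator_of_mem (show x ∈ {x | |y x| ≤ n} from hx), enorm_rpow_eq_ofReal hp0.le,
            ← mul_assoc, ← sq, ← sq_abs, ← Real.rpow_two]
          congr 1
          rcases (abs_nonneg (y x)).eq_or_lt with h0 | h0
          · rw [← h0, Real.zero_rpow hp0.ne', Real.zero_rpow two_ne_zero, zero_mul]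
          · rw [← Real.rpow_add h0]
            congr 1
            ring
        · rw [hg, Set.indicator_of_notMem (show x ∉ {x | |y x| ≤ n} from hx),
            Set.indicator_of_notMem (show x ∉ {x | |y x| ≤ n} from hx), mul_zero,
            ENNReal.ofReal_zero]
      have hnn : ∀ x, 0 ≤ y x * g x := by
        intro x
        by_cases hx : |y x| ≤ n
        · rw [hg, Set.indicator_of_mem (show x ∈ {x | |y x| ≤ n} from hx), ← mul_assoc]
          exact mul_nonneg (mul_self_nonneg _) (Real.rpow_nonneg (abs_nonneg _) _)
        · rw [hg, Set.indicator_of_notMem (show x ∉ {x | |y x| ≤ n} from hx), mul_zero]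
      have e2 : ∫ x, y x * g x ∂μ = ∫ x, F x * T' (toL2 μ g) x ∂μ := by
        rw [hy, ← inner_toL2 _ hgmem, hadj, L2.inner_def]
        refine integral_congr_ae (Filter.Eventually.of_forall fun x => ?_)
        simp [mul_comm]
      calc I = ENNReal.ofReal (∫ x, y x * g x ∂μ) := by
            rw [e1, ofReal_integral_eq_lintegral_ofReal (f := fun x => y x * g x)
              (hymem.integrable_mul hgmem)
              (Filter.Eventually.of_forall hnn)]
        _ ≤ ‖∫ x, F x * T' (toL2 μ g) x ∂μ‖ₑ := by
            rw [e2, Real.enorm_eq_ofReal_abs]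
            exact ENNReal.ofReal_le_ofReal (le_abs_self _)
        _ ≤ ∫⁻ x, ‖F x * T' (toL2 μ g) x‖ₑ ∂μ := enorm_integral_le_lintegral_enorm _
        _ = ∫⁻ x, ((fun x => ‖F x‖ₑ) * fun x => ‖T' (toL2 μ g) x‖ₑ) x ∂μ := by
            simp_rw [enorm_mul, Pi.mul_apply]
        _ ≤ (∫⁻ x, ‖F x‖ₑ ^ p ∂μ) ^ (1 / p) *
              (∫⁻ x, ‖T' (toL2 μ g) x‖ₑ ^ q ∂μ) ^ (1 / q) :=
            ENNReal.lintegral_mul_le_Lp_mul_Lq μ hpq (Lp.aestronglyMeasurable F).enorm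
              (Lp.aestronglyMeasurable _).enorm
        _ ≤ _ := by
            gcongr
            refine (hT' _).trans (le_of_eq ?_)
            rw [hIg]
            congr 1
            refine lintegral_congr_ae ?_
            filter_upwards [coe_toL2 hgmem] with x hx
            rw [hx]
    rcases eq_or_ne I 0 with h0 | h0
    · rw [h0]; exact zero_le
    -- Division of `hIle` by `I ^ (1 / q)`, allowed because `I` is neither 0 nor infinite.
    have h1 : I ^ (1 / p) ≤ (∫⁻ x, ‖F x‖ₑ ^ p ∂μ) ^ (1 / p) * ENNReal.ofReal K ^ (1 / q) := by
      have hc0 : I ^ (1 / q) ≠ 0 := by simp [ENNReal.rpow_eq_zero_iff, h0, hIfin]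
      have hct : I ^ (1 / q) ≠ ⊤ := ENNReal.rpow_ne_top_of_nonneg (by positivity) hIfin
      rw [← ENNReal.mul_le_mul_iff_left hc0 hct, ← ENNReal.rpow_add _ _ h0 hIfin, mul_assoc,
        ← ENNReal.mul_rpow_of_nonneg _ _ (by positivity)]
      have : 1 / p + 1 / q = 1 := by simpa using hpq.inv_add_inv_eq_one
      rw [this, ENNReal.rpow_one]
      exact hIle
    calc I = (I ^ (1 / p)) ^ p := by
          rw [← ENNReal.rpow_mul, one_div_mul_cancel hp0.ne', ENNReal.rpow_one]
      _ ≤ ((∫⁻ x, ‖F x‖ₑ ^ p ∂μ) ^ (1 / p) * ENNReal.ofReal K ^ (1 / q)) ^ p := by gcongr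
      _ = _ := by
          rw [ENNReal.mul_rpow_of_nonneg _ _ hp0.le, ← ENNReal.rpow_mul, ← ENNReal.rpow_mul,
            one_div_mul_cancel hp0.ne', ENNReal.rpow_one, mul_comm, one_div_mul_eq_div]
  have hunion : ⋃ n : ℕ, {x | |y x| ≤ n} = Set.univ := Set.eq_univ_of_forall fun x => by
    obtain ⟨n, hn⟩ := exists_nat_ge |y x|
    exact Set.mem_iUnion.2 ⟨n, hn⟩
  have hmono : Monotone fun n : ℕ => {x | |y x| ≤ n} := fun n m hnm x hx =>
    le_trans (show |y x| ≤ n from hx) (Nat.cast_le.2 hnm)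
  have := setLIntegral_iUnion_of_directed (μ := μ) (fun x => ‖y x‖ₑ ^ p) hmono.directed_le
  rw [hunion, setLIntegral_univ] at this
  rw [hy] at this
  rw [this]
  exact iSup_le htrunc

/-- `L² ∩ Lᵖ` is treated as a subspace of `L²` with a dense image in `Lᵖ`; the operator preserves it
and is bounded in the `Lᵖ` norm, so it extends by continuity. -/
theorem isBoundedOnLp_of_bound {p : ℝ≥0∞} [Fact (1 ≤ p)] (hp : p ≠ ⊤) {K : ℝ≥0∞} (hK : K ≠ ⊤)
    (h : ∀ F : Lp ℝ 2 μ, ∫⁻ x, ‖T F x‖ₑ ^ p.toReal ∂μ ≤ K * ∫⁻ x, ‖F x‖ₑ ^ p.toReal ∂μ) :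
    IsBoundedOnLp T p := by
  have hp1 : 1 ≤ p := Fact.out
  have hp0 : p ≠ 0 := (zero_lt_one.trans_le hp1).ne'
  have hpr : 0 < p.toReal := ENNReal.toReal_pos hp0 hp
  have hnorm : ∀ F : Lp ℝ 2 μ, eLpNorm (T F) p μ ≤ K ^ (1 / p.toReal) * eLpNorm F p μ := by
    intro F
    rw [eLpNorm_eq_lintegral_rpow_enorm_toReal hp0 hp,
      eLpNorm_eq_lintegral_rpow_enorm_toReal hp0 hp,
      ← ENNReal.mul_rpow_of_nonneg _ _ (by positivity)]
    gcongr
    exact h F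
  have hK' : K ^ (1 / p.toReal) ≠ ⊤ := ENNReal.rpow_ne_top_of_nonneg (by positivity) hK
  have hTmem : ∀ F : Lp ℝ 2 μ, MemLp F p μ → MemLp (T F) p μ := fun F hF =>
    ⟨Lp.aestronglyMeasurable _, (hnorm F).trans_lt (ENNReal.mul_lt_top hK'.lt_top hF.2)⟩
  let S : Submodule ℝ (Lp ℝ 2 μ) :=
    { carrier := {F | MemLp F p μ}
      add_mem' := fun {F G} hF hG => (memLp_congr_ae (Lp.coeFn_add F G)).2 (hF.add hG)
      zero_mem' := (memLp_congr_ae (Lp.coeFn_zero ℝ 2 μ)).2 MemLp.zero'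
      smul_mem' := fun c F hF => (memLp_congr_ae (Lp.coeFn_smul c F)).2 (hF.const_smul c) }
  let e : S →ₗ[ℝ] Lp ℝ p μ :=
    { toFun := fun F => MemLp.toLp F.1 F.2
      map_add' := fun F G => by
        refine Lp.ext ?_
        filter_upwards [MemLp.coeFn_toLp (F + G).2, Lp.coeFn_add F.1 G.1,
          Lp.coeFn_add (MemLp.toLp F.1 F.2) (MemLp.toLp G.1 G.2), MemLp.coeFn_toLp F.2,
          MemLp.coeFn_toLp G.2] with x e1 e2 e3 e4 e5
        rw [e1, e3, Pi.add_apply, e4, e5]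
        exact e2
      map_smul' := fun c F => by
        refine Lp.ext ?_
        filter_upwards [MemLp.coeFn_toLp (c • F).2, Lp.coeFn_smul c F.1,
          Lp.coeFn_smul c (MemLp.toLp F.1 F.2), MemLp.coeFn_toLp F.2] with x e1 e2 e3 e4
        rw [e1, RingHom.id_apply, e3, Pi.smul_apply, e4]
        exact e2 }
  let TS : S →ₗ[ℝ] S :=
    (T.toLinearMap.domRestrict S).codRestrict S fun F => hTmem F.1 F.2
  have he : ∀ F : S, e F =ᵐ[μ] F.1 := fun F => MemLp.coeFn_toLp F.2
  have hdense : DenseRange e := by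
    intro f
    rw [Metric.mem_closure_iff]
    intro ε hε
    obtain ⟨U, hU, hlt⟩ := exists_memLp_two_approx hp0 hp (Lp.memLp f) (ε := ENNReal.ofReal ε)
      (by simpa using hε)
    refine ⟨e ⟨U, hU⟩, ⟨_, rfl⟩, ?_⟩
    rw [Lp.dist_def]
    refine (ENNReal.toReal_lt_of_lt_ofReal ?_)
    rwa [eLpNorm_congr_ae ((Filter.EventuallyEq.refl _ ⇑f).sub (he ⟨U, hU⟩))]
  have hbound : ∃ c, ∀ F : S, ‖(e ∘ₗ TS) F‖ ≤ c * ‖e F‖ := by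
    refine ⟨(K ^ (1 / p.toReal)).toReal, fun F => ?_⟩
    rw [Lp.norm_def, Lp.norm_def, ← ENNReal.toReal_mul]
    refine ENNReal.toReal_mono (ENNReal.mul_ne_top hK' (Lp.eLpNorm_ne_top _)) ?_
    rw [eLpNorm_congr_ae (he F)]
    refine le_trans (le_of_eq (eLpNorm_congr_ae (he (TS F)))) (hnorm F.1)
  refine ⟨(e ∘ₗ TS).extendOfNorm e, fun f g hfg => ?_⟩
  have hf : MemLp f p μ := (memLp_congr_ae hfg).2 (Lp.memLp g)
  have hg : g = e ⟨f, hf⟩ := Lp.ext (hfg.symm.trans (he ⟨f, hf⟩).symm)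
  rw [hg, LinearMap.extendOfNorm_eq hdense hbound]
  exact he (TS ⟨f, hf⟩)

end Interpolation

/-! ### The operator of two atom families and its adjoint -/

section AtomOperator

variable {X : Type*} [MeasurableSpace X] {d : X → X → ℝ} {μ : Measure X} {lam : ℝ}
  {D : ℤ → Set (Set X)} {A a b : ℝ} {u v : Set X → X → ℝ}

theorem IsAtomFamily.exists_hasSum (T : IsRegularTree d μ lam D A) (hu : IsAtomFamily μ D a u)
    (hv : IsAtomFamily μ D b v) :
    ∃ P : Lp ℝ 2 μ →L[ℝ] Lp ℝ 2 μ, ∀ f,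
      HasSum (fun Q : splitCubes D => inner ℝ f (toL2 μ (u Q)) • toL2 μ (v Q)) (P f) := by
  have horth : ∀ {c : ℝ} {w : Set X → X → ℝ}, IsAtomFamily μ D c w →
      ∀ Q Q' : splitCubes D, Q ≠ Q' → inner ℝ (toL2 μ (w Q)) (toL2 μ (w Q')) = 0 := by
    intro c w hw Q Q' hne
    rw [inner_toL2_toL2 (hw.memLp T Q.2 2) (hw.memLp T Q'.2 2)]
    exact hw.orthogonal Q Q.2 Q' Q'.2 fun h => hne (Subtype.ext h)
  exact exists_hasSum_inner_smul (sq_nonneg a) (sq_nonneg b) (horth hu) (horth hv)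
    (fun Q => hu.norm_sq_le T Q.2) (fun Q => hv.norm_sq_le T Q.2)

theorem inner_eq_of_hasSum {P P' : Lp ℝ 2 μ →L[ℝ] Lp ℝ 2 μ}
    (hP : ∀ f, HasSum (fun Q : splitCubes D => inner ℝ f (toL2 μ (u Q)) • toL2 μ (v Q)) (P f))
    (hP' : ∀ f, HasSum (fun Q : splitCubes D => inner ℝ f (toL2 μ (v Q)) • toL2 μ (u Q)) (P' f))
    (F G : Lp ℝ 2 μ) : inner ℝ (P F) G = inner ℝ F (P' G) := by
  have h1 := (hP F).mapL (innerSL ℝ G)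
  have h2 := (hP' G).mapL (innerSL ℝ F)
  simp only [innerSL_apply_apply, inner_smul_right] at h1 h2
  rw [real_inner_comm]
  refine h1.unique ?_
  convert h2 using 2
  exact mul_comm _ _

/-- For `p > 2` the adjoint is the operator with the atom families exchanged. It has its own weak
type bound, hence is bounded for the conjugate exponent, which is below 2. -/
theorem IsHaarSystem.isBoundedOnLp_of_hasSum {H : Set (X → ℝ)} (hH : IsHaarSystem μ D H)
    (T : IsRegularTree d μ lam D A) (hu : IsAtomFamily μ D a u) (hv : IsAtomFamily μ D b v)
    {P : Lp ℝ 2 μ →L[ℝ] Lp ℝ 2 μ}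
    (hP : ∀ f, HasSum (fun Q : splitCubes D => inner ℝ f (toL2 μ (u Q)) • toL2 μ (v Q)) (P f))
    {p : ℝ≥0∞} [Fact (1 ≤ p)] (hp1 : 1 < p) (hp : p < ⊤) : IsBoundedOnLp P p := by
  have := IsDyadicFamily.sigmaFinite T.homogeneous
  have hA : 0 < A := by linarith [T.two_le]
  have hr1 : 1 < p.toReal := by
    rw [← ENNReal.toReal_one]
    exact (ENNReal.toReal_lt_toReal ENNReal.one_ne_top hp.ne).2 hp1
  rcases lt_trichotomy p.toReal 2 with h2 | h2 | h2
  · obtain ⟨K, -, hK⟩ := exists_strong_bound_of_weak_bound (C := 2 * (A * (1 + ‖P‖ ^ 2)))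
      (by positivity) (fun F hF t ht => hH.measure_lt_abs_le_of_integrable T hu hv hP F hF ht)
      hr1 h2
    exact isBoundedOnLp_of_bound hp.ne ENNReal.ofReal_ne_top hK
  · obtain rfl : p = 2 := by
      rw [← ENNReal.ofReal_toReal hp.ne, h2]
      simp
    refine ⟨P, fun f g hfg => ?_⟩
    rw [Lp.ext hfg]
  · obtain ⟨P', hP'⟩ := hv.exists_hasSum T hu
    have hpq := Real.HolderConjugate.conjExponent hr1
    have hq2 : p.toReal.conjExponent < 2 := by
      rw [Real.conjExponent, div_lt_iff₀ (by linarith)]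
      linarith
    obtain ⟨K, -, hK⟩ := exists_strong_bound_of_weak_bound (C := 2 * (A * (1 + ‖P'‖ ^ 2)))
      (by positivity) (fun F hF t ht => hH.measure_lt_abs_le_of_integrable T hv hu hP' F hF ht)
      hpq.symm.lt hq2
    exact isBoundedOnLp_of_bound hp.ne
      (ENNReal.rpow_ne_top_of_nonneg (div_pos hpq.pos hpq.symm.pos).le ENNReal.ofReal_ne_top)
      (strong_bound_of_adjoint (inner_eq_of_hasSum hP hP') hpq h2.le hK)

end AtomOperator

end DyadicCZ

theorem theorem5p2 {X : Type*} [MeasurableSpace X] (d : X → X → ℝ) (μ : Measure X)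
    (hX : DyadicCZ.IsHomogeneousType d μ)
    (lam : ℝ) (D : ℤ → Set (Set X)) (hD : DyadicCZ.IsDyadicFamily d lam D)
    (hquad : DyadicCZ.IsQuadrant D)
    (H : Set (X → ℝ)) (hH : DyadicCZ.IsHaarSystem μ D H)
    (α : (X → ℝ) → ℝ) (hα : ∃ B : ℝ, ∀ h ∈ H, |α h| ≤ B) :
    ∃ P : Lp ℝ 2 μ →L[ℝ] Lp ℝ 2 μ,
      (∀ f : Lp ℝ 2 μ,
        HasSum (fun Q : DyadicCZ.splitCubes D => DyadicCZ.petermichlTerm μ D H α f Q) (P f)) ∧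
      DyadicCZ.IsCalderonZygmund (DyadicCZ.dyadicDist μ D) μ (Submodule.span ℝ H) P ∧
      (∀ (p : ℝ≥0∞) [Fact (1 ≤ p)], 1 < p → p < ⊤ → DyadicCZ.IsBoundedOnLp P p) ∧
      DyadicCZ.IsWeakTypeOneOne P := by
  obtain ⟨A, hA2, hA⟩ := hD.exists_measure_le_child hX
  -- The quadrant supplies a cube, and cubes have positive measure.
  have hμ : μ ≠ 0 := by
    rintro rfl
    obtain ⟨j, Q, hQ, -⟩ := hquad
    simpa using hD.measure_cube_pos hX ⟨j, hQ⟩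
  have T : DyadicCZ.IsRegularTree d μ lam D A :=
    ⟨hX, hD, hquad, hA2, hA, hH.measure_univ_eq_top hμ⟩
  obtain ⟨B, hB⟩ := hα
  have hA0 : 0 < A := by linarith
  have hu := hH.isAtomFamily_haarSum T (β := 1) zero_le_one fun h _ => by simp
  have hv := hH.isAtomFamily_childHaarSum T (abs_nonneg B)
    fun h hh => (hB h hh).trans (le_abs_self B)
  obtain ⟨P, hP⟩ := hu.exists_hasSum T hv
  refine ⟨P, fun f => ?_, DyadicCZ.isCalderonZygmund_of_hasSum T hH hu hv (by positivity)
    (by positivity) hP, fun p _ hp1 hp => hH.isBoundedOnLp_of_hasSum T hu hv hP hp1 hp,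
    DyadicCZ.isWeakTypeOneOne_of_bound (C := 2 * (A * (1 + ‖P‖ ^ 2))) (by positivity)
      fun F hF t ht => hH.measure_lt_abs_le_of_integrable T hu hv hP F hF ht⟩
  simpa only [hH.petermichlTerm_eq T] using hP f
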